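/- Let $f:\mathbb R\to\mathbb R$ be $C^\infty$ and let $u(x,t)=\hat u(x-ct)$ be a ($C^2$) travelling wave solution of $u_t=u_{xx}+f(u)$ with limits $\hat u_\pm=\lim_{\xi\to\pm\infty}\hat u(\xi)$. Put $\phi(\xi)=f'(\hat u(\xi))$ and assume that $\phi(\xi)-f'(\hat u_\pm)\to0$ exponentially fast as $\xi\to\pm\infty$. For $\lambda\in\mathbb C$ let $$A(\xi;\lambda)=\begin{bmatrix}0&1\\ \lambda-\phi(\xi)&-c\end{bmatrix},\quad \kappa_\pm=\sqrt{c^2+4(\lambda-f'(\hat u_\pm))},\quad \mu_\pm^{[1]}=\tfrac12(-c+\kappa_\pm),\quad \mu_\pm^{[2]}=\tfrac12(-c-\kappa_\pm),\quad B_\pm=\begin{bmatrix}1&1\\ \mu_\pm^{[1]}&\mu_\pm^{[2]}\end{bmatrix}$$ (principal square root). Let $y_-$, $y_+$ be the solutions of $y'=A(\xi;\lambda)y$ on $\mathbb R$ with $e^{-\mu_-^{[1]}\xi}y_-(\xi)\to(1,\mu_-^{[1]})^\top$ as $\xi\to-\infty$ and $e^{-\mu_+^{[2]}\xi}y_+(\xi)\to(1,\mu_+^{[2]})^\top$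 as $\xi\to+\infty$, and let $D(\lambda)=\det[\,y_-(0)\mid y_+(0)\,]$ be the Evans function. Write $y_-=e^{\mu_-^{[1]}\xi}B_-\bar y_-$ and $y_+=e^{\mu_+^{[2]}\xi}B_+\bar y_+$, so that $\bar y_\pm'=\bar A_\pm(\xi)\bar y_\pm$ with $\bar A_-=B_-^{-1}AB_--\mu_-^{[1]}I$ and $\bar A_+=B_+^{-1}AB_+-\mu_+^{[2]}I$. For $h>0$, $N\in\mathbb N$ and $L=Nh$, the two-stage Gauss–Legendre Runge–Kutta method with constant step $h$ is applied to the transformed equations: $N$ steps forwards from $-L$ to $0$ for $\bar y_-$, and $N$ steps backwards from $L$ to $0$ for $\bar y_+$, starting from the exact values $\bar y_-(-L)$ and $\bar y_+(L)$. Let $\bar y^{\rm num}_\pm$ be the results at $\xi=0$, and $$D_{\rm num}(\lambda)=\det[\,B_-\bar y^{\rm num}_-\mid B_+\bar y^{\rm num}_+\,],\qquad E_D=D(\lambda)-D_{\rm num}(\lambda).$$ Let, moreover, $$Q_{h,N}=\tfrac12h\sum_{j=-N}^{N-1}\Bigl(\phi\bigl(jh+(\tfrac12-\tfrac16\sqrt3)h\bigr)+\phi\bigl(jh+(\tfrac12+\tfrac16\sqrt3)h\bigr)\Bigr)-\int_{-L}^{L}\phi(x)\,dx$$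 be the error of the composite two-point Gauss quadrature rule for $\phi$ on $[-L,L]$, which does not depend on $\lambda$. Fix $\varepsilon>0$. Constants below depend only on $f,\hat u,c,\varepsilon$ and on what is indicated. In the regime $|\arg\kappa_\pm|<\frac12\pi-\varepsilon$, $h|\kappa_\pm|\ge K$: 1. There are $C,K,h_0>0$ such that for all $0<h\le h_0$, all $N$ and all $\lambda$ in the regime, $$|E_D|\le C\bigl(|\lambda|^{-1/2}h^8+|\lambda|^{-1}h^4+|\lambda|^{-3/2}h^2+|Q_{h,N}|\bigr).$$ 2. The quadrature error is negligible: for every $m\in\mathbb N$ there are $C_m,\theta_m>0$ with $|Q_{h,N}|\le C_m\bigl(h^m+e^{-\theta_mL}\bigr)$ for all $0<h\le1$ and all $N$. 3. Consequently, if $L$ is sufficiently large, $E_D=O(\lambda^{-1/2}h^8,\ \lambda^{-1}h^4,\ \lambda^{-3/2}h^2)$, in the following sense: for every $p\in\mathbb N$ there are $C,K,h_0,M>0$, depending also on $p$, such that for all $0<h\le h_0$, all $\lambda$ in the regime with $|\lambda|\le h^{-p}$ and all $N$ with $L=Nh\ge M\log(1/h)$, $$|E_D|\le C\bigl(|\lambda|^{-1/2}h^8+|\lambda|^{-1}h^4+|\lambda|^{-3/2}h^2\bigr).$$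 -/

import Mathlib

open Filter Topology
open scoped ContDiff Matrix

noncomputable section

namespace EvansGL

/-- `u(x,t) = U(x - c t)` is a travelling wave solution of `u_t = u_xx + f(u)`, of class `C²`,
with limits `um` at `-∞` and `up` at `+∞`. -/
structure IsTravellingWave (f : ℝ → ℝ) (c : ℝ) (U : ℝ → ℝ) (um up : ℝ) : Prop where
  contDiff : ContDiff ℝ 2 U
  pde : ∀ x t : ℝ, deriv (fun s => U (x - c * s)) t =
    iteratedDeriv 2 (fun z => U (z - c * t)) x + f (U (x - c * t))
  tendsto_atBot : Tendsto U atBot (𝓝 um)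
  tendsto_atTop : Tendsto U atTop (𝓝 up)

/-- `φ(ξ) = f'(U(ξ))`. -/
def phi (f U : ℝ → ℝ) (ξ : ℝ) : ℝ := deriv f (U ξ)

/-- `φ` approaches its limits `f'(um)` and `f'(up)` exponentially fast. -/
def PhiDecaysExponentially (f U : ℝ → ℝ) (um up : ℝ) : Prop :=
  ∃ C θ : ℝ, 0 < θ ∧
    (∀ ξ ≤ 0, |phi f U ξ - deriv f um| ≤ C * Real.exp (θ * ξ)) ∧
    (∀ ξ ≥ 0, |phi f U ξ - deriv f up| ≤ C * Real.exp (-(θ * ξ)))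

/-- The coefficient matrix `A(ξ; λ)` of the eigenvalue problem `y' = A(ξ; λ) y`. -/
def A (f : ℝ → ℝ) (c : ℝ) (U : ℝ → ℝ) (lam : ℂ) (ξ : ℝ) : Matrix (Fin 2) (Fin 2) ℂ :=
  !![0, 1; lam - ((phi f U ξ : ℝ) : ℂ), -(c : ℂ)]

/-- `κ = √(c² + 4(λ - f'(u₀)))`, principal branch; `u₀` is one of the limits of the wave. -/
def kappa (f : ℝ → ℝ) (c u₀ : ℝ) (lam : ℂ) : ℂ :=
  Complex.sqrt ((c : ℂ) ^ 2 + 4 * (lam - ((deriv f u₀ : ℝ) : ℂ)))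

/-- `μ^{[1]} = (-c + κ) / 2`. -/
def mu1 (f : ℝ → ℝ) (c u₀ : ℝ) (lam : ℂ) : ℂ := (-(c : ℂ) + kappa f c u₀ lam) / 2

/-- `μ^{[2]} = (-c - κ) / 2`. -/
def mu2 (f : ℝ → ℝ) (c u₀ : ℝ) (lam : ℂ) : ℂ := (-(c : ℂ) - kappa f c u₀ lam) / 2

/-- The matrix `B` of eigenvectors of the limiting coefficient matrix. -/
def B (f : ℝ → ℝ) (c u₀ : ℝ) (lam : ℂ) : Matrix (Fin 2) (Fin 2) ℂ :=
  !![1, 1; mu1 f c u₀ lam, mu2 f c u₀ lam]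

/-- `y' = A(ξ; λ) y` on the whole line. -/
def IsSolution (f : ℝ → ℝ) (c : ℝ) (U : ℝ → ℝ) (lam : ℂ) (y : ℝ → Fin 2 → ℂ) : Prop :=
  ∀ ξ : ℝ, HasDerivAt y (A f c U lam ξ *ᵥ y ξ) ξ

/-- The solution `y₋`: `y₋(ξ) ~ exp(μ₋^{[1]} ξ) (1, μ₋^{[1]})ᵀ` as `ξ → -∞`. -/
def IsLeftSolution (f : ℝ → ℝ) (c : ℝ) (U : ℝ → ℝ) (um : ℝ) (lam : ℂ)
    (y : ℝ → Fin 2 → ℂ) : Prop :=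
  IsSolution f c U lam y ∧
    Tendsto (fun ξ : ℝ => Complex.exp (-(mu1 f c um lam * (ξ : ℂ))) • y ξ) atBot
      (𝓝 ![1, mu1 f c um lam])

/-- The solution `y₊`: `y₊(ξ) ~ exp(μ₊^{[2]} ξ) (1, μ₊^{[2]})ᵀ` as `ξ → +∞`. -/
def IsRightSolution (f : ℝ → ℝ) (c : ℝ) (U : ℝ → ℝ) (up : ℝ) (lam : ℂ)
    (y : ℝ → Fin 2 → ℂ) : Prop :=
  IsSolution f c U lam y ∧
    Tendsto (fun ξ : ℝ => Complex.exp (-(mu2 f c up lam * (ξ : ℂ))) • y ξ) atTop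
      (𝓝 ![1, mu2 f c up lam])

/-- The transformed coefficient matrix `B⁻¹ A(ξ) B - μ I`, to be used with
`u₀ = um`, `μ = μ₋^{[1]}` on the left and `u₀ = up`, `μ = μ₊^{[2]}` on the right. -/
def Abar (f : ℝ → ℝ) (c : ℝ) (U : ℝ → ℝ) (u₀ : ℝ) (μ lam : ℂ) (ξ : ℝ) :
    Matrix (Fin 2) (Fin 2) ℂ :=
  (B f c u₀ lam)⁻¹ * A f c U lam ξ * B f c u₀ lam - μ • (1 : Matrix (Fin 2) (Fin 2) ℂ)

/-- One step, of signed length `η` and starting at `ξ`, of the two-stage Gauss--Legendre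
Runge--Kutta method for `w' = M(ξ) w`. -/
def IsGaussLegendreStep (M : ℝ → Matrix (Fin 2) (Fin 2) ℂ) (η ξ : ℝ)
    (w w' : Fin 2 → ℂ) : Prop :=
  ∃ s₁ s₂ : Fin 2 → ℂ,
    s₁ = M (ξ + (1 / 2 - √3 / 6) * η) *ᵥ
      (w + (1 / 4 * η) • s₁ + ((1 / 4 - √3 / 6) * η) • s₂) ∧
    s₂ = M (ξ + (1 / 2 + √3 / 6) * η) *ᵥ
      (w + ((1 / 4 + √3 / 6) * η) • s₁ + (1 / 4 * η) • s₂) ∧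
    w' = w + (1 / 2 * η) • (s₁ + s₂)

/-- The vectors `w 0, …, w N` are computed by `N` steps of the method with constant signed
step `η`, starting at the point `ξ₀`. -/
def IsGaussLegendreRun (M : ℝ → Matrix (Fin 2) (Fin 2) ℂ) (η ξ₀ : ℝ) (N : ℕ)
    (w : ℕ → Fin 2 → ℂ) : Prop :=
  ∀ k < N, IsGaussLegendreStep M η (ξ₀ + k * η) (w k) (w (k + 1))

/-- The wedge product of two vectors in `ℂ²`. -/
def wedge (a b : Fin 2 → ℂ) : ℂ := Matrix.det !![a 0, b 0; a 1, b 1]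

/-- `E` is the error `E_D = D(λ) - D_num(λ)` in the Evans function when `y₋` is computed on
`[-L, 0]` (forwards) and `y₊` on `[0, L]` (backwards), `L = N h`, with `N` Gauss--Legendre steps of
length `h` each in the coordinates `y₋ = exp(μ₋^{[1]} ξ) B₋ w`, `y₊ = exp(μ₊^{[2]} ξ) B₊ w`,
starting from the exact values at `∓L`. -/
def IsEvansError (f : ℝ → ℝ) (c : ℝ) (U : ℝ → ℝ) (um up : ℝ) (lam : ℂ) (h : ℝ) (N : ℕ)
    (E : ℂ) : Prop :=
  ∃ (ym yp : ℝ → Fin 2 → ℂ) (wm wp : ℕ → Fin 2 → ℂ),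
    IsLeftSolution f c U um lam ym ∧
    IsRightSolution f c U up lam yp ∧
    ym (-(N * h)) =
      Complex.exp (mu1 f c um lam * ((-(N * h) : ℝ) : ℂ)) • (B f c um lam *ᵥ wm 0) ∧
    yp (N * h) =
      Complex.exp (mu2 f c up lam * ((N * h : ℝ) : ℂ)) • (B f c up lam *ᵥ wp 0) ∧
    IsGaussLegendreRun (Abar f c U um (mu1 f c um lam) lam) h (-(N * h)) N wm ∧
    IsGaussLegendreRun (Abar f c U up (mu2 f c up lam) lam) (-h) (N * h) N wp ∧
    E = wedge (ym 0) (yp 0) - wedge (B f c um lam *ᵥ wm N) (B f c up lam *ᵥ wp N)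

/-- The error of the composite two-point Gauss--Legendre quadrature rule, with `2 N` panels of
length `h`, for the integral of `φ` over `[-N h, N h]`. -/
def quadError (f U : ℝ → ℝ) (h : ℝ) (N : ℕ) : ℝ :=
  1 / 2 * h * (∑ j ∈ Finset.Ico (-(N : ℤ)) (N : ℤ),
    (phi f U (j * h + (1 / 2 - √3 / 6) * h) + phi f U (j * h + (1 / 2 + √3 / 6) * h)))
  - ∫ x in (-(N * h))..(N * h), phi f U x

/-- `λ` lies in the regime `|arg κ_±| < π/2 - ε`, `|κ_±| ≥ K / h`. -/
def InRegime (f : ℝ → ℝ) (c um up ε K h : ℝ) (lam : ℂ) : Prop :=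
  |(kappa f c um lam).arg| < Real.pi / 2 - ε ∧ |(kappa f c up lam).arg| < Real.pi / 2 - ε ∧
  K ≤ h * ‖kappa f c um lam‖ ∧ K ≤ h * ‖kappa f c up lam‖

/-- `|λ|^{-1/2} h⁸ + |λ|^{-1} h⁴ + |λ|^{-3/2} h²`. -/
def rate (lam : ℂ) (h : ℝ) : ℝ :=
  ‖lam‖ ^ (-(1 / 2) : ℝ) * h ^ 8 + ‖lam‖ ^ (-1 : ℝ) * h ^ 4 + ‖lam‖ ^ (-(3 / 2) : ℝ) * h ^ 2

end EvansGL

end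

open EvansGL

noncomputable section

namespace EvansGL

/-! ### Taylor expansion and exponentially decaying smooth functions -/

/-! In the eigenvector basis of the limiting matrix, with the exponential factor removed, both
half-lines (the right one after a reflection) carry the same system `a' = -(ψ/κ)(a+b)`, `b' = -κ b +
(ψ/κ)(a+b)`. Here `ψ` is `φ` minus its limit; it decays exponentially with all derivatives. The
solution with `a → 1`, `b → 0` at `-∞` follows a slow manifold `b = r a`, where `r' + κ r =
(ψ/κ)(1+r)²`. Truncating the expansion of `r` in powers of `κ⁻¹` leaves a defect `O(κ⁻⁴)`
(`slow_defect_le`). Hence `a(0)` is `exp(-∫ψ(1+r)/κ)` times `a(-L)` up to `O(κ⁻⁶)` (`exact_side`).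

For large `|hκ|` the stability function of the Gauss method is close to `1` in modulus, but in the
sector it stays below `1` by a multiple of `1/|hκ|` (`norm_one_sub_div_stabDen_le`). This weak
damping bounds the sum of the deviations `β - rα` over all steps, independently of `N`. Up to small
terms, each step multiplies `α` by the exponential of the Gauss quadrature of `-ψ(1+r)/κ`
(`pair_step`, `discrete_propagation`). So exact and numerical exponents differ by quadrature errors:
`one_sided` gives `α_N = a(0)(1 - Q/κ)` up to `h⁸κ⁻² + h⁴κ⁻³ + h²κ⁻⁴`, where `Q = O(h⁴)` is the
one-sided quadrature error of `ψ`. The first term contains the square of `Q/κ`, the second the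
quadrature errors of the terms `ψr/κ`.

In the wedge product the leading term carries the factor `(κ₋+κ₊)/2 ~ |λ|^{1/2}`, which turns these
remainders into the stated rate. The two terms `Q₋/κ₋` and `Q₊/κ₊` combine: `1/κ₊ - 1/κ₋ =
O(|λ|^{-3/2})`, so after multiplication by that factor only `Q₋ + Q₊` survives outside the rate
(`evans_error_le`), and this is the error of the rule on the whole interval
(`quadError_eq_halfErr_add`). Although each part is only `O(h⁴)`, the sum is smaller than any power
of `h` up to exponentially small end terms, by an Euler–Maclaurin argument for the smooth, decaying
function `φ'` (`negligible_quadError`). If `|λ|` is bounded by a power of `1/h`, the rate is at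
least a power of `h` and absorbs it (`rate_lower`). -/

/-- The derivative in `t` of the remainder of order `n + 1` is the remainder of order `n` of the
shifted sequence, so induction and the mean value inequality suffice. Working with a sequence of
successive derivatives lets the same bound apply to a primitive as well as to higher derivatives. -/
theorem taylor_bound (n : ℕ) : ∀ (G : ℕ → ℝ → ℝ) (_ : ∀ i x, HasDerivAt (G i) (G (i + 1) x) x)
    {x M t : ℝ} (_ : 0 ≤ t) (_ : ∀ y ∈ Set.Icc x (x + t), |G n y| ≤ M),
    |G 0 (x + t) - ∑ i ∈ Finset.range n, G i x * (t ^ i / i.factorial)| ≤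
      M * (t ^ n / n.factorial) := by
  induction n with
  | zero =>
    intro G _ x M t ht hM
    simpa using hM (x + t) ⟨by linarith, le_rfl⟩
  | succ n ih =>
    intro G hG x M t ht hM
    have hderiv : ∀ τ, HasDerivAt
        (fun τ => G 0 (x + τ) - ∑ i ∈ Finset.range (n + 1), G i x * (τ ^ i / i.factorial))
        (G 1 (x + τ) - ∑ i ∈ Finset.range n, G (i + 1) x * (τ ^ i / i.factorial)) τ := by
      intro τ
      have h1 : HasDerivAt (fun τ => G 0 (x + τ)) (G 1 (x + τ)) τ := by
        simpa using (hG 0 (x + τ)).comp_const_add x τ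
      refine h1.sub ?_
      have h2 : ∀ i ∈ Finset.range (n + 1), HasDerivAt (fun τ : ℝ => G i x * (τ ^ i / i.factorial))
          (G i x * ((i * τ ^ (i - 1)) / i.factorial)) τ := fun i _ =>
        ((hasDerivAt_pow i τ).div_const _).const_mul _
      refine (HasDerivAt.fun_sum h2).congr_deriv ?_
      rw [Finset.sum_range_succ']
      simp only [Nat.cast_zero, zero_mul, zero_div, mul_zero, add_zero]
      refine Finset.sum_congr rfl fun i _ => ?_
      rw [Nat.factorial_succ]
      have : (i.factorial : ℝ) ≠ 0 := by positivity
      push_cast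
      field_simp
    have hB : ∀ τ : ℝ, HasDerivAt (fun τ : ℝ => M * (τ ^ (n + 1) / (n + 1).factorial))
        (M * (τ ^ n / n.factorial)) τ := by
      intro τ
      refine (((hasDerivAt_pow (n + 1) τ).div_const _).const_mul _).congr_deriv ?_
      rw [Nat.factorial_succ]
      have : (n.factorial : ℝ) ≠ 0 := by positivity
      push_cast
      field_simp
    have := image_norm_le_of_norm_deriv_right_le_deriv_boundary (a := 0) (b := t)
      (f := fun τ => G 0 (x + τ) - ∑ i ∈ Finset.range (n + 1), G i x * (τ ^ i / i.factorial))
      (fun τ _ => (hderiv τ).continuousAt.continuousWithinAt)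
      (fun τ _ => (hderiv τ).hasDerivWithinAt) (B := fun τ => M * (τ ^ (n + 1) / (n + 1).factorial))
      (by simp [Finset.sum_range_succ']) hB
      (fun τ hτ => by
        rw [Real.norm_eq_abs]
        refine ih (fun i => G (i + 1)) (fun i => hG (i + 1)) hτ.1 fun y hy => hM y ?_
        exact ⟨hy.1, hy.2.trans (by linarith [hτ.2])⟩)
      (x := t) ⟨ht, le_rfl⟩
    simpa [Real.norm_eq_abs] using this

theorem hasDerivAt_iteratedDeriv {g : ℝ → ℝ} (hg : ContDiff ℝ ∞ g) (k : ℕ) (x : ℝ) :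
    HasDerivAt (iteratedDeriv k g) (iteratedDeriv (k + 1) g x) x := by
  rw [iteratedDeriv_succ]
  exact (hg.differentiable_iteratedDeriv k (by exact_mod_cast WithTop.coe_lt_top _)).differentiableAt.hasDerivAt

theorem contDiff_iteratedDeriv {g : ℝ → ℝ} (hg : ContDiff ℝ ∞ g) (k : ℕ) :
    ContDiff ℝ ∞ (iteratedDeriv k g) := by
  rw [iteratedDeriv_eq_iterate]
  exact hg.iterate_deriv k

theorem contDiffAt_nat {g : ℝ → ℝ} (hg : ContDiff ℝ ∞ g) (k : ℕ) (x : ℝ) :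
    ContDiffAt ℝ (k : WithTop ℕ∞) g x :=
  (hg.of_le (by exact_mod_cast le_top)).contDiffAt

theorem iteratedDeriv_iteratedDeriv (g : ℝ → ℝ) (j k : ℕ) :
    iteratedDeriv j (iteratedDeriv k g) = iteratedDeriv (j + k) g := by
  simp only [iteratedDeriv_eq_iterate, Function.iterate_add_apply]

/-- Smooth functions that decay exponentially at `-∞`, together with all derivatives. -/
def LeftDecay (g : ℝ → ℝ) : Prop :=
  ContDiff ℝ ∞ g ∧ ∀ k : ℕ, ∃ C θ : ℝ, 0 < θ ∧ ∀ x ≤ 0, |iteratedDeriv k g x| ≤ C * Real.exp (θ * x)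

theorem exp_bound_mono {C C' θ θ' x : ℝ} (hC : C ≤ C') (hC' : 0 ≤ C') (hθ : θ' ≤ θ) (hx : x ≤ 0) :
    C * Real.exp (θ * x) ≤ C' * Real.exp (θ' * x) := by
  refine (mul_le_mul_of_nonneg_right hC (Real.exp_pos _).le).trans
    (mul_le_mul_of_nonneg_left (Real.exp_le_exp.2 ?_) hC')
  exact mul_le_mul_of_nonpos_right hθ hx

theorem LeftDecay.iteratedDeriv {g : ℝ → ℝ} (hg : LeftDecay g) (j : ℕ) :
    LeftDecay (iteratedDeriv j g) :=
  ⟨contDiff_iteratedDeriv hg.1 j, fun k => by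
    rw [iteratedDeriv_iteratedDeriv]; exact hg.2 _⟩

theorem LeftDecay.deriv {g : ℝ → ℝ} (hg : LeftDecay g) : LeftDecay (deriv g) := by
  simpa using hg.iteratedDeriv 1

/-- Finitely many functions that decay at `-∞` have a common bound. -/
theorem LeftDecay.common_bound (l : List (ℝ → ℝ)) (n : ℕ) (hl : ∀ g ∈ l, LeftDecay g) :
    ∃ M θ : ℝ, 0 < M ∧ 0 < θ ∧ ∀ g ∈ l, ∀ k ≤ n, ∀ x ≤ 0,
      |_root_.iteratedDeriv k g x| ≤ M * Real.exp (θ * x) := by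
  have one : ∀ (g : ℝ → ℝ), LeftDecay g → ∀ n : ℕ, ∃ M θ : ℝ, 0 < M ∧ 0 < θ ∧ ∀ k ≤ n, ∀ x ≤ 0,
      |_root_.iteratedDeriv k g x| ≤ M * Real.exp (θ * x) := by
    intro g hg n
    induction n with
    | zero =>
      obtain ⟨C, θ, hθ, h⟩ := hg.2 0
      refine ⟨max C 1, θ, by positivity, hθ, fun k hk x hx => ?_⟩
      obtain rfl : k = 0 := by omega
      exact (h x hx).trans (exp_bound_mono (le_max_left _ _) (by positivity) le_rfl hx)
    | succ n ih =>
      obtain ⟨M, θ, hM, hθ, h⟩ := ih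
      obtain ⟨C, θ', hθ', h'⟩ := hg.2 (n + 1)
      refine ⟨max C M, min θ θ', lt_max_of_lt_right hM, lt_min hθ hθ', fun k hk x hx => ?_⟩
      rcases Nat.lt_or_ge k (n + 1) with hk' | hk'
      · exact (h k (by omega) x hx).trans
          (exp_bound_mono (le_max_right _ _) (le_max_of_le_right hM.le) (min_le_left _ _) hx)
      · obtain rfl : k = n + 1 := by omega
        exact (h' x hx).trans
          (exp_bound_mono (le_max_left _ _) (le_max_of_le_right hM.le) (min_le_right _ _) hx)
  induction l with
  | nil => exact ⟨1, 1, one_pos, one_pos, by simp⟩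
  | cons g l ih =>
    obtain ⟨M, θ, hM, hθ, h⟩ := ih fun g hg => hl g (List.mem_cons_of_mem _ hg)
    obtain ⟨M', θ', hM', hθ', h'⟩ := one g (hl g List.mem_cons_self) n
    refine ⟨max M M', min θ θ', lt_max_of_lt_left hM, lt_min hθ hθ', fun f hf k hk x hx => ?_⟩
    rcases List.mem_cons.1 hf with rfl | hf
    · exact (h' k hk x hx).trans
        (exp_bound_mono (le_max_right _ _) (le_max_of_le_left hM.le) (min_le_right _ _) hx)
    · exact (h f hf k hk x hx).trans
        (exp_bound_mono (le_max_left _ _) (le_max_of_le_left hM.le) (min_le_left _ _) hx)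

theorem LeftDecay.add {f g : ℝ → ℝ} (hf : LeftDecay f) (hg : LeftDecay g) :
    LeftDecay (fun x => f x + g x) := by
  refine ⟨hf.1.add hg.1, fun k => ?_⟩
  obtain ⟨M, θ, hM, hθ, h⟩ := LeftDecay.common_bound [f, g] k (by simp [hf, hg])
  refine ⟨2 * M, θ, hθ, fun x hx => ?_⟩
  have := iteratedDeriv_add (contDiffAt_nat hf.1 k x) (contDiffAt_nat hg.1 k x)
  rw [show (fun x => f x + g x) = f + g from rfl, this]
  have h1 := h f (by simp) k le_rfl x hx
  have h2 := h g (by simp) k le_rfl x hx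
  linarith [abs_add_le (_root_.iteratedDeriv k f x) (_root_.iteratedDeriv k g x)]

theorem LeftDecay.mul {f g : ℝ → ℝ} (hf : LeftDecay f) (hg : LeftDecay g) :
    LeftDecay (fun x => f x * g x) := by
  refine ⟨hf.1.mul hg.1, fun k => ?_⟩
  obtain ⟨M, θ, hM, hθ, h⟩ := LeftDecay.common_bound [f, g] k (by simp [hf, hg])
  refine ⟨∑ i ∈ Finset.range (k + 1), (k.choose i : ℝ) * M * M, θ, hθ, fun x hx => ?_⟩
  have := iteratedDeriv_mul (contDiffAt_nat hf.1 k x) (contDiffAt_nat hg.1 k x)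
  rw [show (fun x => f x * g x) = f * g from rfl, this, Finset.sum_mul]
  refine (Finset.abs_sum_le_sum_abs _ _).trans (Finset.sum_le_sum fun i hi => ?_)
  have hi' : i ≤ k := by simpa [Nat.lt_succ_iff] using hi
  have h1 := h f (by simp) i hi' x hx
  have h2 := h g (by simp) (k - i) (by omega) x hx
  -- One of the two exponentials in each Leibniz term is enough; the other is bounded by one.
  have he : Real.exp (θ * x) ≤ 1 := Real.exp_le_one_iff.2 (mul_nonpos_of_nonneg_of_nonpos hθ.le hx)
  rw [abs_mul, abs_mul, Nat.abs_cast, mul_assoc, mul_assoc, mul_assoc]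
  refine mul_le_mul_of_nonneg_left ?_ (by positivity)
  refine mul_le_mul (h1.trans ?_) h2 (abs_nonneg _) hM.le
  exact mul_le_of_le_one_right hM.le he

theorem LeftDecay.const_mul {f : ℝ → ℝ} (hf : LeftDecay f) (c : ℝ) :
    LeftDecay (fun x => c * f x) := by
  refine ⟨contDiff_const.mul hf.1, fun k => ?_⟩
  obtain ⟨C, θ, hθ, h⟩ := hf.2 k
  refine ⟨|c| * C, θ, hθ, fun x hx => ?_⟩
  rw [iteratedDeriv_const_mul _ (contDiffAt_nat hf.1 k x), abs_mul, mul_assoc]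
  exact mul_le_mul_of_nonneg_left (h x hx) (abs_nonneg _)

/-- Landau's interpolation argument: a decaying function with a bounded second derivative has a
decaying first derivative. -/
theorem deriv_decay {G : ℕ → ℝ → ℝ} (hG : ∀ i x, HasDerivAt (G i) (G (i + 1) x) x)
    {C θ b : ℝ} (hθ : 0 < θ) (h0 : ∀ x ≤ 0, |G 0 x| ≤ C * Real.exp (θ * x))
    (h2 : ∀ x, |G 2 x| ≤ b) :
    ∀ x ≤ 0, |G 1 x| ≤ (2 * C + 2 * b) * Real.exp (θ / 2 * x) := by
  intro x hx
  -- This step length balances the two errors of the difference quotient: the values of `G 0` are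
  -- `O(s²)`, which divided by `s` matches `b * s`. The base point is `x - s`, so that only points
  -- of the left half-line occur.
  set s := Real.exp (θ / 2 * x) with hs
  have hs0 : 0 < s := Real.exp_pos _
  have hss : Real.exp (θ * x) = s * s := by rw [hs, ← Real.exp_add]; ring_nf
  have hb : 0 ≤ b := (abs_nonneg _).trans (h2 0)
  have t1 := taylor_bound 2 G hG (x := x - s) (M := b) hs0.le (fun y _ => h2 y)
  have t2 := taylor_bound 1 (fun i => G (i + 1)) (fun i => hG _) (x := x - s) (M := b) hs0.le
    (fun y _ => h2 y)
  simp only [Finset.sum_range_succ, Finset.sum_range_zero, sub_add_cancel] at t1 t2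
  norm_num at t1 t2
  have e1 := h0 x hx
  have e2 := h0 (x - s) (by linarith)
  have hC : 0 ≤ C := by
    have := (abs_nonneg _).trans e1
    exact nonneg_of_mul_nonneg_left this (Real.exp_pos _)
  have e3 : Real.exp (θ * (x - s)) ≤ s * s := by
    rw [← hss]; exact Real.exp_le_exp.2 (by nlinarith)
  have e4 := mul_le_mul_of_nonneg_left e3 hC
  rw [hss] at e1
  rw [abs_le] at *
  have key1 : s * G 1 (x - s) ≤ s * ((2 * C + b) * s) := by nlinarith
  have key2 : s * (-((2 * C + b) * s)) ≤ s * G 1 (x - s) := by nlinarith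
  have k1 := le_of_mul_le_mul_left key1 hs0
  have k2 := le_of_mul_le_mul_left key2 hs0
  constructor <;> nlinarith

/-- Induction with `deriv_decay`. The rate is halved at every order, which is why `LeftDecay` allows
the rate to depend on the order. -/
theorem leftDecay_of_bounded {g : ℝ → ℝ} (hg : ContDiff ℝ ∞ g) {C θ : ℝ} (hθ : 0 < θ)
    (h0 : ∀ x ≤ 0, |g x| ≤ C * Real.exp (θ * x))
    (hb : ∀ k : ℕ, 1 ≤ k → ∃ b, ∀ x, |iteratedDeriv k g x| ≤ b) : LeftDecay g := by
  refine ⟨hg, fun k => ?_⟩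
  induction k with
  | zero => exact ⟨C, θ, hθ, by simpa using h0⟩
  | succ k ih =>
    obtain ⟨C', θ', hθ', h⟩ := ih
    obtain ⟨b, hb⟩ := hb (k + 2) (by omega)
    exact ⟨_, θ' / 2, by positivity, deriv_decay (G := fun i => iteratedDeriv (k + i) g)
      (fun i x => hasDerivAt_iteratedDeriv hg (k + i) x) hθ' h hb⟩

/-! ### The travelling wave is smooth, with bounded derivatives -/

theorem bounded_of_tendsto {g : ℝ → ℝ} (hg : Continuous g) {l l' : ℝ}
    (h1 : Tendsto g atBot (𝓝 l)) (h2 : Tendsto g atTop (𝓝 l')) : ∃ b, ∀ x, |g x| ≤ b := by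
  obtain ⟨r, hr⟩ := eventually_atBot.1 (h1.eventually (Metric.ball_mem_nhds l one_pos))
  obtain ⟨R, hR⟩ := eventually_atTop.1 (h2.eventually (Metric.ball_mem_nhds l' one_pos))
  obtain ⟨b, hb⟩ := (isCompact_Icc (a := r) (b := R)).exists_bound_of_continuousOn hg.continuousOn
  refine ⟨max b (max (|l| + 1) (|l'| + 1)), fun x => ?_⟩
  rcases le_total x r with h | h
  · have := hr x h
    rw [Real.dist_eq] at this
    have h3 := abs_sub_abs_le_abs_sub (g x) l
    exact le_max_of_le_right (le_max_of_le_left (by linarith))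
  · rcases le_total R x with h' | h'
    · have := hR x h'
      rw [Real.dist_eq] at this
      have h3 := abs_sub_abs_le_abs_sub (g x) l'
      exact le_max_of_le_right (le_max_of_le_right (by linarith))
    · exact le_max_of_le_left (hb x ⟨h, h'⟩)

/-- The equation at time zero is already the profile equation `U'' = -c U' - f(U)`, since `x` is
arbitrary. -/
theorem IsTravellingWave.hasDerivAt_deriv {f U : ℝ → ℝ} {c um up : ℝ}
    (hU : IsTravellingWave f c U um up) (x : ℝ) :
    HasDerivAt (deriv U) (-(c * deriv U x) - f (U x)) x := by
  have hd : Differentiable ℝ (deriv U) := by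
    have := hU.contDiff.differentiable_iteratedDeriv 1 (by norm_num)
    simpa using this
  have h := hU.pde x 0
  have h1 : HasDerivAt (fun s => U (x - c * s)) (deriv U (x - c * 0) * (-c)) 0 := by
    have hUd : HasDerivAt U (deriv U (x - c * 0)) (x - c * 0) :=
      (hU.contDiff.differentiable (by norm_num)).differentiableAt.hasDerivAt
    refine hUd.comp (0 : ℝ) ?_
    simpa using ((hasDerivAt_id (0 : ℝ)).const_mul c).const_sub x
  rw [h1.deriv] at h
  simp only [mul_zero, sub_zero] at h
  have h2 : iteratedDeriv 2 U x = deriv (deriv U) x := by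
    rw [iteratedDeriv_succ, iteratedDeriv_one]
  rw [h2] at h
  refine (hd x).hasDerivAt.congr_deriv ?_
  linarith

/-- The function `U' + c U` has the bounded derivative `-f(U)`. On `[x, x + 1]` the mean value
theorem supplies a point where `U'` is at most `2b`, and the bound is carried from there to `x` over
a distance of at most one. -/
theorem IsTravellingWave.bounded_deriv {f U : ℝ → ℝ} {c um up : ℝ} (hf : Continuous f)
    (hU : IsTravellingWave f c U um up) : ∃ b, ∀ x, |U x| ≤ b ∧ |deriv U x| ≤ b := by
  obtain ⟨b, hb⟩ := bounded_of_tendsto hU.contDiff.continuous hU.tendsto_atBot hU.tendsto_atTop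
  have hb0 : 0 ≤ b := (abs_nonneg _).trans (hb 0)
  obtain ⟨m, hm⟩ := (isCompact_Icc (a := -b) (b := b)).exists_bound_of_continuousOn hf.continuousOn
  have hm' : ∀ x, |f (U x)| ≤ m := fun x => hm _ (abs_le.1 (hb x))
  have hUd : ∀ x, HasDerivAt U (deriv U x) x := fun x =>
    (hU.contDiff.differentiable (by norm_num)).differentiableAt.hasDerivAt
  refine ⟨2 * b + 2 * |c| * b + m + b, fun x => ⟨?_, ?_⟩⟩
  · have := hb x
    have := hm' x
    nlinarith [abs_nonneg c, abs_nonneg (f (U x)), mul_nonneg (abs_nonneg c) hb0]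
  obtain ⟨ξ, hξ, hξ'⟩ := exists_deriv_eq_slope U (a := x) (b := x + 1) (by linarith)
    hU.contDiff.continuous.continuousOn (hU.contDiff.differentiable (by norm_num)).differentiableOn
  have hV : ∀ y, HasDerivAt (fun y => deriv U y + c * U y) (-f (U y)) y := fun y =>
    ((hU.hasDerivAt_deriv y).add ((hUd y).const_mul c)).congr_deriv (by ring)
  have h1 := (convex_univ (𝕜 := ℝ) (E := ℝ)).norm_image_sub_le_of_norm_hasDerivWithin_le
    (f := fun y => deriv U y + c * U y) (f' := fun y => -f (U y)) (C := m) (x := ξ) (y := x)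
    (fun y _ => (hV y).hasDerivWithinAt) (fun y _ => by simpa using hm' y) trivial trivial
  simp only [Real.norm_eq_abs] at h1
  have h2 : |x - ξ| ≤ 1 := by rw [abs_le]; constructor <;> linarith [hξ.1, hξ.2]
  have hm0 : 0 ≤ m := (abs_nonneg _).trans (hm' 0)
  have h3 : m * |x - ξ| ≤ m := mul_le_of_le_one_right hm0 h2
  have h4 : |deriv U ξ| ≤ 2 * b := by
    rw [hξ', show x + 1 - x = 1 by ring, div_one]
    linarith [abs_sub (U (x + 1)) (U x), hb x, hb (x + 1)]
  have h5 : ∀ y, |c * U y| ≤ |c| * b := fun y => by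
    rw [abs_mul]; exact mul_le_mul_of_nonneg_left (hb y) (abs_nonneg _)
  have h6 := h5 x
  have h7 := h5 ξ
  rw [abs_le] at *
  constructor <;> linarith

/-- The derivatives of a smooth function of `(U, U')` are again smooth functions of `(U, U')`. -/
theorem IsTravellingWave.exists_iteratedDeriv {f U : ℝ → ℝ} {c um up : ℝ} (hf : ContDiff ℝ ∞ f)
    (hU : IsTravellingWave f c U um up) (k : ℕ) : ∀ G : ℝ × ℝ → ℝ, ContDiff ℝ ∞ G →
    ∃ H : ℝ × ℝ → ℝ, ContDiff ℝ ∞ H ∧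
      iteratedDeriv k (fun x => G (U x, deriv U x)) = fun x => H (U x, deriv U x) := by
  induction k with
  | zero => exact fun G hG => ⟨G, hG, by simp⟩
  | succ k ih =>
    intro G hG
    have hd : ∀ x, HasDerivAt (fun x => G (U x, deriv U x))
        (fderiv ℝ G (U x, deriv U x) (deriv U x, -(c * deriv U x) - f (U x))) x := fun x =>
      ((hG.differentiable (by simp)).differentiableAt (x := (U x, deriv U x))).hasFDerivAt.comp_hasDerivAt x
        (((hU.contDiff.differentiable (by norm_num)).differentiableAt.hasDerivAt).prodMk
          (hU.hasDerivAt_deriv x))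
    obtain ⟨H, hH, h⟩ := ih (fun p => fderiv ℝ G p (p.2, -(c * p.2) - f p.1)) (by
      refine (hG.fderiv_right (m := ∞) (by simp)).clm_apply ?_
      exact contDiff_snd.prodMk ((contDiff_const.mul contDiff_snd).neg.sub (hf.comp contDiff_fst)))
    refine ⟨H, hH, ?_⟩
    rw [iteratedDeriv_succ', ← h]
    congr 1
    exact funext fun x => (hd x).deriv

/-- The wave is only assumed `C²`, so smoothness is bootstrapped: every derivative of `φ` is a
smooth function of `(U, U')`, and this pair is differentiable by the profile equation. -/
theorem IsTravellingWave.contDiff_phi {f U : ℝ → ℝ} {c um up : ℝ} (hf : ContDiff ℝ ∞ f)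
    (hU : IsTravellingWave f c U um up) : ContDiff ℝ ∞ (phi f U) := by
  have hUd : Differentiable ℝ U := hU.contDiff.differentiable (by norm_num)
  have hVd : Differentiable ℝ (deriv U) := fun x => (hU.hasDerivAt_deriv x).differentiableAt
  have hf' : ContDiff ℝ ∞ (deriv f) := (contDiff_infty_iff_deriv.1 hf).2
  rw [contDiff_infty]
  intro n
  refine (contDiff_of_differentiable_iteratedDeriv (n := (n : ℕ∞)) fun m _ => ?_)
  obtain ⟨H, hH, h⟩ := hU.exists_iteratedDeriv hf m (fun p => deriv f p.1) (hf'.comp contDiff_fst)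
  change Differentiable ℝ (iteratedDeriv m (fun x => deriv f (U x)))
  rw [h]
  exact (hH.differentiable (by simp)).comp (hUd.prodMk hVd)

/-- The pair `(U, U')` stays in a compact square, on which the smooth function representing the
derivative is bounded. -/
theorem IsTravellingWave.bounded_iteratedDeriv_phi {f U : ℝ → ℝ} {c um up : ℝ}
    (hf : ContDiff ℝ ∞ f) (hU : IsTravellingWave f c U um up) (k : ℕ) :
    ∃ b, ∀ x, |iteratedDeriv k (phi f U) x| ≤ b := by
  have hf' : ContDiff ℝ ∞ (deriv f) := (contDiff_infty_iff_deriv.1 hf).2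
  obtain ⟨H, hH, h⟩ := hU.exists_iteratedDeriv hf k (fun p => deriv f p.1) (hf'.comp contDiff_fst)
  obtain ⟨b, hb⟩ := hU.bounded_deriv hf.continuous
  obtain ⟨m, hm⟩ := ((isCompact_Icc (a := -b) (b := b)).prod
    (isCompact_Icc (a := -b) (b := b))).exists_bound_of_continuousOn hH.continuous.continuousOn
  refine ⟨m, fun x => ?_⟩
  change |iteratedDeriv k (fun x => deriv f (U x)) x| ≤ m
  rw [h]
  exact hm _ ⟨abs_le.1 (hb x).1, abs_le.1 (hb x).2⟩

theorem iteratedDeriv_sub_const {g : ℝ → ℝ} (k : ℕ) (v : ℝ) :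
    iteratedDeriv (k + 1) (fun x => g x - v) = iteratedDeriv (k + 1) g := by
  rw [iteratedDeriv_succ', iteratedDeriv_succ']
  congr 1
  exact funext fun x => deriv_sub_const v

/-- `φ - f'(u₋)` on the left half-line. -/
def psiLeft (f U : ℝ → ℝ) (um : ℝ) (x : ℝ) : ℝ := phi f U x - deriv f um

/-- `φ - f'(u₊)`, reflected to the left half-line. -/
def psiRight (f U : ℝ → ℝ) (up : ℝ) (x : ℝ) : ℝ := phi f U (-x) - deriv f up

/-- Decay is assumed for `φ` only; for its derivatives it follows by interpolation with their
boundedness. -/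
theorem leftDecay_psiLeft {f U : ℝ → ℝ} {c um up : ℝ} (hf : ContDiff ℝ ∞ f)
    (hU : IsTravellingWave f c U um up) (hd : PhiDecaysExponentially f U um up) :
    LeftDecay (psiLeft f U um) := by
  obtain ⟨C, θ, hθ, h, -⟩ := hd
  refine leftDecay_of_bounded ((hU.contDiff_phi hf).sub contDiff_const) hθ h fun k hk => ?_
  obtain ⟨k, rfl⟩ : ∃ j, k = j + 1 := ⟨k - 1, by omega⟩
  obtain ⟨b, hb⟩ := hU.bounded_iteratedDeriv_phi hf (k + 1)
  refine ⟨b, fun x => ?_⟩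
  change |iteratedDeriv (k + 1) (fun x => phi f U x - deriv f um) x| ≤ b
  rw [iteratedDeriv_sub_const]
  exact hb x

theorem leftDecay_psiRight {f U : ℝ → ℝ} {c um up : ℝ} (hf : ContDiff ℝ ∞ f)
    (hU : IsTravellingWave f c U um up) (hd : PhiDecaysExponentially f U um up) :
    LeftDecay (psiRight f U up) := by
  obtain ⟨C, θ, hθ, -, h⟩ := hd
  refine leftDecay_of_bounded (((hU.contDiff_phi hf).comp contDiff_neg).sub contDiff_const) hθ
    (fun x hx => by simpa [psiRight] using h (-x) (by linarith)) fun k hk => ?_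
  obtain ⟨k, rfl⟩ : ∃ j, k = j + 1 := ⟨k - 1, by omega⟩
  obtain ⟨b, hb⟩ := hU.bounded_iteratedDeriv_phi hf (k + 1)
  refine ⟨b, fun x => ?_⟩
  change |iteratedDeriv (k + 1) (fun x => (fun x => phi f U (-x)) x - deriv f up) x| ≤ b
  rw [iteratedDeriv_sub_const, iteratedDeriv_comp_neg, smul_eq_mul, abs_mul, abs_pow, abs_neg,
    abs_one, one_pow, one_mul]
  exact hb (-x)

/-! ### The composite two-point Gauss rule -/

/-- The error of the two-point Gauss rule on the panel `[x, x + h]`. -/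
def panelErr (G : ℝ → ℝ) (h x : ℝ) : ℝ :=
  h / 2 * (G (x + (1 / 2 - √3 / 6) * h) + G (x + (1 / 2 + √3 / 6) * h)) - ∫ y in x..x + h, G y

/-- The error of the two-point Gauss rule for `t ^ k / k!` on `[0, 1]`. -/
def gaussDefect (k : ℕ) : ℝ :=
  (1 / 2 * ((1 / 2 - √3 / 6) ^ k + (1 / 2 + √3 / 6) ^ k) - 1 / (k + 1)) / k.factorial

theorem sqrt_three_bounds : 1.7 ≤ √3 ∧ √3 ≤ 1.8 ∧ √3 ^ 2 = 3 := by
  refine ⟨?_, ?_, Real.sq_sqrt (by norm_num)⟩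
  · rw [Real.le_sqrt (by norm_num) (by norm_num)]; norm_num
  · rw [Real.sqrt_le_left (by norm_num)]; norm_num

/-- The two-point rule is exact for cubics, so the first term in the expansion of a panel error has
size `h ^ 5`. -/
theorem gaussDefect_eq_zero {k : ℕ} (hk : k < 4) : gaussDefect k = 0 := by
  obtain ⟨-, -, h⟩ := sqrt_three_bounds
  unfold gaussDefect
  interval_cases k
  · norm_num
  · norm_num
  · norm_num; linarith
  · norm_num; linear_combination (1 / 24) * h

theorem panelErr_expansion {G : ℝ → ℝ} (hG : ContDiff ℝ ∞ G) (n : ℕ) {h x M : ℝ} (hh : 0 ≤ h)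
    (hM : ∀ y ∈ Set.Icc x (x + h), |iteratedDeriv n G y| ≤ M) :
    |panelErr G h x - ∑ k ∈ Finset.range n, gaussDefect k * h ^ (k + 1) * iteratedDeriv k G x| ≤
      2 * M * h ^ (n + 1) := by
  obtain ⟨s1, s2, -⟩ := sqrt_three_bounds
  have hM0 : 0 ≤ M := (abs_nonneg _).trans (hM x ⟨le_rfl, by linarith⟩)
  have node : ∀ c, 0 ≤ c → c ≤ 1 →
      |G (x + c * h) - ∑ k ∈ Finset.range n, iteratedDeriv k G x * ((c * h) ^ k / k.factorial)| ≤
        M * h ^ n := by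
    intro c hc hc'
    have hch : c * h ≤ h := mul_le_of_le_one_left hh hc'
    have := taylor_bound n (fun i => iteratedDeriv i G) (hasDerivAt_iteratedDeriv hG) (x := x)
      (M := M) (t := c * h) (by positivity) (fun y hy => hM y ⟨hy.1, hy.2.trans (by linarith)⟩)
    simp only [iteratedDeriv_zero] at this
    refine this.trans (mul_le_mul_of_nonneg_left ?_ hM0)
    refine (div_le_self (by positivity) (by exact_mod_cast Nat.factorial_pos n)).trans ?_
    exact pow_le_pow_left₀ (by positivity) hch n
  have h1 := node (1 / 2 - √3 / 6) (by linarith) (by linarith)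
  have h2 := node (1 / 2 + √3 / 6) (by linarith) (by linarith)
  have h3 : |(∫ y in x..x + h, G y) -
      ∑ k ∈ Finset.range n, iteratedDeriv k G x * (h ^ (k + 1) / (k + 1).factorial)| ≤
        M * h ^ (n + 1) := by
    -- Placing the primitive of `G` in front of the derivatives makes the integral over the panel a
    -- value covered by `taylor_bound`.
    let F : ℕ → ℝ → ℝ := fun i => Nat.casesOn i (fun z => ∫ y in x..z, G y)
      (fun i => iteratedDeriv i G)
    have hF : ∀ i z, HasDerivAt (F i) (F (i + 1) z) z := fun i z => by
      cases i with
      | zero =>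
        simpa [F] using intervalIntegral.integral_hasDerivAt_right
          (hG.continuous.intervalIntegrable _ _)
          (hG.continuous.stronglyMeasurableAtFilter _ _) hG.continuous.continuousAt
      | succ i => exact hasDerivAt_iteratedDeriv hG i z
    have := taylor_bound (n + 1) F hF (x := x) (M := M) (t := h) hh hM
    rw [Finset.sum_range_succ', show F 0 x = 0 from intervalIntegral.integral_same, zero_mul,
      add_zero] at this
    refine this.trans (mul_le_mul_of_nonneg_left ?_ hM0)
    exact div_le_self (by positivity) (by exact_mod_cast Nat.factorial_pos _)
  have key : panelErr G h x -
      ∑ k ∈ Finset.range n, gaussDefect k * h ^ (k + 1) * iteratedDeriv k G x =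
      h / 2 * (G (x + (1 / 2 - √3 / 6) * h) - ∑ k ∈ Finset.range n,
        iteratedDeriv k G x * (((1 / 2 - √3 / 6) * h) ^ k / k.factorial)) +
      h / 2 * (G (x + (1 / 2 + √3 / 6) * h) - ∑ k ∈ Finset.range n,
        iteratedDeriv k G x * (((1 / 2 + √3 / 6) * h) ^ k / k.factorial)) -
      ((∫ y in x..x + h, G y) -
        ∑ k ∈ Finset.range n, iteratedDeriv k G x * (h ^ (k + 1) / (k + 1).factorial)) := by
    have : ∑ k ∈ Finset.range n, gaussDefect k * h ^ (k + 1) * iteratedDeriv k G x =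
        h / 2 * (∑ k ∈ Finset.range n,
          iteratedDeriv k G x * (((1 / 2 - √3 / 6) * h) ^ k / k.factorial)) +
        h / 2 * (∑ k ∈ Finset.range n,
          iteratedDeriv k G x * (((1 / 2 + √3 / 6) * h) ^ k / k.factorial)) -
        ∑ k ∈ Finset.range n, iteratedDeriv k G x * (h ^ (k + 1) / (k + 1).factorial) := by
      rw [Finset.mul_sum, Finset.mul_sum, ← Finset.sum_add_distrib, ← Finset.sum_sub_distrib]
      refine Finset.sum_congr rfl fun k _ => ?_
      have hk : (k.factorial : ℝ) ≠ 0 := by positivity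
      have hk' : (k : ℝ) + 1 ≠ 0 := by positivity
      rw [gaussDefect, Nat.factorial_succ, mul_pow, mul_pow]
      push_cast
      field_simp
      ring
    rw [this, panelErr]
    ring
  rw [key]
  set a := G (x + (1 / 2 - √3 / 6) * h) - ∑ k ∈ Finset.range n,
        iteratedDeriv k G x * (((1 / 2 - √3 / 6) * h) ^ k / k.factorial)
  set b := G (x + (1 / 2 + √3 / 6) * h) - ∑ k ∈ Finset.range n,
        iteratedDeriv k G x * (((1 / 2 + √3 / 6) * h) ^ k / k.factorial)
  have e1 := mul_le_mul_of_nonneg_left h1 (show 0 ≤ h / 2 by linarith)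
  have e2 := mul_le_mul_of_nonneg_left h2 (show 0 ≤ h / 2 by linarith)
  have e0 : 2 * M * h ^ (n + 1) = h / 2 * (M * h ^ n) + h / 2 * (M * h ^ n) + M * h ^ (n + 1) := by
    ring
  rw [e0]
  refine (abs_sub _ _).trans (add_le_add ((abs_add_le _ _).trans (add_le_add ?_ ?_)) h3) <;>
  rwa [abs_mul, abs_of_nonneg (show 0 ≤ h / 2 by linarith)]

/-- A left Riemann sum of an increasing exponential lies below its integral. The induction compares
the partial sum with the integral up to the next node; one step is `1 + θh ≤ exp(θh)`. The bound is
uniform in `h` and `N`, which makes `exp(θx)` usable as a summable weight. -/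
theorem sum_exp_le {θ : ℝ} (hθ : 0 < θ) (h : ℝ) (N : ℕ) :
    h * ∑ n ∈ Finset.range N, Real.exp (θ * (-(N * h) + n * h)) ≤ 1 / θ := by
  have key : ∀ m : ℕ, h * ∑ n ∈ Finset.range m, Real.exp (θ * (-(N * h) + n * h)) ≤
      Real.exp (θ * (-(N * h) + m * h)) / θ := by
    intro m
    induction m with
    | zero => simp; positivity
    | succ m ih =>
      rw [Finset.sum_range_succ, mul_add]
      have h1 : Real.exp (θ * (-(N * h) + (m + 1 : ℕ) * h)) =
          Real.exp (θ * (-(N * h) + m * h)) * Real.exp (θ * h) := by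
        rw [← Real.exp_add]; push_cast; ring_nf
      have h2 := Real.add_one_le_exp (θ * h)
      have h3 := Real.exp_pos (θ * (-(N * h) + m * h))
      rw [h1, le_div_iff₀ hθ]
      rw [le_div_iff₀ hθ] at ih
      nlinarith
  refine (key N).trans_eq ?_
  simp

theorem exp_panel_le {θ h x y : ℝ} (hθ : 0 < θ) (h1 : h ≤ 1) (hy : y ≤ x + h) :
    Real.exp (θ * y) ≤ Real.exp θ * Real.exp (θ * x) := by
  rw [← Real.exp_add]
  exact Real.exp_le_exp.2 (by nlinarith)

theorem node_le_zero {N n : ℕ} (hn : n < N) {h : ℝ} (hh : 0 < h) :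
    -(N * h) + n * h + h ≤ 0 := by
  have : (n : ℝ) + 1 ≤ N := by exact_mod_cast hn
  nlinarith

/-- The composite Gauss rule has order four on the left half-line. -/
theorem LeftDecay.sum_panelErr_le {G : ℝ → ℝ} (hG : LeftDecay G) :
    ∃ C, 0 < C ∧ ∀ (h : ℝ) (N : ℕ), 0 < h → h ≤ 1 →
      |∑ n ∈ Finset.range N, panelErr G h (-(N * h) + n * h)| ≤ C * h ^ 4 := by
  obtain ⟨M, θ, hM, hθ, hb⟩ := LeftDecay.common_bound [G] 4 (by simpa using hG)
  refine ⟨2 * M * Real.exp θ / θ, by positivity, fun h N hh h1 => ?_⟩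
  have step : ∀ n ∈ Finset.range N, |panelErr G h (-(N * h) + n * h)| ≤
      2 * (M * (Real.exp θ * Real.exp (θ * (-(N * h) + n * h)))) * h ^ 5 := by
    intro n hn
    have := panelErr_expansion hG.1 4 (h := h) (x := -(N * h) + n * h) hh.le
      (M := M * (Real.exp θ * Real.exp (θ * (-(N * h) + n * h)))) (fun y hy => by
        refine (hb G (by simp) 4 le_rfl y
          (hy.2.trans (node_le_zero (Finset.mem_range.1 hn) hh))).trans ?_
        exact mul_le_mul_of_nonneg_left (exp_panel_le hθ h1 hy.2) hM.le)
    rwa [Finset.sum_eq_zero, sub_zero] at this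
    intro k hk
    rw [gaussDefect_eq_zero (Finset.mem_range.1 hk)]
    ring
  refine (Finset.abs_sum_le_sum_abs _ _).trans ((Finset.sum_le_sum step).trans ?_)
  have := mul_le_mul_of_nonneg_left (sum_exp_le hθ h N)
    (show 0 ≤ 2 * M * Real.exp θ * h ^ 4 by positivity)
  calc _ = 2 * M * Real.exp θ * h ^ 4 *
      (h * ∑ n ∈ Finset.range N, Real.exp (θ * (-(N * h) + n * h))) := by
        rw [Finset.mul_sum, Finset.mul_sum]
        exact Finset.sum_congr rfl fun n _ => by ring
    _ ≤ _ := this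
    _ = _ := by ring

/-! ### Spectral accuracy of the composite rule on the whole line -/

/-- Smooth functions that decay exponentially at `±∞`, together with all derivatives. -/
def TwoSidedDecay (g : ℝ → ℝ) : Prop :=
  ContDiff ℝ ∞ g ∧
    ∀ k : ℕ, ∃ C θ : ℝ, 0 < θ ∧ ∀ x, |iteratedDeriv k g x| ≤ C * Real.exp (-(θ * |x|))

theorem TwoSidedDecay.iteratedDeriv {g : ℝ → ℝ} (hg : TwoSidedDecay g) (j : ℕ) :
    TwoSidedDecay (iteratedDeriv j g) :=
  ⟨contDiff_iteratedDeriv hg.1 j, fun k => by rw [iteratedDeriv_iteratedDeriv]; exact hg.2 _⟩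

/-- Since `φ` may have nonzero and different limits, the argument on the whole line has to start
from `φ'`. -/
theorem twoSidedDecay_deriv_phi {f U : ℝ → ℝ} {c um up : ℝ} (hf : ContDiff ℝ ∞ f)
    (hU : IsTravellingWave f c U um up) (hd : PhiDecaysExponentially f U um up) :
    TwoSidedDecay (deriv (phi f U)) := by
  refine ⟨(contDiff_infty_iff_deriv.1 (hU.contDiff_phi hf)).2, fun k => ?_⟩
  obtain ⟨C, θ, hθ, h⟩ := (leftDecay_psiLeft hf hU hd).2 (k + 1)
  obtain ⟨C', θ', hθ', h'⟩ := (leftDecay_psiRight hf hU hd).2 (k + 1)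
  change ∀ x ≤ 0, |_root_.iteratedDeriv (k + 1) (fun x => phi f U x - deriv f um) x| ≤ _ at h
  change ∀ x ≤ 0, |_root_.iteratedDeriv (k + 1) (fun x => (fun x => phi f U (-x)) x - deriv f up) x|
    ≤ _ at h'
  rw [iteratedDeriv_sub_const] at h h'
  simp only [iteratedDeriv_comp_neg, smul_eq_mul, abs_mul, abs_pow, abs_neg, abs_one, one_pow,
    one_mul] at h'
  refine ⟨max |C| |C'|, min θ θ', lt_min hθ hθ', fun x => ?_⟩
  rw [← iteratedDeriv_succ']
  rcases le_total x 0 with hx | hx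
  · refine (h x hx).trans ((exp_bound_mono ((le_abs_self C).trans (le_max_left |C| |C'|))
      (by positivity) (min_le_left θ θ') hx).trans_eq ?_)
    rw [abs_of_nonpos hx, mul_neg, neg_neg]
  · have := h' (-x) (by linarith)
    rw [neg_neg] at this
    refine this.trans ((exp_bound_mono ((le_abs_self C').trans (le_max_right |C| |C'|))
      (by positivity) (min_le_right θ θ') (by linarith)).trans_eq ?_)
    rw [abs_of_nonneg hx, mul_neg]

/-- Quantities of size `h ^ m`, up to exponentially small terms. -/
def Negligible (m : ℕ) (F : ℝ → ℕ → ℝ) : Prop :=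
  ∃ C θ : ℝ, 0 < C ∧ 0 < θ ∧ ∀ (h : ℝ) (N : ℕ), 0 < h → h ≤ 1 →
    |F h N| ≤ C * (h ^ m + Real.exp (-(θ * (N * h))))

theorem Negligible.add {m : ℕ} {F G : ℝ → ℕ → ℝ} (hF : Negligible m F) (hG : Negligible m G) :
    Negligible m (fun h N => F h N + G h N) := by
  obtain ⟨C, θ, hC, hθ, hF⟩ := hF
  obtain ⟨C', θ', hC', hθ', hG⟩ := hG
  refine ⟨C + C', min θ θ', by positivity, lt_min hθ hθ', fun h N hh h1 => ?_⟩
  have e1 : Real.exp (-(θ * (N * h))) ≤ Real.exp (-(min θ θ' * (N * h))) :=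
    Real.exp_le_exp.2 (neg_le_neg (mul_le_mul_of_nonneg_right (min_le_left _ _) (by positivity)))
  have e2 : Real.exp (-(θ' * (N * h))) ≤ Real.exp (-(min θ θ' * (N * h))) :=
    Real.exp_le_exp.2 (neg_le_neg (mul_le_mul_of_nonneg_right (min_le_right _ _) (by positivity)))
  have := abs_add_le (F h N) (G h N)
  have := hF h N hh h1
  have := hG h N hh h1
  nlinarith

theorem Negligible.of_le {m : ℕ} {F G : ℝ → ℕ → ℝ} (hG : Negligible m G)
    (h : ∀ h N, 0 < h → h ≤ 1 → |F h N| ≤ |G h N|) : Negligible m F := by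
  obtain ⟨C, θ, hC, hθ, hG⟩ := hG
  exact ⟨C, θ, hC, hθ, fun h' N hh h1 => (h h' N hh h1).trans (hG h' N hh h1)⟩

theorem Negligible.sum {m : ℕ} (F : ℕ → ℝ → ℕ → ℝ) (n : ℕ) (hF : ∀ k < n, Negligible m (F k)) :
    Negligible m (fun h N => ∑ k ∈ Finset.range n, F k h N) := by
  induction n with
  | zero => exact ⟨1, 1, one_pos, one_pos, fun h N hh h1 => by simp; positivity⟩
  | succ n ih =>
    simp only [Finset.sum_range_succ]
    exact (ih fun k hk => hF k (by omega)).add (hF n (by omega))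

theorem Negligible.const_mul_pow {m : ℕ} {F : ℝ → ℕ → ℝ} (hF : Negligible m F) (c : ℝ) (j : ℕ) :
    Negligible (m + j) (fun h N => c * h ^ j * F h N) := by
  obtain ⟨C, θ, hC, hθ, hF⟩ := hF
  refine ⟨(|c| + 1) * C, θ, by positivity, hθ, fun h N hh h1 => ?_⟩
  have e1 : h ^ j ≤ 1 := pow_le_one₀ hh.le h1
  have e2 := Real.exp_pos (-(θ * (N * h)))
  rw [abs_mul, abs_mul, abs_of_pos (pow_pos hh j), pow_add]
  calc |c| * h ^ j * |F h N| ≤ |c| * h ^ j * (C * (h ^ m + Real.exp (-(θ * (N * h))))) :=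
        mul_le_mul_of_nonneg_left (hF h N hh h1) (by positivity)
    _ = (|c| * C) * (h ^ m * h ^ j + h ^ j * Real.exp (-(θ * (N * h)))) := by ring
    _ ≤ ((|c| + 1) * C) * (h ^ m * h ^ j + 1 * Real.exp (-(θ * (N * h)))) := by
        gcongr
        linarith
    _ = _ := by ring

theorem Negligible.mono {m n : ℕ} {F : ℝ → ℕ → ℝ} (hF : Negligible n F) (hmn : m ≤ n) :
    Negligible m F := by
  obtain ⟨C, θ, hC, hθ, hF⟩ := hF
  refine ⟨C, θ, hC, hθ, fun h N hh h1 => (hF h N hh h1).trans ?_⟩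
  have := pow_le_pow_of_le_one hh.le h1 hmn
  gcongr

theorem sum_exp_abs_le {θ h : ℝ} (hθ : 0 < θ) (hh : 0 < h) (h1 : h ≤ 1) (N : ℕ) :
    h * ∑ n ∈ Finset.range (N + N), Real.exp (-(θ * |-(N * h) + n * h|)) ≤
      (1 + Real.exp θ) / θ := by
  rw [Finset.sum_range_add, mul_add, add_div]
  refine add_le_add ((mul_le_mul_of_nonneg_left (Finset.sum_le_sum fun n hn => ?_) hh.le).trans
    (sum_exp_le hθ h N)) ?_
  · have := node_le_zero (Finset.mem_range.1 hn) hh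
    rw [abs_of_nonpos (by linarith)]
    exact (congrArg Real.exp (by ring)).le
  · rw [← Finset.sum_range_reflect]
    have := mul_le_mul_of_nonneg_left (sum_exp_le hθ h N) (Real.exp_pos θ).le
    rw [mul_one_div] at this
    refine le_trans ?_ this
    rw [mul_left_comm, Finset.mul_sum (Finset.range N) _ (Real.exp θ)]
    refine mul_le_mul_of_nonneg_left (Finset.sum_le_sum fun n hn => ?_) hh.le
    have hn' : ((N - 1 - n : ℕ) : ℝ) = N - 1 - n := by
      have := Finset.mem_range.1 hn
      rw [Nat.cast_sub (by omega), Nat.cast_sub (by omega)]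
      simp
    have := node_le_zero (Finset.mem_range.1 hn) hh
    push_cast
    rw [hn', abs_of_nonneg (by linarith)]
    refine (Real.exp_le_exp.2 ?_).trans (exp_panel_le hθ h1 (x := -(N * h) + n * h)
      (y := -(N * h) + n * h + h) le_rfl)
    apply le_of_eq; ring

theorem exp_abs_panel_le {θ h x y : ℝ} (hθ : 0 < θ) (h1 : h ≤ 1) (hy : y ∈ Set.Icc x (x + h)) :
    Real.exp (-(θ * |y|)) ≤ Real.exp θ * Real.exp (-(θ * |x|)) := by
  rw [← Real.exp_add]
  refine Real.exp_le_exp.2 ?_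
  have : |x| ≤ |y| + 1 := by
    have := abs_sub_abs_le_abs_sub x y
    have : |x - y| ≤ 1 := by rw [abs_le]; constructor <;> linarith [hy.1, hy.2]
    linarith
  nlinarith

/-- Sums of remainders that are bounded panelwise by a decaying derivative. -/
theorem TwoSidedDecay.negligible_sum {g : ℝ → ℝ} (hg : TwoSidedDecay g) (k m : ℕ)
    (F : ℝ → ℝ → ℝ)
    (hF : ∀ h x M : ℝ, 0 < h → h ≤ 1 →
      (∀ y ∈ Set.Icc x (x + h), |_root_.iteratedDeriv k g y| ≤ M) → |F h x| ≤ 2 * M * h ^ (m + 1)) :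
    Negligible m (fun h N => ∑ n ∈ Finset.range (N + N), F h (-(N * h) + n * h)) := by
  obtain ⟨C, θ, hθ, hb⟩ := hg.2 k
  have hC : 0 ≤ C := by
    have := (abs_nonneg _).trans (hb 0)
    exact nonneg_of_mul_nonneg_left this (Real.exp_pos _)
  -- The exponential term of `Negligible` is not needed here, so its rate `1` is arbitrary; the
  -- summand `1` only makes the constant positive. One factor `h` of `h ^ (m + 1)` pays for the sum
  -- over the panels.
  refine ⟨2 * C * Real.exp θ * ((1 + Real.exp θ) / θ) + 1, 1, by positivity, one_pos,
    fun h N hh h1 => ?_⟩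
  have step : ∀ n ∈ Finset.range (N + N), |F h (-(N * h) + n * h)| ≤
      2 * (C * (Real.exp θ * Real.exp (-(θ * |-(N * h) + n * h|)))) * h ^ (m + 1) := fun n _ =>
    hF h _ _ hh h1 fun y hy =>
      (hb y).trans (mul_le_mul_of_nonneg_left (exp_abs_panel_le hθ h1 hy) hC)
  refine (Finset.abs_sum_le_sum_abs _ _).trans ((Finset.sum_le_sum step).trans ?_)
  have := mul_le_mul_of_nonneg_left (sum_exp_abs_le hθ hh h1 N)
    (show 0 ≤ 2 * C * Real.exp θ * h ^ m by positivity)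
  calc _ = 2 * C * Real.exp θ * h ^ m *
      (h * ∑ n ∈ Finset.range (N + N), Real.exp (-(θ * |-(N * h) + n * h|))) := by
        rw [Finset.mul_sum, Finset.mul_sum]
        exact Finset.sum_congr rfl fun n _ => by ring
    _ ≤ _ := this
    _ ≤ (2 * C * Real.exp θ * ((1 + Real.exp θ) / θ)) * (h ^ m + Real.exp (-(1 * (N * h)))) +
        1 * (h ^ m + Real.exp (-(1 * (N * h)))) := by
        have e1 := Real.exp_pos (-(1 * (N * h)))
        have e2 : 0 < h ^ m := by positivity
        have e3 : 0 ≤ (2 * C * Real.exp θ * ((1 + Real.exp θ) / θ)) * Real.exp (-(1 * (N * h))) := by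
          positivity
        nlinarith
    _ = _ := by ring

theorem TwoSidedDecay.negligible_boundary {g : ℝ → ℝ} (hg : TwoSidedDecay g) (m : ℕ) :
    Negligible m (fun h N => g (N * h) - g (-(N * h))) := by
  obtain ⟨C, θ, hθ, hb⟩ := hg.2 0
  simp only [iteratedDeriv_zero] at hb
  have hC : 0 ≤ C := by
    have := (abs_nonneg _).trans (hb 0)
    exact nonneg_of_mul_nonneg_left this (Real.exp_pos _)
  refine ⟨2 * C + 1, θ, by positivity, hθ, fun h N hh h1 => ?_⟩
  have e1 := hb (N * h)
  have e2 := hb (-(N * h))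
  rw [abs_neg] at e2
  rw [abs_of_nonneg (show (0 : ℝ) ≤ N * h by positivity)] at e1 e2
  have e3 := abs_sub (g (N * h)) (g (-(N * h)))
  have e4 := Real.exp_pos (-(θ * (N * h)))
  have e5 : 0 < h ^ m := by positivity
  nlinarith

theorem sum_mul_mul_sum_comm (a : ℕ → ℝ) (c : ℝ) (S : ℕ → ℕ → ℝ) (m n : ℕ) :
    ∑ k ∈ Finset.range m, a k * (c * ∑ i ∈ Finset.range n, S k i) =
      ∑ i ∈ Finset.range n, ∑ k ∈ Finset.range m, a k * c * S k i := by
  rw [Finset.sum_comm]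
  refine Finset.sum_congr rfl fun k _ => ?_
  rw [← mul_assoc, Finset.mul_sum]

/-- Euler–Maclaurin by induction. The telescoping sum of `g(x + h) - g(x)` is an exponentially small
end term. Taylor expansion of the differences expresses `h ∑ g'` through it, through sums of the
same form for higher derivatives with extra powers of `h`, and through a remainder. The induction
hypothesis for all functions `g` then raises the order by one. -/
theorem TwoSidedDecay.negligible_deriv (m : ℕ) : ∀ g : ℝ → ℝ, TwoSidedDecay g →
    Negligible m (fun h N => h * ∑ n ∈ Finset.range (N + N), _root_.deriv g (-(N * h) + n * h)) := by
  induction m with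
  | zero =>
    intro g hg
    refine (hg.negligible_sum 1 0 (fun h x => h * _root_.deriv g x) ?_).of_le fun h N hh h1 => ?_
    · intro h x M hh h1 hM
      have := hM x ⟨le_rfl, by linarith⟩
      rw [iteratedDeriv_one] at this
      have h0 := mul_le_mul_of_nonneg_left this hh.le
      have h2 := mul_nonneg hh.le ((abs_nonneg _).trans this)
      rw [abs_mul, abs_of_pos hh, zero_add, pow_one]
      linarith
    · rw [Finset.mul_sum]
  | succ m ih =>
    intro g hg
    have hrem := hg.negligible_sum (m + 2) (m + 1) (fun h x => -(g (x + h) -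
      ∑ i ∈ Finset.range (m + 2), _root_.iteratedDeriv i g x * (h ^ i / i.factorial))) (by
        intro h x M hh h1 hM
        have hM0 : 0 ≤ M := (abs_nonneg _).trans (hM x ⟨le_rfl, by linarith⟩)
        have := taylor_bound (m + 2) (fun i => _root_.iteratedDeriv i g)
          (hasDerivAt_iteratedDeriv hg.1) hh.le hM
        simp only [iteratedDeriv_zero] at this
        rw [abs_neg]
        refine this.trans ?_
        have e : h ^ (m + 2) / (m + 2).factorial ≤ h ^ (m + 2) :=
          div_le_self (by positivity) (by exact_mod_cast Nat.factorial_pos _)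
        have e2 : 0 ≤ M * h ^ (m + 2) := by positivity
        nlinarith [mul_le_mul_of_nonneg_left e hM0])
    have hterm : ∀ i < m, Negligible (m + 1) (fun h N => -(1 / (i + 2).factorial : ℝ) * h ^ (i + 1) *
        (h * ∑ n ∈ Finset.range (N + N), _root_.deriv (_root_.iteratedDeriv (i + 1) g)
          (-(N * h) + n * h))) := fun i _ =>
      ((ih _ (hg.iteratedDeriv (i + 1))).const_mul_pow _ (i + 1)).mono (by omega)
    refine ((hg.negligible_boundary (m + 1)).add (hrem.add (Negligible.sum _ m hterm))).of_le
      fun h N hh h1 => le_of_eq (congrArg _ ?_)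
    have tele : ∑ n ∈ Finset.range (N + N), (g (-(N * h) + n * h + h) - g (-(N * h) + n * h)) =
        g (N * h) - g (-(N * h)) := by
      have := Finset.sum_range_sub (fun n : ℕ => g (-(N * h) + n * h)) (N + N)
      simp only [Nat.cast_add, Nat.cast_one, Nat.cast_zero, zero_mul, add_zero] at this
      convert this using 3
      · ring_nf
      · ring_nf
    have expand : ∀ x, ∑ i ∈ Finset.range (m + 2), _root_.iteratedDeriv i g x * (h ^ i / i.factorial)
        = g x + h * _root_.deriv g x + ∑ i ∈ Finset.range m,
          1 / ((i + 2).factorial : ℝ) * h ^ (i + 1) *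
            (h * _root_.deriv (_root_.iteratedDeriv (i + 1) g) x) := by
      intro x
      rw [Finset.sum_range_succ', Finset.sum_range_succ']
      simp only [iteratedDeriv_zero, zero_add, iteratedDeriv_one, pow_zero, pow_one,
        Nat.factorial_zero, Nat.factorial_one, Nat.cast_one, div_one, mul_one]
      rw [show ∀ a b c : ℝ, a + b + c = c + b + a by intros; ring]
      congr 1
      · ring
      · refine Finset.sum_congr rfl fun i _ => ?_
        rw [← iteratedDeriv_succ]
        ring
    simp only [expand]
    rw [← tele, sum_mul_mul_sum_comm, ← Finset.sum_add_distrib, ← Finset.sum_add_distrib, Finset.mul_sum]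
    refine Finset.sum_congr rfl fun n _ => ?_
    have : ∑ i ∈ Finset.range m, -(1 / ((i + 2).factorial : ℝ)) * h ^ (i + 1) * h *
          _root_.deriv (_root_.iteratedDeriv (i + 1) g) (-(N * h) + n * h) =
        -∑ i ∈ Finset.range m, 1 / ((i + 2).factorial : ℝ) * h ^ (i + 1) *
            (h * _root_.deriv (_root_.iteratedDeriv (i + 1) g) (-(N * h) + n * h)) := by
      rw [← Finset.sum_neg_distrib]
      exact Finset.sum_congr rfl fun i _ => by ring
    rw [this]
    ring

theorem sum_panelErr_left_add_right (g : ℝ → ℝ) (h : ℝ) (N : ℕ) :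
    ∑ n ∈ Finset.range (N + N), panelErr g h (-(N * h) + n * h) =
      ∑ n ∈ Finset.range N, panelErr g h (-(N * h) + n * h) +
      ∑ n ∈ Finset.range N, panelErr g h (n * h) := by
  rw [Finset.sum_range_add]
  congr 1
  refine Finset.sum_congr rfl fun n _ => ?_
  push_cast
  ring_nf

theorem quadError_eq_sum {f U : ℝ → ℝ} (hφ : Continuous (phi f U)) (h : ℝ) (N : ℕ) :
    quadError f U h N = ∑ n ∈ Finset.range (N + N), panelErr (phi f U) h (-(N * h) + n * h) := by
  have hint : ∑ n ∈ Finset.range (N + N),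
      (∫ y in (-(N * h) + n * h)..(-(N * h) + n * h + h), phi f U y) =
      ∫ x in (-(N * h))..(N * h), phi f U x := by
    have := intervalIntegral.sum_integral_adjacent_intervals (μ := MeasureTheory.volume)
      (f := phi f U) (a := fun n : ℕ => -((N : ℝ) * h) + (n : ℝ) * h) (n := N + N)
      (fun k _ => hφ.intervalIntegrable _ _)
    simp only [Nat.cast_add, Nat.cast_one, Nat.cast_zero, zero_mul, add_zero] at this
    rw [show -((N : ℝ) * h) + (N + N) * h = N * h by ring] at this
    rw [← this]
    refine Finset.sum_congr rfl fun n _ => ?_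
    congr 1
    ring
  have hsum : ∑ j ∈ Finset.Ico (-(N : ℤ)) (N : ℤ),
      (phi f U (j * h + (1 / 2 - √3 / 6) * h) + phi f U (j * h + (1 / 2 + √3 / 6) * h)) =
      ∑ n ∈ Finset.range (N + N), (phi f U (-(N * h) + n * h + (1 / 2 - √3 / 6) * h) +
        phi f U (-(N * h) + n * h + (1 / 2 + √3 / 6) * h)) := by
    symm
    refine Finset.sum_bij (fun (n : ℕ) _ => (n : ℤ) - N) ?_ ?_ ?_ ?_
    · intro n hn
      have := Finset.mem_range.1 hn
      simp only [Finset.mem_Ico]; omega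
    · intro a _ b _ hab
      simpa using hab
    · intro b hb
      simp only [Finset.mem_Ico] at hb
      exact ⟨(b + N).toNat, by simp only [Finset.mem_range]; omega, by omega⟩
    · intro n _
      push_cast
      ring_nf
  rw [quadError, hsum, ← hint, Finset.mul_sum, ← Finset.sum_sub_distrib]
  refine Finset.sum_congr rfl fun n _ => ?_
  rw [panelErr]
  ring

/-- On the whole line, the composite Gauss rule converges faster than any power of `h`. -/
theorem negligible_quadError {f U : ℝ → ℝ} {c um up : ℝ} (hf : ContDiff ℝ ∞ f)
    (hU : IsTravellingWave f c U um up) (hd : PhiDecaysExponentially f U um up) (m : ℕ) :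
    Negligible m (quadError f U) := by
  have hφ := hU.contDiff_phi hf
  have hg := twoSidedDecay_deriv_phi hf hU hd
  have hrem := hg.negligible_sum (m + 1) (m + 2) (fun h x => panelErr (phi f U) h x -
    ∑ k ∈ Finset.range (m + 2), gaussDefect k * h ^ (k + 1) * _root_.iteratedDeriv k (phi f U) x) (by
      intro h x M hh h1 hM
      rw [← iteratedDeriv_succ'] at hM
      exact panelErr_expansion hφ (m + 2) hh.le hM)
  -- The sum starts with the second derivative of `φ`, which is the derivative of the decaying
  -- function `φ'`. The orders zero and one would not be negligible; their defects vanish.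
  have hterm : ∀ k < m, Negligible m (fun h N => gaussDefect (k + 2) * h ^ (k + 2) *
      (h * ∑ n ∈ Finset.range (N + N), _root_.deriv (_root_.iteratedDeriv k (_root_.deriv (phi f U)))
          (-(N * h) + n * h))) := fun k _ =>
    ((TwoSidedDecay.negligible_deriv m _ (hg.iteratedDeriv k)).const_mul_pow _ (k + 2)).mono
      (by omega)
  refine ((hrem.mono (by omega)).add (Negligible.sum _ m hterm)).of_le
    fun h N hh h1 => le_of_eq (congrArg _ ?_)
  rw [quadError_eq_sum hφ.continuous, sum_mul_mul_sum_comm, ← Finset.sum_add_distrib]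
  refine Finset.sum_congr rfl fun n _ => ?_
  rw [Finset.sum_range_succ', Finset.sum_range_succ', gaussDefect_eq_zero (by norm_num),
    gaussDefect_eq_zero (by norm_num)]
  simp only [← iteratedDeriv_succ, ← iteratedDeriv_succ']
  have : ∑ k ∈ Finset.range m, gaussDefect (k + 2) * h ^ (k + 2) * h *
        _root_.iteratedDeriv (k + 1 + 1) (phi f U) (-(N * h) + n * h) =
      ∑ k ∈ Finset.range m, gaussDefect (k + 1 + 1) * h ^ (k + 1 + 1 + 1) *
        _root_.iteratedDeriv (k + 1 + 1) (phi f U) (-(N * h) + n * h) :=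
    Finset.sum_congr rfl fun k _ => by ring
  rw [this]
  ring

/-! ### The quadrature error as the sum of two one-sided errors -/

theorem panelErr_sub_const {g : ℝ → ℝ} (hg : Continuous g) (v h x : ℝ) :
    panelErr (fun y => g y - v) h x = panelErr g h x := by
  rw [panelErr, panelErr, intervalIntegral.integral_sub (hg.intervalIntegrable _ _)
    (continuous_const.intervalIntegrable _ _), intervalIntegral.integral_const]
  rw [smul_eq_mul]
  ring

theorem panelErr_comp_neg (g : ℝ → ℝ) (h x : ℝ) :
    panelErr (fun y => g (-y)) h x = panelErr g h (-x - h) := by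
  rw [panelErr, panelErr, intervalIntegral.integral_comp_neg]
  ring_nf

/-- The one-sided quadrature error. -/
def halfErr (ψ : ℝ → ℝ) (h : ℝ) (N : ℕ) : ℝ :=
  ∑ n ∈ Finset.range N, panelErr ψ h (-(N * h) + n * h)

/-- The rule is exact for constants, so a different limit may be subtracted on each half-line, and
its nodes are symmetric, so the right half may be reflected. -/
theorem quadError_eq_halfErr_add {f U : ℝ → ℝ} (hφ : Continuous (phi f U)) (um up h : ℝ) (N : ℕ) :
    quadError f U h N = halfErr (psiLeft f U um) h N + halfErr (psiRight f U up) h N := by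
  rw [quadError_eq_sum hφ, sum_panelErr_left_add_right, halfErr, halfErr]
  congr 1
  · exact Finset.sum_congr rfl fun n _ => (panelErr_sub_const hφ _ _ _).symm
  · rw [← Finset.sum_range_reflect]
    refine Finset.sum_congr rfl fun n hn => ?_
    change _ = panelErr (fun y => (fun y => phi f U (-y)) y - deriv f up) h _
    rw [panelErr_sub_const (g := fun y => phi f U (-y)) (hφ.comp continuous_neg),
      panelErr_comp_neg]
    congr 1
    have := Finset.mem_range.1 hn
    rw [Nat.cast_sub (by omega), Nat.cast_sub (by omega)]
    push_cast
    ring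

/-! ### One Gauss--Legendre step for the diagonalised system -/

/-- `√3 / 6`. -/
def sig : ℂ := ((√3 / 6 : ℝ) : ℂ)

theorem sig_sq : sig ^ 2 = 1 / 12 := by
  obtain ⟨-, -, h⟩ := sqrt_three_bounds
  have : (√3 / 6) ^ 2 = 1 / 12 := by linarith
  rw [sig, ← Complex.ofReal_pow, this]
  norm_num

theorem norm_sig_le : ‖sig‖ ≤ 1 / 3 := by
  obtain ⟨h1, h2, -⟩ := sqrt_three_bounds
  rw [sig, Complex.norm_real, Real.norm_eq_abs, abs_of_nonneg (by linarith)]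
  linarith

theorem norm_quarter_sub_sig_le : ‖1 / 4 - sig‖ ≤ 1 / 2 := by
  obtain ⟨h1, h2, -⟩ := sqrt_three_bounds
  have : 1 / 4 - sig = ((1 / 4 - √3 / 6 : ℝ) : ℂ) := by rw [sig]; push_cast; ring
  rw [this, Complex.norm_real, Real.norm_eq_abs, abs_le]
  constructor <;> linarith

theorem norm_quarter_add_sig_le : ‖1 / 4 + sig‖ ≤ 3 / 4 := by
  obtain ⟨h1, h2, -⟩ := sqrt_three_bounds
  have : 1 / 4 + sig = ((1 / 4 + √3 / 6 : ℝ) : ℂ) := by rw [sig]; push_cast; ring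
  rw [this, Complex.norm_real, Real.norm_eq_abs, abs_le]
  constructor <;> linarith

theorem norm_quarter : ‖(1 / 4 : ℂ)‖ = 1 / 4 := by norm_num

theorem norm_half : ‖(1 / 2 : ℂ)‖ = 1 / 2 := by norm_num

/-- The denominator of the stability function. -/
def stabDen (z : ℂ) : ℂ := 1 + z / 2 + z ^ 2 / 12

theorem norm_stabDen_bounds {z : ℂ} (hz : 48 ≤ ‖z‖) :
    ‖z‖ ^ 2 / 24 ≤ ‖stabDen z‖ ∧ ‖stabDen z‖ ≤ ‖z‖ ^ 2 / 6 := by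
  have h1 : ‖1 + z / 2‖ ≤ 1 + ‖z‖ / 2 := (norm_add_le _ _).trans (by simp)
  have h2 : ‖z ^ 2 / 12‖ = ‖z‖ ^ 2 / 12 := by simp
  have h3 := norm_add_le (1 + z / 2) (z ^ 2 / 12)
  have h4 : ‖z ^ 2 / 12‖ ≤ ‖stabDen z‖ + ‖1 + z / 2‖ := by
    have : z ^ 2 / 12 = stabDen z - (1 + z / 2) := by rw [stabDen]; ring
    rw [this]; exact norm_sub_le _ _
  rw [stabDen] at *
  constructor <;> nlinarith

/-- With `z = hκ`, the quantity `1 - z / stabDen z` is the stability function at `-z`. The gap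
between the squared moduli of its denominator and numerator is exactly `Re z (2 + |z|²/6)`. Compared
with `|stabDen z|² = O(|z|⁴)` this yields damping of order `1/|z|` only, which has to be exploited
over about `1/t` steps. -/
theorem norm_one_sub_div_stabDen_le {z : ℂ} {δ t : ℝ} (hδ : 0 < δ) (hz : 48 ≤ ‖z‖)
    (ht : ‖z‖ * t = 1) (hre : δ * ‖z‖ ≤ z.re) : ‖1 - z / stabDen z‖ ≤ 1 - 3 * δ * t := by
  obtain ⟨h1, h2⟩ := norm_stabDen_bounds hz
  set r := ‖z‖ with hr
  have hr0 : 0 < r := by linarith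
  have hD : 0 < ‖stabDen z‖ := lt_of_lt_of_le (by positivity) h1
  have hD0 : stabDen z ≠ 0 := norm_pos_iff.1 hD
  have ht0 : 0 < t := pos_of_mul_pos_right (by rw [ht]; norm_num) hr0.le
  have hδ1 : δ ≤ 1 := by
    have := Complex.re_le_norm z
    have : δ * r ≤ 1 * r := by linarith
    exact le_of_mul_le_mul_right this hr0
  have hsq : z.re * z.re + z.im * z.im = r ^ 2 := by
    rw [hr, Complex.sq_norm, Complex.normSq_apply]
  have key : ‖stabDen z - z‖ ^ 2 = ‖stabDen z‖ ^ 2 - z.re * (2 + r ^ 2 / 6) := by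
    rw [Complex.sq_norm, Complex.sq_norm, Complex.normSq_apply, Complex.normSq_apply, stabDen,
      ← hsq]
    simp [pow_two]
    ring
  have e1 : 1 - z / stabDen z = (stabDen z - z) / stabDen z := by field_simp
  have htr : t * r = 1 := by linarith
  have h3 : 0 ≤ 1 - 3 * δ * t := by nlinarith
  rw [e1, norm_div, div_le_iff₀ hD]
  refine le_of_sq_le_sq ?_ (by positivity)
  rw [key, mul_pow]
  have h4 : δ * r ^ 3 / 6 ≤ z.re * (2 + r ^ 2 / 6) := by
    have : 0 ≤ z.re := le_trans (by positivity) hre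
    nlinarith [mul_le_mul_of_nonneg_right hre (sq_nonneg r)]
  have h5 : ‖stabDen z‖ ^ 2 ≤ (r ^ 2 / 6) ^ 2 := pow_le_pow_left₀ hD.le h2 2
  have h6 : 6 * δ * t * ‖stabDen z‖ ^ 2 ≤ δ * r ^ 3 / 6 := by
    calc 6 * δ * t * ‖stabDen z‖ ^ 2 ≤ 6 * δ * t * (r ^ 2 / 6) ^ 2 := by gcongr
      _ = δ * r ^ 3 / 6 * (t * r) := by ring
      _ = _ := by rw [htr, mul_one]
  nlinarith [sq_nonneg (3 * δ * t * ‖stabDen z‖)]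

/-- The solution of the stage equations for the stiff component. -/
theorem stage_solve {z e E₁ E₂ D₁ D₂ : ℂ} {t d : ℝ} (hz : 48 ≤ ‖z‖) (ht : ‖z‖ * t = 1)
    (h₁ : E₁ + z * (1 / 4 * E₁ + (1 / 4 - sig) * E₂) = e + D₁)
    (h₂ : E₂ + z * ((1 / 4 + sig) * E₁ + 1 / 4 * E₂) = e + D₂)
    (hd₁ : ‖D₁‖ ≤ d) (hd₂ : ‖D₂‖ ≤ d) :
    ‖E₁‖ + ‖E₂‖ ≤ 48 * t * (‖e‖ + d) ∧ ‖(E₁ + E₂) / 2‖ ≤ 24 * t ^ 2 * ‖e‖ + 24 * t * d ∧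
    ‖e - z * ((E₁ + E₂) / 2)‖ ≤ ‖1 - z / stabDen z‖ * ‖e‖ + 24 * d := by
  have hss := sig_sq
  obtain ⟨hD1, -⟩ := norm_stabDen_bounds hz
  have hr0 : 0 < ‖z‖ := by linarith
  have ht0 : 0 < t := pos_of_mul_pos_right (by rw [ht]; norm_num) hr0.le
  have hd0 : 0 ≤ d := (norm_nonneg _).trans hd₁
  have hD : 0 < ‖stabDen z‖ := lt_of_lt_of_le (by positivity) hD1
  have hD0 : stabDen z ≠ 0 := norm_pos_iff.1 hD
  have bound : ∀ (w : ℂ) (b : ℝ), ‖stabDen z * w‖ ≤ ‖z‖ * b → 0 ≤ b → ‖w‖ ≤ 24 * t * b := by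
    intro w b hw hb
    rw [norm_mul] at hw
    have h3 : ‖z‖ * (‖z‖ * ‖w‖) ≤ ‖z‖ * (24 * b) := by
      nlinarith [mul_le_mul_of_nonneg_right hD1 (norm_nonneg w)]
    have h4 := le_of_mul_le_mul_left h3 hr0
    calc ‖w‖ = t * (‖z‖ * ‖w‖) := by rw [← mul_assoc, mul_comm t, ht, one_mul]
      _ ≤ t * (24 * b) := by gcongr
      _ = _ := by ring
  have n1 := norm_sig_le
  have n2 := norm_quarter_sub_sig_le
  have n3 := norm_quarter_add_sig_le
  -- Cramer's rule for the stage system, whose determinant is `stabDen z` because `sig ^ 2 = 1 /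
  -- 12`.
  have i1 : stabDen z * E₁ = (1 + z / 4) * (e + D₁) - (1 / 4 - sig) * z * (e + D₂) := by
    rw [← h₁, ← h₂, stabDen]
    linear_combination (-z ^ 2 * E₁) * hss
  have i2 : stabDen z * E₂ = (1 + z / 4) * (e + D₂) - (1 / 4 + sig) * z * (e + D₁) := by
    rw [← h₁, ← h₂, stabDen]
    linear_combination (-z ^ 2 * E₂) * hss
  -- In the mean of the stages the contributions of `z * e` cancel. Hence the mean is `O(t²)` in
  -- `e`, whereas each stage is only `O(t)`; this gain is essential for the dominant component.
  have i3 : stabDen z * ((E₁ + E₂) / 2) = e + ((1 - sig * z) * D₁ + (1 + sig * z) * D₂) / 2 := by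
    linear_combination (1 / 2) * i1 + (1 / 2) * i2
  have q1 : ‖1 + z / 4‖ ≤ 1 + ‖z‖ / 4 := (norm_add_le _ _).trans (by simp)
  have ed : ∀ D : ℂ, ‖D‖ ≤ d → ‖e + D‖ ≤ ‖e‖ + d := fun D hD =>
    (norm_add_le _ _).trans (by linarith)
  have stage : ∀ (p D D' : ℂ), ‖p‖ ≤ 3 / 4 - 1 / 48 → ‖D‖ ≤ d → ‖D'‖ ≤ d →
      ‖(1 + z / 4) * (e + D) - p * z * (e + D')‖ ≤ ‖z‖ * (‖e‖ + d) := by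
    intro p D D' hp hD hD'
    refine (norm_sub_le _ _).trans ?_
    rw [norm_mul, norm_mul, norm_mul]
    have a1 : ‖1 + z / 4‖ * ‖e + D‖ ≤ (1 + ‖z‖ / 4) * (‖e‖ + d) := by
      gcongr; exact ed D hD
    have a2 : ‖p‖ * ‖z‖ * ‖e + D'‖ ≤ (3 / 4 - 1 / 48) * ‖z‖ * (‖e‖ + d) := by
      gcongr; exact ed D' hD'
    have : (1 + ‖z‖ / 4) + (3 / 4 - 1 / 48) * ‖z‖ ≤ ‖z‖ := by linarith
    nlinarith [norm_nonneg e]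
  have n3' : ‖1 / 4 + sig‖ ≤ 3 / 4 - 1 / 48 := by
    refine (norm_add_le _ _).trans ?_
    rw [norm_quarter]; linarith
  have rem : ‖((1 - sig * z) * D₁ + (1 + sig * z) * D₂) / 2‖ ≤ ‖z‖ * d := by
    have b : ‖sig * z‖ ≤ 1 / 3 * ‖z‖ := by rw [norm_mul]; gcongr
    have b1 : ‖1 - sig * z‖ ≤ ‖z‖ := (norm_sub_le _ _).trans (by rw [norm_one]; linarith)
    have b2 : ‖1 + sig * z‖ ≤ ‖z‖ := (norm_add_le _ _).trans (by rw [norm_one]; linarith)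
    rw [norm_div, Complex.norm_two]
    have := norm_add_le ((1 - sig * z) * D₁) ((1 + sig * z) * D₂)
    rw [norm_mul, norm_mul] at this
    have c1 : ‖1 - sig * z‖ * ‖D₁‖ ≤ ‖z‖ * d := by gcongr
    have c2 : ‖1 + sig * z‖ * ‖D₂‖ ≤ ‖z‖ * d := by gcongr
    linarith
  refine ⟨?_, ?_, ?_⟩
  · have k1 := bound E₁ (‖e‖ + d) (by rw [i1]; exact stage _ _ _ (n2.trans (by norm_num)) hd₁ hd₂)
      (by positivity)
    have k2 := bound E₂ (‖e‖ + d) (by rw [i2]; exact stage _ _ _ n3' hd₂ hd₁) (by positivity)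
    linarith
  · refine (bound _ (t * ‖e‖ + d) ?_ (by positivity)).trans_eq (by ring)
    rw [i3, mul_add, ← mul_assoc, ht, one_mul]
    exact (norm_add_le _ _).trans (by linarith)
  · have i4 : e - z * ((E₁ + E₂) / 2) = (1 - z / stabDen z) * e -
        z * (((1 - sig * z) * D₁ + (1 + sig * z) * D₂) / 2 / stabDen z) := by
      have : (E₁ + E₂) / 2 =
          (e + ((1 - sig * z) * D₁ + (1 + sig * z) * D₂) / 2) / stabDen z := by
        rw [← i3]; field_simp
      rw [this]; ring
    rw [i4]
    refine (norm_sub_le _ _).trans ?_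
    rw [norm_mul, norm_mul]
    have := bound (((1 - sig * z) * D₁ + (1 + sig * z) * D₂) / 2 / stabDen z) d
      (by rw [mul_div_cancel₀ _ hD0]; exact rem) hd0
    have h5 : ‖z‖ * ‖((1 - sig * z) * D₁ + (1 + sig * z) * D₂) / 2 / stabDen z‖ ≤
        ‖z‖ * (24 * t * d) := by gcongr
    have h6 : ‖z‖ * (24 * t * d) = 24 * d := by
      rw [show ‖z‖ * (24 * t * d) = ‖z‖ * t * (24 * d) by ring, ht, one_mul]
    linarith

/-- The two-stage Gauss method for a scalar equation agrees with the exponential up to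
fifth order in the mean and second order in the difference of the stage coefficients. -/
theorem norm_pade_sub_exp_le {s d : ℂ} (hs : ‖s‖ ≤ 1 / 2) :
    ‖(1 + s / 2 + (s ^ 2 - d ^ 2) / 12) - (1 - s / 2 + (s ^ 2 - d ^ 2) / 12) * Complex.exp s‖ ≤
      ‖s‖ ^ 5 + ‖s‖ * ‖d‖ ^ 2 := by
  have h1 := Complex.exp_bound (x := s) (by linarith) (n := 5) (by norm_num)
  have h2 := Complex.norm_exp_sub_one_le (x := s) (by linarith)
  simp only [Finset.sum_range_succ, Finset.sum_range_zero, Nat.factorial] at h1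
  norm_num at h1
  set T := 1 + s + s ^ 2 / 2 + s ^ 3 / 6 + s ^ 4 / 24 with hT
  have key : (1 + s / 2 + (s ^ 2 - d ^ 2) / 12) -
      (1 - s / 2 + (s ^ 2 - d ^ 2) / 12) * Complex.exp s =
      s ^ 5 * (1 / 144 - s / 288) - (1 - s / 2 + s ^ 2 / 12) * (Complex.exp s - T) +
        d ^ 2 / 12 * (Complex.exp s - 1) := by
    rw [hT]; ring
  rw [key]
  have n1 : ‖1 / 144 - s / 288‖ ≤ 1 / 2 := by
    refine (norm_sub_le _ _).trans ?_
    norm_num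
    linarith
  have n2 : ‖1 - s / 2 + s ^ 2 / 12‖ ≤ 2 := by
    refine (norm_add_le _ _).trans ((add_le_add_left (norm_sub_le _ _) _).trans ?_)
    rw [norm_div, norm_div, norm_pow]
    norm_num
    nlinarith [norm_nonneg s]
  refine (norm_add_le _ _).trans (add_le_add ((norm_sub_le _ _).trans ?_) ?_)
  · rw [norm_mul, norm_mul, norm_pow]
    have a1 : ‖s‖ ^ 5 * ‖1 / 144 - s / 288‖ ≤ ‖s‖ ^ 5 * (1 / 2) := by gcongr
    have a2 : ‖1 - s / 2 + s ^ 2 / 12‖ * ‖Complex.exp s - T‖ ≤ 2 * (‖s‖ ^ 5 * (1 / 100)) := by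
      gcongr
    have : 0 ≤ ‖s‖ ^ 5 := by positivity
    linarith
  · rw [norm_mul, norm_div, norm_pow]
    norm_num
    have : ‖d‖ ^ 2 / 12 * ‖Complex.exp s - 1‖ ≤ ‖d‖ ^ 2 / 12 * (2 * ‖s‖) := by gcongr
    nlinarith [mul_nonneg (sq_nonneg ‖d‖) (norm_nonneg s)]

/-- Eliminating the stages gives the Padé quotient in the mean and half-difference of `z₁`, `z₂`.
The forcing enters to leading order only through its mean, and otherwise with an extra factor `‖z₁‖
+ ‖z₂‖`. This separation preserves the cancellation in the mean of the fast stages. -/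
theorem scalar_step {α α' X₁ X₂ z₁ z₂ f₁ f₂ : ℂ} (h₁ : ‖z₁‖ ≤ 1 / 4) (h₂ : ‖z₂‖ ≤ 1 / 4)
    (hX₁ : X₁ = α + (1 / 4 * (z₁ * X₁ + f₁) + (1 / 4 - sig) * (z₂ * X₂ + f₂)))
    (hX₂ : X₂ = α + ((1 / 4 + sig) * (z₁ * X₁ + f₁) + 1 / 4 * (z₂ * X₂ + f₂)))
    (hα' : α' = α + (1 / 2 * (z₁ * X₁ + f₁) + 1 / 2 * (z₂ * X₂ + f₂))) :
    ‖α' - Complex.exp ((z₁ + z₂) / 2) * α‖ ≤ ‖(f₁ + f₂) / 2‖ +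
      4 * (‖z₁‖ + ‖z₂‖) * (‖f₁‖ + ‖f₂‖) +
      2 * (‖(z₁ + z₂) / 2‖ ^ 5 + ‖(z₁ + z₂) / 2‖ * ‖(z₁ - z₂) / 2‖ ^ 2) * ‖α‖ := by
  have hss := sig_sq
  set s := (z₁ + z₂) / 2 with hs
  set d := (z₁ - z₂) / 2 with hd
  have hsn : ‖s‖ ≤ 1 / 2 := by
    rw [hs, norm_div, Complex.norm_two]; linarith [norm_add_le z₁ z₂]
  have hp := norm_pade_sub_exp_le (d := d) hsn
  have hps : s ^ 2 - d ^ 2 = z₁ * z₂ := by rw [hs, hd]; ring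
  rw [hps] at hp
  set Den := 1 - s / 2 + z₁ * z₂ / 12 with hDen
  set F₁ := 1 / 4 * f₁ + (1 / 4 - sig) * f₂ with hF₁
  set F₂ := (1 / 4 + sig) * f₁ + 1 / 4 * f₂ with hF₂
  have hDn : 1 / 2 ≤ ‖Den‖ := by
    have h3 : ‖s / 2 - z₁ * z₂ / 12‖ ≤ 1 / 2 := by
      refine (norm_sub_le _ _).trans ?_
      rw [norm_div s 2, norm_div _ (12 : ℂ), norm_mul z₁ z₂]
      norm_num
      nlinarith [norm_nonneg z₁, norm_nonneg z₂]
    have h4 : (1 : ℂ) = Den + (s / 2 - z₁ * z₂ / 12) := by rw [hDen]; ring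
    have h5 : ‖(1 : ℂ)‖ ≤ ‖Den‖ + ‖s / 2 - z₁ * z₂ / 12‖ := by
      conv_lhs => rw [h4]
      exact norm_add_le _ _
    rw [norm_one] at h5
    linarith
  have iX₁ : Den * X₁ = (1 - z₂ / 4) * (α + F₁) + (1 / 4 - sig) * z₂ * (α + F₂) := by
    rw [hDen, hs, hF₁, hF₂]
    linear_combination (1 - z₂ / 4) * hX₁ + (1 / 4 - sig) * z₂ * hX₂ - (X₁ * z₁ * z₂) * hss
  have iX₂ : Den * X₂ = (1 - z₁ / 4) * (α + F₂) + (1 / 4 + sig) * z₁ * (α + F₁) := by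
    rw [hDen, hs, hF₁, hF₂]
    linear_combination (1 - z₁ / 4) * hX₂ + (1 / 4 + sig) * z₁ * hX₁ - (X₂ * z₁ * z₂) * hss
  have key : Den * (α' - Complex.exp s * α) = Den * ((f₁ + f₂) / 2) +
      (1 / 2 * z₁ * ((1 - z₂ / 4) * F₁ + (1 / 4 - sig) * z₂ * F₂) +
        1 / 2 * z₂ * ((1 - z₁ / 4) * F₂ + (1 / 4 + sig) * z₁ * F₁)) +
      ((1 + s / 2 + z₁ * z₂ / 12) - Den * Complex.exp s) * α := by
    rw [hα']
    linear_combination (1 / 2 * z₁) * iX₁ + (1 / 2 * z₂) * iX₂ + α * (hDen - (1/2) * hs)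
  have n2 := norm_quarter_sub_sig_le
  have n3 := norm_quarter_add_sig_le
  set f := ‖f₁‖ + ‖f₂‖ with hf
  have hf0 : 0 ≤ f := by positivity
  have bF₁ : ‖F₁‖ ≤ f := by
    refine (norm_add_le _ _).trans ?_
    rw [norm_mul, norm_mul, norm_quarter]
    nlinarith [norm_nonneg f₁, norm_nonneg f₂]
  have bF₂ : ‖F₂‖ ≤ f := by
    refine (norm_add_le _ _).trans ?_
    rw [norm_mul, norm_mul, norm_quarter]
    nlinarith [norm_nonneg f₁, norm_nonneg f₂]
  have part : ∀ (z z' p F F' : ℂ), ‖z'‖ ≤ 1 / 4 → ‖p‖ ≤ 3 / 4 → ‖F‖ ≤ f → ‖F'‖ ≤ f →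
      ‖1 / 2 * z * ((1 - z' / 4) * F + p * z' * F')‖ ≤ ‖z‖ * f := by
    intro z z' p F F' hz' hp' hF hF'
    rw [norm_mul, norm_mul, norm_half]
    have a1 : ‖1 - z' / 4‖ ≤ 5 / 4 := by
      refine (norm_sub_le _ _).trans ?_
      norm_num; linarith
    have a2 : ‖(1 - z' / 4) * F + p * z' * F'‖ ≤ 2 * f := by
      refine (norm_add_le _ _).trans ?_
      rw [norm_mul, norm_mul, norm_mul]
      have c1 : ‖1 - z' / 4‖ * ‖F‖ ≤ 5 / 4 * f := by gcongr
      have c2 : ‖p‖ * ‖z'‖ * ‖F'‖ ≤ 3 / 4 * (1 / 4) * f := by gcongr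
      linarith
    nlinarith [norm_nonneg z, mul_le_mul_of_nonneg_left a2 (norm_nonneg z)]
  have b1 := part z₁ z₂ _ F₁ F₂ h₂ (n2.trans (by norm_num)) bF₁ bF₂
  have b2 := part z₂ z₁ _ F₂ F₁ h₁ n3 bF₂ bF₁
  have hn : ‖Den‖ * ‖α' - Complex.exp s * α‖ ≤ ‖Den‖ * ‖(f₁ + f₂) / 2‖ + (‖z₁‖ * f + ‖z₂‖ * f) +
      (‖s‖ ^ 5 + ‖s‖ * ‖d‖ ^ 2) * ‖α‖ := by
    rw [← norm_mul, key]
    refine (norm_add_le _ _).trans (add_le_add ((norm_add_le _ _).trans (add_le_add ?_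
      ((norm_add_le _ _).trans (add_le_add b1 b2)))) ?_)
    · rw [norm_mul]
    · rw [norm_mul]; gcongr
  have hpos : 0 < ‖Den‖ := by linarith
  have c0 : 0 ≤ (‖z₁‖ + ‖z₂‖) * f := by positivity
  have c1 : 0 ≤ (‖s‖ ^ 5 + ‖s‖ * ‖d‖ ^ 2) * ‖α‖ := by positivity
  refine le_of_mul_le_mul_left (hn.trans ?_) hpos
  nlinarith [mul_le_mul_of_nonneg_right hDn c0, mul_le_mul_of_nonneg_right hDn c1]

/-- One step of length `h` of the Gauss--Legendre method for the pair of scalar equations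
`a' = -(u / κ) (a + b)`, `b' = -κ b + (u / κ) (a + b)`, where `u₁`, `u₂` are the values of `u` at
the two nodes; `xⱼ`, `yⱼ` are the slopes and `Xⱼ`, `Yⱼ` the stage values. -/
def IsPairStep (κ : ℂ) (h : ℝ) (u₁ u₂ α β α' β' : ℂ) : Prop :=
  ∃ X₁ X₂ Y₁ Y₂ x₁ x₂ y₁ y₂ : ℂ,
    x₁ = -(u₁ * κ⁻¹) * (X₁ + Y₁) ∧ x₂ = -(u₂ * κ⁻¹) * (X₂ + Y₂) ∧
    y₁ = -κ * Y₁ - x₁ ∧ y₂ = -κ * Y₂ - x₂ ∧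
    X₁ = α + h * (1 / 4 * x₁ + (1 / 4 - sig) * x₂) ∧
    X₂ = α + h * ((1 / 4 + sig) * x₁ + 1 / 4 * x₂) ∧
    Y₁ = β + h * (1 / 4 * y₁ + (1 / 4 - sig) * y₂) ∧
    Y₂ = β + h * ((1 / 4 + sig) * y₁ + 1 / 4 * y₂) ∧
    α' = α + h * (1 / 2 * x₁ + 1 / 2 * x₂) ∧
    β' = β + h * (1 / 2 * y₁ + 1 / 2 * y₂)

/-- Bounds on the potential `u` and on an approximate slow manifold `b = r a` at the nodes of one
panel of length `h`, where `t = 1 / |h κ|` and `g` is a weight: `r₀`, `r₃` are the values of `r` at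
the end points, `rⱼ` and `dⱼ` those of `r` and `r'` at the nodes. -/
structure PanelBounds (M h t g : ℝ) (κ u₁ u₂ r₀ r₁ r₂ r₃ d₁ d₂ : ℂ) : Prop where
  pot₁ : ‖u₁‖ ≤ M * g
  pot₂ : ‖u₂‖ ≤ M * g
  pot_sub : ‖u₂ - u₁‖ ≤ M * g * h
  slow₁ : ‖r₁‖ ≤ 1
  slow₂ : ‖r₂‖ ≤ 1
  slope₁ : ‖d₁‖ ≤ M * g * (h ^ 2 * t ^ 2)
  slope₂ : ‖d₂‖ ≤ M * g * (h ^ 2 * t ^ 2)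
  slow_sub₁ : ‖r₁ - r₀‖ ≤ M * g * (h ^ 3 * t ^ 2)
  slow_sub₂ : ‖r₂ - r₀‖ ≤ M * g * (h ^ 3 * t ^ 2)
  stage₁ : ‖r₁ - r₀ - h * (1 / 4 * d₁ + (1 / 4 - sig) * d₂)‖ ≤ M * g * (h ^ 5 * t ^ 2)
  stage₂ : ‖r₂ - r₀ - h * ((1 / 4 + sig) * d₁ + 1 / 4 * d₂)‖ ≤ M * g * (h ^ 5 * t ^ 2)
  final : ‖r₃ - r₀ - h * (1 / 2 * d₁ + 1 / 2 * d₂)‖ ≤ M * g * (h ^ 5 * t ^ 2)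
  defect₁ : ‖d₁ + κ * r₁ - u₁ * κ⁻¹ * (1 + r₁) ^ 2‖ ≤ M * g * (h ^ 4 * t ^ 4)
  defect₂ : ‖d₂ + κ * r₂ - u₂ * κ⁻¹ * (1 + r₂) ^ 2‖ ≤ M * g * (h ^ 4 * t ^ 4)

theorem norm_stage_sub_le {h S : ℝ} {α p q x₁ x₂ X : ℂ} (hh : 0 ≤ h) (hp : ‖p‖ ≤ 3 / 4)
    (hq : ‖q‖ ≤ 3 / 4) (h₁ : ‖x₁‖ ≤ S) (h₂ : ‖x₂‖ ≤ S) (hX : X = α + h * (p * x₁ + q * x₂)) :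
    ‖X - α‖ ≤ 3 / 2 * (h * S) := by
  have e : X - α = h * (p * x₁ + q * x₂) := by rw [hX]; ring
  have h3 : ‖p * x₁ + q * x₂‖ ≤ 3 / 2 * S := by
    refine (norm_add_le _ _).trans ?_
    rw [norm_mul, norm_mul]
    have a1 : ‖p‖ * ‖x₁‖ ≤ 3 / 4 * S := by gcongr
    have a2 : ‖q‖ * ‖x₂‖ ≤ 3 / 4 * S := by gcongr
    linarith
  rw [e, norm_mul, Complex.norm_real, Real.norm_eq_abs, abs_of_nonneg hh]
  calc h * ‖p * x₁ + q * x₂‖ ≤ h * (3 / 2 * S) := by gcongr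
    _ = _ := by ring

theorem norm_weighted_le {h b₁ b₂ : ℝ} {p q v₁ v₂ : ℂ} (hh : 0 ≤ h) (hp : ‖p‖ ≤ 3 / 4)
    (hq : ‖q‖ ≤ 3 / 4) (h₁ : ‖v₁‖ ≤ b₁) (h₂ : ‖v₂‖ ≤ b₂) :
    ‖(h : ℂ) * (p * v₁ + q * v₂)‖ ≤ 3 / 4 * (h * (b₁ + b₂)) := by
  have h3 : ‖p * v₁ + q * v₂‖ ≤ 3 / 4 * (b₁ + b₂) := by
    refine (norm_add_le _ _).trans ?_
    rw [norm_mul, norm_mul, mul_add]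
    gcongr
  rw [norm_mul, Complex.norm_real, Real.norm_eq_abs, abs_of_nonneg hh]
  calc h * ‖p * v₁ + q * v₂‖ ≤ h * (3 / 4 * (b₁ + b₂)) := by gcongr
    _ = _ := by ring

set_option maxHeartbeats 1600000 in
/-- The deviation from the slow manifold satisfies the stage equations of the fast equation up to
a small defect. -/
theorem slow_defect {A h t S : ℝ} {κ u₁ u₂ r₀ r₁ r₂ r d₁ d₂ α β p q X Y X₁ X₂ Y₁ Y₂ x₁ x₂ y₁ y₂ : ℂ}
    (hA : 0 ≤ A) (hAt : A * t ≤ 1 / 52) (hh : 0 ≤ h) (h1 : h ≤ 1) (ht : 0 ≤ t) (ht1 : t ≤ 1 / 52)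
    (hκ : ‖κ⁻¹‖ = h * t)
    (hu₁ : ‖u₁‖ ≤ A) (hu₂ : ‖u₂‖ ≤ A) (hr₁ : ‖r₁‖ ≤ 1) (hr₂ : ‖r₂‖ ≤ 1)
    (hd₁ : ‖d₁‖ ≤ A * (h ^ 2 * t ^ 2)) (hd₂ : ‖d₂‖ ≤ A * (h ^ 2 * t ^ 2))
    (hrs₁ : ‖r₁ - r₀‖ ≤ A * (h ^ 3 * t ^ 2)) (hrs₂ : ‖r₂ - r₀‖ ≤ A * (h ^ 3 * t ^ 2))
    (hρ₁ : ‖d₁ + κ * r₁ - u₁ * κ⁻¹ * (1 + r₁) ^ 2‖ ≤ A * (h ^ 4 * t ^ 4))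
    (hρ₂ : ‖d₂ + κ * r₂ - u₂ * κ⁻¹ * (1 + r₂) ^ 2‖ ≤ A * (h ^ 4 * t ^ 4))
    (hτ : ‖r - r₀ - h * (p * d₁ + q * d₂)‖ ≤ A * (h ^ 5 * t ^ 2))
    (hx₁ : x₁ = -(u₁ * κ⁻¹) * (X₁ + Y₁)) (hx₂ : x₂ = -(u₂ * κ⁻¹) * (X₂ + Y₂))
    (hy₁ : y₁ = -κ * Y₁ - x₁) (hy₂ : y₂ = -κ * Y₂ - x₂)
    (hX : X = α + h * (p * x₁ + q * x₂)) (hY : Y = β + h * (p * y₁ + q * y₂))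
    (hp : ‖p‖ ≤ 3 / 4) (hq : ‖q‖ ≤ 3 / 4) (hS₁ : ‖x₁‖ ≤ S) (hS₂ : ‖x₂‖ ≤ S)
    (hS : S ≤ h * (A * t) * (2 * (‖X₁‖ + ‖X₂‖) + (‖Y₁ - r₁ * X₁‖ + ‖Y₂ - r₂ * X₂‖)))
    (hX₁ : ‖X₁ - α‖ ≤ 3 / 2 * (h * S)) (hX₂ : ‖X₂ - α‖ ≤ 3 / 2 * (h * S)) :
    ‖(Y - r * X) - (β - r₀ * α) + h * κ * (p * (Y₁ - r₁ * X₁) + q * (Y₂ - r₂ * X₂))‖ ≤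
      50 * A * h ^ 5 * t ^ 2 * ‖α‖ +
        26 * A * h ^ 2 * t * (‖Y₁ - r₁ * X₁‖ + ‖Y₂ - r₂ * X₂‖) := by
  set E₁ := Y₁ - r₁ * X₁ with hE₁
  set E₂ := Y₂ - r₂ * X₂ with hE₂
  have hXα := norm_stage_sub_le hh hp hq hS₁ hS₂ hX
  set ρ₁ := d₁ + κ * r₁ - u₁ * κ⁻¹ * (1 + r₁) ^ 2 with hρ₁'
  set ρ₂ := d₂ + κ * r₂ - u₂ * κ⁻¹ * (1 + r₂) ^ 2 with hρ₂'
  -- The approximate manifold equation rewrites the slope of the fast component as the derivative of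
  -- `r a` along the flow, plus a fast linear term in the deviation and the defect `ρ₁`.
  have iy₁ : y₁ = (d₁ - ρ₁) * X₁ + r₁ * x₁ + (-κ + u₁ * κ⁻¹ * (1 + r₁)) * E₁ := by
    rw [hy₁, hx₁, hρ₁', hE₁]; ring
  have iy₂ : y₂ = (d₂ - ρ₂) * X₂ + r₂ * x₂ + (-κ + u₂ * κ⁻¹ * (1 + r₂)) * E₂ := by
    rw [hy₂, hx₂, hρ₂', hE₂]; ring
  -- The residual consists of the quadrature error for `r`, the variation of `X` between the stages,
  -- the variation of `r`, the manifold defects and the coupling back to the deviation. The weights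
  -- `p`, `q` are kept general, so the same estimate serves both stages and the final update.
  have key : (Y - r * X) - (β - r₀ * α) + h * κ * (p * E₁ + q * E₂) =
      -((r - r₀ - h * (p * d₁ + q * d₂)) * X) +
      h * (p * (d₁ * (X₁ - X)) + q * (d₂ * (X₂ - X))) +
      h * (p * ((r₁ - r₀) * x₁) + q * ((r₂ - r₀) * x₂)) -
      h * (p * (ρ₁ * X₁) + q * (ρ₂ * X₂)) +
      h * (p * (u₁ * κ⁻¹ * (1 + r₁) * E₁) + q * (u₂ * κ⁻¹ * (1 + r₂) * E₂)) := by
    linear_combination hY - r₀ * hX + (h : ℂ) * p * iy₁ + (h : ℂ) * q * iy₂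
  set m := ‖X₁‖ + ‖X₂‖ with hm
  set n := ‖E₁‖ + ‖E₂‖ with hn
  set a := ‖α‖
  have hm0 : 0 ≤ m := by positivity
  have hn0 : 0 ≤ n := by positivity
  have ha0 : 0 ≤ a := norm_nonneg _
  have hS0 : 0 ≤ S := (norm_nonneg _).trans hS₁
  have hSb : S ≤ 1 / 52 * (2 * m + n) := by
    refine hS.trans (mul_le_mul_of_nonneg_right ?_ (by positivity))
    calc h * (A * t) ≤ 1 * (1 / 52) := by gcongr
      _ = _ := by ring
  have hhS : h * S ≤ 1 / 52 * (2 * m + n) := (mul_le_of_le_one_left hS0 h1).trans hSb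
  have tri : ∀ W : ℂ, ‖W - α‖ ≤ 3 / 2 * (h * S) → ‖W‖ ≤ a + 3 / 2 * (h * S) := fun W hW => by
    have := norm_add_le α (W - α)
    rw [add_sub_cancel] at this
    linarith
  have hma : m ≤ 3 * a + n := by
    have := tri _ hX₁
    have := tri _ hX₂
    linarith
  have hXn : ‖X‖ ≤ a + (2 * m + n) := by
    have := tri _ hXα
    linarith
  have hXX : ∀ W : ℂ, ‖W - α‖ ≤ 3 / 2 * (h * S) → ‖W - X‖ ≤ 3 * (h * S) := fun W hW => by
    have e : W - X = (W - α) - (X - α) := by ring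
    rw [e]
    exact (norm_sub_le _ _).trans (by linarith)
  have hSS : S ≤ h * (2 * m + n) := by
    refine hS.trans (mul_le_mul_of_nonneg_right ?_ (by positivity))
    calc h * (A * t) ≤ h * (1 / 52) := by gcongr
      _ ≤ h := by linarith
  set B := A * (h ^ 5 * t ^ 2) with hB
  have hB0 : 0 ≤ B := by positivity
  have t1 : ‖(r - r₀ - h * (p * d₁ + q * d₂)) * X‖ ≤ B * (a + (2 * m + n)) := by
    rw [norm_mul]; gcongr
  have t2 : ‖(h : ℂ) * (p * (d₁ * (X₁ - X)) + q * (d₂ * (X₂ - X)))‖ ≤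
      B * (9 / 2 * (2 * m + n)) := by
    have b : ∀ d W : ℂ, ‖d‖ ≤ A * (h ^ 2 * t ^ 2) → ‖W - α‖ ≤ 3 / 2 * (h * S) →
        ‖d * (W - X)‖ ≤ A * (h ^ 2 * t ^ 2) * (3 * (h * S)) := fun d W hd hW => by
      rw [norm_mul]; gcongr; exact hXX W hW
    refine (norm_weighted_le hh hp hq (b _ _ hd₁ hX₁) (b _ _ hd₂ hX₂)).trans ?_
    calc _ = 9 / 2 * (A * (h ^ 4 * t ^ 2)) * S := by ring
      _ ≤ 9 / 2 * (A * (h ^ 4 * t ^ 2)) * (h * (2 * m + n)) := by gcongr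
      _ = _ := by rw [hB]; ring
  have t3 : ‖(h : ℂ) * (p * ((r₁ - r₀) * x₁) + q * ((r₂ - r₀) * x₂))‖ ≤
      B * (3 / 2 * (2 * m + n)) := by
    have b : ∀ d x : ℂ, ‖d‖ ≤ A * (h ^ 3 * t ^ 2) → ‖x‖ ≤ S →
        ‖d * x‖ ≤ A * (h ^ 3 * t ^ 2) * S := fun d x hd hx => by
      rw [norm_mul]; gcongr
    refine (norm_weighted_le hh hp hq (b _ _ hrs₁ hS₁) (b _ _ hrs₂ hS₂)).trans ?_
    calc _ = 3 / 2 * (A * (h ^ 4 * t ^ 2)) * S := by ring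
      _ ≤ 3 / 2 * (A * (h ^ 4 * t ^ 2)) * (h * (2 * m + n)) := by gcongr
      _ = _ := by rw [hB]; ring
  have t4 : ‖(h : ℂ) * (p * (ρ₁ * X₁) + q * (ρ₂ * X₂))‖ ≤ B * m := by
    have b : ∀ d x : ℂ, ‖d‖ ≤ A * (h ^ 4 * t ^ 4) → ‖d * x‖ ≤ A * (h ^ 4 * t ^ 4) * ‖x‖ :=
      fun d x hd => by rw [norm_mul]; gcongr
    refine (norm_weighted_le hh hp hq (b _ _ hρ₁) (b _ _ hρ₂)).trans ?_
    calc _ = 3 / 4 * (A * (h ^ 5 * t ^ 2)) * m * t ^ 2 := by rw [hm]; ring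
      _ ≤ 3 / 4 * (A * (h ^ 5 * t ^ 2)) * m * 1 ^ 2 := by gcongr; linarith
      _ ≤ _ := by
        have := mul_nonneg hB0 hm0
        rw [← hB]
        linarith
  have t5 : ‖(h : ℂ) * (p * (u₁ * κ⁻¹ * (1 + r₁) * E₁) + q * (u₂ * κ⁻¹ * (1 + r₂) * E₂))‖ ≤
      2 * A * h ^ 2 * t * n := by
    have b : ∀ u r E : ℂ, ‖u‖ ≤ A → ‖r‖ ≤ 1 → ‖u * κ⁻¹ * (1 + r) * E‖ ≤ A * (h * t) * 2 * ‖E‖ :=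
      fun u r E hu hr => by
        have : ‖1 + r‖ ≤ 2 := (norm_add_le _ _).trans (by rw [norm_one]; linarith)
        rw [norm_mul, norm_mul, norm_mul, hκ]; gcongr
    refine (norm_weighted_le hh hp hq (b _ _ _ hu₁ hr₁) (b _ _ _ hu₂ hr₂)).trans ?_
    have : 0 ≤ A * h ^ 2 * t * n := by positivity
    calc _ = 3 / 2 * (A * h ^ 2 * t * n) := by rw [hn]; ring
      _ ≤ _ := by linarith
  rw [key]
  have total := norm_add_le
    (-((r - r₀ - h * (p * d₁ + q * d₂)) * X) +
      h * (p * (d₁ * (X₁ - X)) + q * (d₂ * (X₂ - X))) +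
      h * (p * ((r₁ - r₀) * x₁) + q * ((r₂ - r₀) * x₂)) -
      h * (p * (ρ₁ * X₁) + q * (ρ₂ * X₂)))
    (h * (p * (u₁ * κ⁻¹ * (1 + r₁) * E₁) + q * (u₂ * κ⁻¹ * (1 + r₂) * E₂)))
  have total2 := norm_sub_le
    (-((r - r₀ - h * (p * d₁ + q * d₂)) * X) +
      h * (p * (d₁ * (X₁ - X)) + q * (d₂ * (X₂ - X))) +
      h * (p * ((r₁ - r₀) * x₁) + q * ((r₂ - r₀) * x₂)))
    (h * (p * (ρ₁ * X₁) + q * (ρ₂ * X₂)))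
  have total3 := norm_add₃_le (a := -((r - r₀ - h * (p * d₁ + q * d₂)) * X))
    (b := h * (p * (d₁ * (X₁ - X)) + q * (d₂ * (X₂ - X))))
    (c := h * (p * ((r₁ - r₀) * x₁) + q * ((r₂ - r₀) * x₂)))
  rw [norm_neg] at total3
  have sum1 : B * (a + (2 * m + n)) + B * (9 / 2 * (2 * m + n)) + B * (3 / 2 * (2 * m + n)) +
      B * m ≤ B * (50 * a) + B * (24 * n) := by
    rw [← mul_add, ← mul_add, ← mul_add, ← mul_add]
    refine mul_le_mul_of_nonneg_left ?_ hB0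
    linarith
  have sum2 : B * (24 * n) ≤ 24 * A * h ^ 2 * t * n := by
    calc B * (24 * n) = 24 * A * h ^ 2 * t * n * (h ^ 3 * t) := by rw [hB]; ring
      _ ≤ 24 * A * h ^ 2 * t * n * (1 ^ 3 * 1) := by gcongr; linarith
      _ = _ := by ring
  have sum3 : B * (50 * a) = 50 * A * h ^ 5 * t ^ 2 * a := by rw [hB]; ring
  linarith

set_option maxHeartbeats 1600000 in
/-- The error recursion for one step: `β - r₀ α` is damped, and `α` is multiplied by the
exponential of the quadrature approximation, up to small terms. -/
theorem pair_step {M h t g δ : ℝ} {κ u₁ u₂ r₀ r₁ r₂ r₃ d₁ d₂ α β α' β' : ℂ}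
    (hM : 1 ≤ M) (hMt : M * t ≤ 1 / 52) (hh : 0 < h) (h1 : h ≤ 1) (ht : 0 < t)
    (hg : 0 ≤ g) (hg1 : g ≤ 1) (hδ : 0 < δ)
    (hκt : ‖(h : ℂ) * κ‖ * t = 1) (hre : δ * ‖κ‖ ≤ κ.re)
    (hb : PanelBounds M h t g κ u₁ u₂ r₀ r₁ r₂ r₃ d₁ d₂)
    (hstep : IsPairStep κ h u₁ u₂ α β α' β') :
    ‖β' - r₃ * α'‖ ≤ (1 - 3 * δ * t) * ‖β - r₀ * α‖ +
      100000 * M ^ 5 * g * (h ^ 2 * t ^ 2 * ‖β - r₀ * α‖ + h ^ 5 * t ^ 2 * ‖α‖) ∧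
    ‖α' - Complex.exp (-(h * κ⁻¹ / 2) * (u₁ * (1 + r₁) + u₂ * (1 + r₂))) * α‖ ≤
      100000 * M ^ 5 * g * ((h ^ 2 * t ^ 3 + h ^ 3 * t ^ 2) * ‖β - r₀ * α‖ +
        (h ^ 7 * t ^ 4 + h ^ 8 * t ^ 3) * ‖α‖) := by
  obtain ⟨X₁, X₂, Y₁, Y₂, x₁, x₂, y₁, y₂, hx₁, hx₂, hy₁, hy₂, hX₁, hX₂, hY₁, hY₂, hα', hβ'⟩ := hstep
  have ht1 : t ≤ 1 / 52 := (le_mul_of_one_le_left ht.le hM).trans hMt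
  have hnz : ‖(h : ℂ) * κ‖ = h * ‖κ‖ := by
    rw [norm_mul, Complex.norm_real, Real.norm_eq_abs, abs_of_pos hh]
  have hκ0 : κ ≠ 0 := by
    rintro rfl
    simp at hκt
  have hκn : 0 < ‖κ‖ := norm_pos_iff.2 hκ0
  have hκ : ‖κ⁻¹‖ = h * t := by
    rw [norm_inv, inv_eq_one_div, div_eq_iff hκn.ne', ← hκt, hnz]; ring
  -- Since `t = 1/|hκ|`, the bound `t ≤ 1/52` leaves room above the threshold `48` of the stage
  -- estimates.
  have hz : 48 ≤ ‖(h : ℂ) * κ‖ := by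
    by_contra hlt
    push Not at hlt
    have := mul_le_mul hlt.le ht1 ht.le (by norm_num)
    norm_num at this hκt
    linarith
  have hzre : δ * ‖(h : ℂ) * κ‖ ≤ ((h : ℂ) * κ).re := by
    rw [hnz, Complex.re_ofReal_mul, mul_left_comm]
    exact mul_le_mul_of_nonneg_left hre hh.le
  set A := M * g with hAdef
  have hA : 0 ≤ A := by positivity
  have hAM : A ≤ M := mul_le_of_le_one_right (by linarith) hg1
  have hAt : A * t ≤ 1 / 52 := (mul_le_mul_of_nonneg_right hAM ht.le).trans hMt
  set E₁ := Y₁ - r₁ * X₁ with hE₁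
  set E₂ := Y₂ - r₂ * X₂ with hE₂
  set e := β - r₀ * α with he
  set n := ‖E₁‖ + ‖E₂‖ with hn
  set a := ‖α‖ with ha
  set S := h * (A * t) * (2 * (‖X₁‖ + ‖X₂‖) + n) with hS
  have hSx : ∀ u r X Y x : ℂ, ‖u‖ ≤ A → ‖r‖ ≤ 1 → x = -(u * κ⁻¹) * (X + Y) →
      ‖X‖ ≤ ‖X₁‖ + ‖X₂‖ → ‖Y - r * X‖ ≤ n → ‖x‖ ≤ S := by
    intro u r X Y x hu hr hx hX hE
    have e1 : X + Y = (1 + r) * X + (Y - r * X) := by ring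
    have e2 : ‖1 + r‖ ≤ 2 := (norm_add_le _ _).trans (by rw [norm_one]; linarith)
    have e3 : ‖X + Y‖ ≤ 2 * (‖X₁‖ + ‖X₂‖) + n := by
      rw [e1]
      refine (norm_add_le _ _).trans (add_le_add ?_ hE)
      rw [norm_mul]; gcongr
    rw [hx, norm_mul, norm_neg, norm_mul, hκ]
    calc ‖u‖ * (h * t) * ‖X + Y‖ ≤ A * (h * t) * (2 * (‖X₁‖ + ‖X₂‖) + n) := by gcongr
      _ = S := by rw [hS]; ring
  have hS₁ := hSx u₁ r₁ X₁ Y₁ x₁ hb.pot₁ hb.slow₁ hx₁ (by linarith [norm_nonneg X₂])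
    (by linarith [norm_nonneg E₂])
  have hS₂ := hSx u₂ r₂ X₂ Y₂ x₂ hb.pot₂ hb.slow₂ hx₂ (by linarith [norm_nonneg X₁])
    (by linarith [norm_nonneg E₁])
  have w1 : ‖(1 / 4 : ℂ)‖ ≤ 3 / 4 := by rw [norm_quarter]; norm_num
  have w2 : ‖1 / 4 - sig‖ ≤ 3 / 4 := norm_quarter_sub_sig_le.trans (by norm_num)
  have w3 := norm_quarter_add_sig_le
  have w4 : ‖(1 / 2 : ℂ)‖ ≤ 3 / 4 := by rw [norm_half]; norm_num
  have hXα₁ := norm_stage_sub_le hh.le w1 w2 hS₁ hS₂ hX₁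
  have hXα₂ := norm_stage_sub_le hh.le w3 w1 hS₁ hS₂ hX₂
  have D₁ := slow_defect hA hAt hh.le h1 ht.le ht1 hκ hb.pot₁ hb.pot₂ hb.slow₁ hb.slow₂ hb.slope₁ hb.slope₂ hb.slow_sub₁
    hb.slow_sub₂ hb.defect₁ hb.defect₂ hb.stage₁ hx₁ hx₂ hy₁ hy₂ hX₁ hY₁ w1 w2 hS₁ hS₂ le_rfl hXα₁ hXα₂
  have D₂ := slow_defect hA hAt hh.le h1 ht.le ht1 hκ hb.pot₁ hb.pot₂ hb.slow₁ hb.slow₂ hb.slope₁ hb.slope₂ hb.slow_sub₁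
    hb.slow_sub₂ hb.defect₁ hb.defect₂ hb.stage₂ hx₁ hx₂ hy₁ hy₂ hX₂ hY₂ w3 w1 hS₁ hS₂ le_rfl hXα₁ hXα₂
  have D₃ := slow_defect hA hAt hh.le h1 ht.le ht1 hκ hb.pot₁ hb.pot₂ hb.slow₁ hb.slow₂ hb.slope₁ hb.slope₂ hb.slow_sub₁
    hb.slow_sub₂ hb.defect₁ hb.defect₂ hb.final hx₁ hx₂ hy₁ hy₂ hα' hβ' w4 w4 hS₁ hS₂ le_rfl hXα₁ hXα₂
  rw [← hE₁, ← hE₂, ← he] at D₁ D₂ D₃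
  rw [← hn, ← ha] at D₁ D₂ D₃
  set d := 50 * A * h ^ 5 * t ^ 2 * a + 26 * A * h ^ 2 * t * n with hd
  -- The inhomogeneities of the stage equations are defined as the residuals, which `slow_defect`
  -- bounds by `d`.
  obtain ⟨s1, s2, s3⟩ := stage_solve (e := e) hz hκt
    (show E₁ + (h : ℂ) * κ * (1 / 4 * E₁ + (1 / 4 - sig) * E₂) = e +
      (E₁ - e + h * κ * (1 / 4 * E₁ + (1 / 4 - sig) * E₂)) by ring)
    (show E₂ + (h : ℂ) * κ * ((1 / 4 + sig) * E₁ + 1 / 4 * E₂) = e +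
      (E₂ - e + h * κ * ((1 / 4 + sig) * E₁ + 1 / 4 * E₂)) by ring) D₁ D₂
  rw [← hn] at s1
  have ha0 : 0 ≤ a := norm_nonneg _
  have hn0 : 0 ≤ n := by positivity
  have he0 : 0 ≤ ‖e‖ := norm_nonneg _
  set P := A * h ^ 5 * t ^ 2 * a with hP
  have hP0 : 0 ≤ P := by positivity
  have hh2 : h ^ 2 ≤ 1 := pow_le_one₀ hh.le h1
  -- bound for the stage deviations
  have c1 : 48 * t * (26 * A * h ^ 2 * t * n) ≤ 1 / 2 * n := by
    calc 48 * t * (26 * A * h ^ 2 * t * n) = 1248 * (A * t) * t * n * h ^ 2 := by ring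
      _ ≤ 1248 * (1 / 52) * (1 / 52) * n * 1 := by gcongr
      _ ≤ _ := by linarith
  have hnb : n ≤ 96 * t * (‖e‖ + 50 * P) := by
    have : 48 * t * (‖e‖ + d) = 48 * t * (‖e‖ + 50 * P) + 48 * t * (26 * A * h ^ 2 * t * n) := by
      rw [hd, hP]; ring
    linarith
  have hdb : d ≤ 100 * P + 2500 * A * h ^ 2 * t ^ 2 * ‖e‖ := by
    have i1 : 26 * A * h ^ 2 * t * n ≤ 26 * A * h ^ 2 * t * (96 * t * (‖e‖ + 50 * P)) := by
      gcongr
    have i2 : 26 * A * h ^ 2 * t * (96 * t * (50 * P)) ≤ 50 * P := by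
      calc 26 * A * h ^ 2 * t * (96 * t * (50 * P)) = 2496 * (A * t) * t * (50 * P) * h ^ 2 := by
            ring
        _ ≤ 2496 * (1 / 52) * (1 / 52) * (50 * P) * 1 := by gcongr
        _ ≤ _ := by linarith
    have i3 : 26 * A * h ^ 2 * t * (96 * t * ‖e‖) ≤ 2500 * A * h ^ 2 * t ^ 2 * ‖e‖ := by
      have : 0 ≤ A * h ^ 2 * t ^ 2 * ‖e‖ := by positivity
      calc 26 * A * h ^ 2 * t * (96 * t * ‖e‖) = 2496 * (A * h ^ 2 * t ^ 2 * ‖e‖) := by ring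
        _ ≤ 2500 * (A * h ^ 2 * t ^ 2 * ‖e‖) := by linarith
        _ = _ := by ring
    have i4 : d = 50 * P + 26 * A * h ^ 2 * t * n := by rw [hd, hP]; ring
    have i5 : 26 * A * h ^ 2 * t * (96 * t * (‖e‖ + 50 * P)) =
      26 * A * h ^ 2 * t * (96 * t * ‖e‖) + 26 * A * h ^ 2 * t * (96 * t * (50 * P)) := by ring
    linarith
  have hM5 : M ≤ M ^ 5 := by
    calc M = M ^ 1 := (pow_one M).symm
      _ ≤ M ^ 5 := pow_le_pow_right₀ hM (by norm_num)
  have hA5 : A ≤ M ^ 5 * g := by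
    rw [hAdef]; gcongr
  have hA25 : A * M ≤ M ^ 5 * g := by
    have : M ^ 2 ≤ M ^ 5 := pow_le_pow_right₀ hM (by norm_num)
    calc A * M = M ^ 2 * g := by rw [hAdef]; ring
      _ ≤ _ := by gcongr
  constructor
  · have hR := norm_one_sub_div_stabDen_le hδ hz hκt hzre
    have e' : β' - r₃ * α' = (e - h * κ * ((E₁ + E₂) / 2)) +
        (β' - r₃ * α' - e + h * κ * (1 / 2 * E₁ + 1 / 2 * E₂)) := by ring
    have j1 : ‖β' - r₃ * α'‖ ≤ ‖1 - h * κ / stabDen (h * κ)‖ * ‖e‖ + 24 * d + d := by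
      conv_lhs => rw [e']
      exact (norm_add_le _ _).trans (add_le_add s3 D₃)
    have j2 : ‖1 - h * κ / stabDen (h * κ)‖ * ‖e‖ ≤ (1 - 3 * δ * t) * ‖e‖ := by gcongr
    have j3 : 25 * (100 * P + 2500 * A * h ^ 2 * t ^ 2 * ‖e‖) ≤
        100000 * M ^ 5 * g * (h ^ 2 * t ^ 2 * ‖e‖ + h ^ 5 * t ^ 2 * a) := by
      have k1 : 0 ≤ h ^ 2 * t ^ 2 * ‖e‖ := by positivity
      have k2 : 0 ≤ h ^ 5 * t ^ 2 * a := by positivity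
      have k3 := mul_le_mul_of_nonneg_right hA5 k1
      have k4 := mul_le_mul_of_nonneg_right hA5 k2
      have k5 : 0 ≤ M ^ 5 * g * (h ^ 2 * t ^ 2 * ‖e‖) := by positivity
      have k6 : 0 ≤ M ^ 5 * g * (h ^ 5 * t ^ 2 * a) := by positivity
      calc 25 * (100 * P + 2500 * A * h ^ 2 * t ^ 2 * ‖e‖) =
          2500 * (A * (h ^ 5 * t ^ 2 * a)) + 62500 * (A * (h ^ 2 * t ^ 2 * ‖e‖)) := by
            rw [hP]; ring
        _ ≤ 100000 * (M ^ 5 * g * (h ^ 5 * t ^ 2 * a)) +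
            100000 * (M ^ 5 * g * (h ^ 2 * t ^ 2 * ‖e‖)) := by linarith
        _ = _ := by ring
    linarith
  · -- the dominant component
    have hv : ∀ u r : ℂ, ‖u‖ ≤ A → ‖r‖ ≤ 1 →
        ‖-(h * κ⁻¹) * (u * (1 + r))‖ ≤ 2 * (h ^ 2 * t) * A := by
      intro u r hu hr
      have e2 : ‖1 + r‖ ≤ 2 := (norm_add_le _ _).trans (by rw [norm_one]; linarith)
      rw [norm_mul, norm_neg, norm_mul, norm_mul, hκ, Complex.norm_real, Real.norm_eq_abs,
        abs_of_pos hh]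
      calc h * (h * t) * (‖u‖ * ‖1 + r‖) ≤ h * (h * t) * (A * 2) := by gcongr
        _ = _ := by ring
    have hz₁ := hv u₁ r₁ hb.pot₁ hb.slow₁
    have hz₂ := hv u₂ r₂ hb.pot₂ hb.slow₂
    have hsmall : 2 * (h ^ 2 * t) * A ≤ 1 / 26 := by
      calc 2 * (h ^ 2 * t) * A = 2 * h ^ 2 * (A * t) := by ring
        _ ≤ 2 * 1 * (1 / 52) := by gcongr
        _ = _ := by norm_num
    have hf : ∀ u E : ℂ, ‖u‖ ≤ A → ‖-(h * κ⁻¹) * (u * E)‖ ≤ h ^ 2 * t * A * ‖E‖ := by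
      intro u E hu
      rw [norm_mul, norm_neg, norm_mul, norm_mul, hκ, Complex.norm_real, Real.norm_eq_abs,
        abs_of_pos hh]
      calc h * (h * t) * (‖u‖ * ‖E‖) ≤ h * (h * t) * (A * ‖E‖) := by gcongr
        _ = _ := by ring
    have hf₁ := hf u₁ E₁ hb.pot₁
    have hf₂ := hf u₂ E₂ hb.pot₂
    set z₁ := -(h * κ⁻¹) * (u₁ * (1 + r₁)) with hz₁'
    set z₂ := -(h * κ⁻¹) * (u₂ * (1 + r₂)) with hz₂'
    set f₁ := -(h * κ⁻¹) * (u₁ * E₁) with hf₁'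
    set f₂ := -(h * κ⁻¹) * (u₂ * E₂) with hf₂'
    have q₁ : (h : ℂ) * x₁ = z₁ * X₁ + f₁ := by rw [hx₁, hz₁', hf₁', hE₁]; ring
    have q₂ : (h : ℂ) * x₂ = z₂ * X₂ + f₂ := by rw [hx₂, hz₂', hf₂', hE₂]; ring
    have sc := scalar_step (α := α) (α' := α') (X₁ := X₁) (X₂ := X₂) (z₁ := z₁) (z₂ := z₂)
      (f₁ := f₁) (f₂ := f₂) (by linarith) (by linarith)
      (by rw [← q₁, ← q₂]; linear_combination hX₁) (by rw [← q₁, ← q₂]; linear_combination hX₂)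
      (by rw [← q₁, ← q₂]; linear_combination hα')
    have harg : -(h * κ⁻¹ / 2) * (u₁ * (1 + r₁) + u₂ * (1 + r₂)) = (z₁ + z₂) / 2 := by
      rw [hz₁', hz₂']; ring
    rw [harg]
    have b1 : ‖(f₁ + f₂) / 2‖ ≤ h ^ 2 * t * (A * (24 * t ^ 2 * ‖e‖ + 24 * t * d) + A * h * n) := by
      -- The mean forcing is split into a multiple of the mean deviation, which is small by
      -- cancellation, and a term with `u₂ - u₁`, which gains a factor `h`.
      have : (f₁ + f₂) / 2 = -(h * κ⁻¹) * (u₁ * ((E₁ + E₂) / 2) + (u₂ - u₁) * (E₂ / 2)) := by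
        rw [hf₁', hf₂']; ring
      rw [this, norm_mul, norm_neg, norm_mul, hκ, Complex.norm_real, Real.norm_eq_abs,
        abs_of_pos hh]
      have i1 : ‖u₁ * ((E₁ + E₂) / 2)‖ ≤ A * (24 * t ^ 2 * ‖e‖ + 24 * t * d) := by
        rw [norm_mul]
        exact mul_le_mul hb.pot₁ s2 (norm_nonneg _) hA
      have i2 : ‖(u₂ - u₁) * (E₂ / 2)‖ ≤ A * h * n := by
        rw [norm_mul]
        refine mul_le_mul hb.pot_sub ?_ (norm_nonneg _) (by positivity)
        rw [norm_div, Complex.norm_two]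
        linarith [norm_nonneg E₁, norm_nonneg E₂]
      calc h * (h * t) * ‖u₁ * ((E₁ + E₂) / 2) + (u₂ - u₁) * (E₂ / 2)‖ ≤
          h * (h * t) * (A * (24 * t ^ 2 * ‖e‖ + 24 * t * d) + A * h * n) := by
            gcongr; exact (norm_add_le _ _).trans (add_le_add i1 i2)
        _ = _ := by ring
    have b2 : 4 * (‖z₁‖ + ‖z₂‖) * (‖f₁‖ + ‖f₂‖) ≤ h ^ 2 * t * (A * h * n) := by
      calc 4 * (‖z₁‖ + ‖z₂‖) * (‖f₁‖ + ‖f₂‖) ≤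
          4 * (2 * (h ^ 2 * t) * A + 2 * (h ^ 2 * t) * A) *
            (h ^ 2 * t * A * ‖E₁‖ + h ^ 2 * t * A * ‖E₂‖) := by gcongr
        _ = 16 * (A * t) * h * (h ^ 2 * t * (A * h * n)) := by rw [hn]; ring
        _ ≤ 16 * (1 / 52) * 1 * (h ^ 2 * t * (A * h * n)) := by gcongr
        _ ≤ _ := by
          have : 0 ≤ h ^ 2 * t * (A * h * n) := by positivity
          linarith
    have bs : ‖(z₁ + z₂) / 2‖ ≤ 2 * (h ^ 2 * t) * A := by
      rw [norm_div, Complex.norm_two]; linarith [norm_add_le z₁ z₂]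
    have bd : ‖(z₁ - z₂) / 2‖ ≤ 2 * h ^ 3 * t * A := by
      have : (z₁ - z₂) / 2 = (h * κ⁻¹) * (((u₂ - u₁) * (1 + r₁) +
          u₂ * ((r₂ - r₀) - (r₁ - r₀))) / 2) := by rw [hz₁', hz₂']; ring
      have e2 : ‖1 + r₁‖ ≤ 2 := (norm_add_le _ _).trans (by rw [norm_one]; linarith [hb.slow₁])
      have i1 : ‖(u₂ - u₁) * (1 + r₁)‖ ≤ A * h * 2 := by
        rw [norm_mul]
        exact mul_le_mul hb.pot_sub e2 (norm_nonneg _) (by positivity)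
      have i2 : ‖u₂ * ((r₂ - r₀) - (r₁ - r₀))‖ ≤ A * h := by
        have l1 : ‖(r₂ - r₀) - (r₁ - r₀)‖ ≤ A * (h ^ 3 * t ^ 2) + A * (h ^ 3 * t ^ 2) :=
          (norm_sub_le _ _).trans (add_le_add hb.slow_sub₂ hb.slow_sub₁)
        rw [norm_mul]
        calc ‖u₂‖ * ‖(r₂ - r₀) - (r₁ - r₀)‖ ≤ A * (A * (h ^ 3 * t ^ 2) + A * (h ^ 3 * t ^ 2)) :=
              mul_le_mul hb.pot₂ l1 (norm_nonneg _) hA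
          _ = A * h * (2 * (A * t) * t * h ^ 2) := by ring
          _ ≤ A * h * (2 * (1 / 52) * (1 / 52) * 1) := by gcongr
          _ ≤ _ := by
            have : 0 ≤ A * h := by positivity
            linarith
      rw [this, norm_mul, norm_mul, norm_div, Complex.norm_two, hκ, Complex.norm_real,
        Real.norm_eq_abs, abs_of_pos hh]
      have i3 := norm_add_le ((u₂ - u₁) * (1 + r₁)) (u₂ * ((r₂ - r₀) - (r₁ - r₀)))
      have i4 : ‖(u₂ - u₁) * (1 + r₁) + u₂ * ((r₂ - r₀) - (r₁ - r₀))‖ / 2 ≤ 2 * (A * h) := by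
        have : 0 ≤ A * h := by positivity
        linarith
      calc h * (h * t) * (‖(u₂ - u₁) * (1 + r₁) + u₂ * ((r₂ - r₀) - (r₁ - r₀))‖ / 2) ≤
          h * (h * t) * (2 * (A * h)) := by gcongr
        _ = _ := by ring
    have hgpow : ∀ k, g ^ (k + 1) ≤ g := fun k => by
      rw [pow_succ]; exact mul_le_of_le_one_left hg (pow_le_one₀ hg hg1)
    -- The fifth power in the Padé error is the source of `M ^ 5`. The mixed term, of size
    -- `(h²t)(h³t)²`, fixes the order `h ^ 8 * t ^ 3`.
    have b3 : 2 * (‖(z₁ + z₂) / 2‖ ^ 5 + ‖(z₁ + z₂) / 2‖ * ‖(z₁ - z₂) / 2‖ ^ 2) * a ≤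
        80 * M ^ 5 * g * (h ^ 8 * t ^ 3 * a) := by
      have i1 : ‖(z₁ + z₂) / 2‖ ^ 5 ≤ 32 * M ^ 5 * g * (h ^ 8 * t ^ 3) := by
        calc ‖(z₁ + z₂) / 2‖ ^ 5 ≤ (2 * (h ^ 2 * t) * A) ^ 5 := by gcongr
          _ = 32 * M ^ 5 * g ^ 5 * (h ^ 8 * t ^ 3) * (h ^ 2 * t ^ 2) := by rw [hAdef]; ring
          _ ≤ 32 * M ^ 5 * g * (h ^ 8 * t ^ 3) * (1 * 1 ^ 2) := by
            gcongr
            · exact hgpow 4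
            · linarith
          _ = _ := by ring
      have i2 : ‖(z₁ + z₂) / 2‖ * ‖(z₁ - z₂) / 2‖ ^ 2 ≤ 8 * M ^ 5 * g * (h ^ 8 * t ^ 3) := by
        calc ‖(z₁ + z₂) / 2‖ * ‖(z₁ - z₂) / 2‖ ^ 2 ≤
            (2 * (h ^ 2 * t) * A) * (2 * h ^ 3 * t * A) ^ 2 := by gcongr
          _ = 8 * M ^ 3 * g ^ 3 * (h ^ 8 * t ^ 3) := by rw [hAdef]; ring
          _ ≤ 8 * M ^ 5 * g * (h ^ 8 * t ^ 3) := by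
            gcongr
            · norm_num
            · exact hgpow 2
      calc _ ≤ 2 * (32 * M ^ 5 * g * (h ^ 8 * t ^ 3) + 8 * M ^ 5 * g * (h ^ 8 * t ^ 3)) * a := by
            gcongr
        _ = _ := by ring
    have b4 : h ^ 2 * t * (A * (24 * t ^ 2 * ‖e‖ + 24 * t * d) + 2 * (A * h * n)) ≤
        A * (2000 * (h ^ 2 * t ^ 3 + h ^ 3 * t ^ 2) * ‖e‖ + 12000 * M * h ^ 7 * t ^ 4 * a) := by
      have i1 : 24 * t * d ≤ 1200 * t ^ 2 * ‖e‖ + 2400 * M * h ^ 5 * t ^ 3 * a := by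
        calc 24 * t * d ≤ 24 * t * (100 * P + 2500 * A * h ^ 2 * t ^ 2 * ‖e‖) := by gcongr
          _ = 60000 * (A * t) * h ^ 2 * t ^ 2 * ‖e‖ + 2400 * A * h ^ 5 * t ^ 3 * a := by
            rw [hP]; ring
          _ ≤ 60000 * (1 / 52) * 1 * t ^ 2 * ‖e‖ + 2400 * M * h ^ 5 * t ^ 3 * a := by gcongr
          _ ≤ _ := by
            have : 0 ≤ t ^ 2 * ‖e‖ := by positivity
            linarith
      have i2 : 2 * h * n ≤ 192 * t * h * ‖e‖ + 9600 * M * h ^ 5 * t ^ 3 * a := by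
        calc 2 * h * n ≤ 2 * h * (96 * t * (‖e‖ + 50 * P)) := by gcongr
          _ = 192 * t * h * ‖e‖ + 9600 * A * h ^ 5 * t ^ 3 * a * h := by rw [hP]; ring
          _ ≤ 192 * t * h * ‖e‖ + 9600 * M * h ^ 5 * t ^ 3 * a * 1 := by gcongr
          _ = _ := by ring
      calc _ = A * (h ^ 2 * t) * (24 * t ^ 2 * ‖e‖ + 24 * t * d + 2 * h * n) := by ring
        _ ≤ A * (h ^ 2 * t) * (24 * t ^ 2 * ‖e‖ + (1200 * t ^ 2 * ‖e‖ + 2400 * M * h ^ 5 * t ^ 3 * a)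
            + (192 * t * h * ‖e‖ + 9600 * M * h ^ 5 * t ^ 3 * a)) := by gcongr
        _ = A * (1224 * (h ^ 2 * t ^ 3 * ‖e‖) + 192 * (h ^ 3 * t ^ 2 * ‖e‖) +
            12000 * M * h ^ 7 * t ^ 4 * a) := by ring
        _ ≤ A * (2000 * (h ^ 2 * t ^ 3 * ‖e‖) + 2000 * (h ^ 3 * t ^ 2 * ‖e‖) +
            12000 * M * h ^ 7 * t ^ 4 * a) := by gcongr <;> norm_num
        _ = _ := by ring
    have b5 : A * (2000 * (h ^ 2 * t ^ 3 + h ^ 3 * t ^ 2) * ‖e‖ + 12000 * M * h ^ 7 * t ^ 4 * a) ≤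
        2000 * M ^ 5 * g * ((h ^ 2 * t ^ 3 + h ^ 3 * t ^ 2) * ‖e‖) +
          12000 * M ^ 5 * g * (h ^ 7 * t ^ 4 * a) := by
      have k1 : 0 ≤ (h ^ 2 * t ^ 3 + h ^ 3 * t ^ 2) * ‖e‖ := by positivity
      have k2 : 0 ≤ h ^ 7 * t ^ 4 * a := by positivity
      have k3 := mul_le_mul_of_nonneg_right hA5 k1
      have k4 := mul_le_mul_of_nonneg_right hA25 k2
      calc _ = 2000 * (A * ((h ^ 2 * t ^ 3 + h ^ 3 * t ^ 2) * ‖e‖)) +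
            12000 * (A * M * (h ^ 7 * t ^ 4 * a)) := by ring
        _ ≤ 2000 * (M ^ 5 * g * ((h ^ 2 * t ^ 3 + h ^ 3 * t ^ 2) * ‖e‖)) +
            12000 * (M ^ 5 * g * (h ^ 7 * t ^ 4 * a)) := by linarith
        _ = _ := by ring
    have k1 : 0 ≤ M ^ 5 * g * ((h ^ 2 * t ^ 3 + h ^ 3 * t ^ 2) * ‖e‖) := by positivity
    have k2 : 0 ≤ M ^ 5 * g * (h ^ 7 * t ^ 4 * a) := by positivity
    have k3 : 0 ≤ M ^ 5 * g * (h ^ 8 * t ^ 3 * a) := by positivity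
    have total : 100000 * M ^ 5 * g * ((h ^ 2 * t ^ 3 + h ^ 3 * t ^ 2) * ‖e‖ +
        (h ^ 7 * t ^ 4 + h ^ 8 * t ^ 3) * a) =
        100000 * (M ^ 5 * g * ((h ^ 2 * t ^ 3 + h ^ 3 * t ^ 2) * ‖e‖)) +
        100000 * (M ^ 5 * g * (h ^ 7 * t ^ 4 * a)) +
        100000 * (M ^ 5 * g * (h ^ 8 * t ^ 3 * a)) := by ring
    have b6 := mul_add (h ^ 2 * t) (A * (24 * t ^ 2 * ‖e‖ + 24 * t * d) + A * h * n) (A * h * n)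
    rw [show A * (24 * t ^ 2 * ‖e‖ + 24 * t * d) + A * h * n + A * h * n =
      A * (24 * t ^ 2 * ‖e‖ + 24 * t * d) + 2 * (A * h * n) by ring] at b6
    rw [total]
    linarith

/-! ### Propagation of the errors over all steps -/

theorem discrete_gronwall {v p q : ℕ → ℝ} {N : ℕ} (hp : ∀ n < N, 0 ≤ p n) (hq : ∀ n < N, 0 ≤ q n)
    (h0 : 0 ≤ v 0) (hv : ∀ n < N, v (n + 1) ≤ (1 + p n) * v n + q n) :
    ∀ n ≤ N, v n ≤ Real.exp (∑ i ∈ Finset.range n, p i) * (v 0 + ∑ i ∈ Finset.range n, q i) := by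
  intro n
  induction n with
  | zero => simp
  | succ n ih =>
    intro hn
    have ih := ih (by omega)
    have hn' : n < N := by omega
    have hp0 : 0 ≤ ∑ i ∈ Finset.range n, p i := Finset.sum_nonneg fun i hi =>
      hp i (by have := Finset.mem_range.1 hi; omega)
    have hq0 : 0 ≤ ∑ i ∈ Finset.range n, q i := Finset.sum_nonneg fun i hi =>
      hq i (by have := Finset.mem_range.1 hi; omega)
    rw [Finset.sum_range_succ, Finset.sum_range_succ, Real.exp_add]
    set P := Real.exp (∑ i ∈ Finset.range n, p i)
    have hP : 1 ≤ P := Real.one_le_exp hp0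
    have h1 := Real.add_one_le_exp (p n)
    have h2 := hp n hn'
    have h3 : 1 ≤ Real.exp (p n) := Real.one_le_exp h2
    have h4 : (1 + p n) * v n ≤ Real.exp (p n) * (P * (v 0 + ∑ i ∈ Finset.range n, q i)) :=
      (mul_le_mul_of_nonneg_left ih (by linarith)).trans
        (mul_le_mul_of_nonneg_right (by linarith) (by positivity))
    have h5 : q n ≤ P * Real.exp (p n) * q n :=
      le_mul_of_one_le_left (hq n hn') (one_le_mul_of_one_le_of_one_le hP h3)
    calc v (n + 1) ≤ (1 + p n) * v n + q n := hv n hn'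
      _ ≤ Real.exp (p n) * (P * (v 0 + ∑ i ∈ Finset.range n, q i)) + P * Real.exp (p n) * q n :=
        add_le_add h4 h5
      _ = _ := by ring

theorem norm_exp_le_of_le {s : ℂ} {x C : ℝ} (hs : ‖s‖ ≤ x) (hx : x ≤ C) :
    ‖Complex.exp s‖ ≤ 1 + Real.exp C * x := by
  have hx0 : 0 ≤ x := (norm_nonneg _).trans hs
  have h1 : ‖Complex.exp s‖ ≤ Real.exp x :=
    (Complex.norm_exp_le_exp_norm s).trans (Real.exp_le_exp.2 hs)
  have h2 := Real.add_one_le_exp (-x)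
  have h3 : Real.exp x * Real.exp (-x) = 1 := by rw [← Real.exp_add]; simp
  have h4 : Real.exp x ≤ Real.exp C := Real.exp_le_exp.2 hx
  have h5 := mul_le_mul_of_nonneg_left h2 (Real.exp_pos x).le
  have h6 := mul_le_mul_of_nonneg_right h4 hx0
  nlinarith

/-- The estimate is bootstrapped: boundedness of both components, then deviations of size `h⁴t²`,
then their sum of size `h⁴t`, and finally the error of `α`. The sum is where damping is
indispensable: `1 - ct` gains a factor `1/t` independent of the number of steps, while the weights
`h * g n` are summable by assumption. -/
theorem discrete_propagation {C G c : ℝ} (hC : 0 ≤ C) (hG : 0 ≤ G) (hc : 0 < c) :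
    ∃ C', 0 ≤ C' ∧ ∀ (h t : ℝ) (N : ℕ) (α e s : ℕ → ℂ) (g : ℕ → ℝ), 0 < h → h ≤ 1 → 0 < t → t ≤ 1 →
      (∀ n, 0 ≤ g n) → (∀ n < N, g n ≤ 1) → h * ∑ n ∈ Finset.range N, g n ≤ G →
      (∀ n < N, ‖s n‖ ≤ C * (h * g n)) →
      (∀ n < N, ‖e (n + 1)‖ ≤ (1 - c * t) * ‖e n‖ +
        C * g n * (h ^ 2 * t ^ 2 * ‖e n‖ + h ^ 5 * t ^ 2 * ‖α n‖)) →
      (∀ n < N, ‖α (n + 1) - Complex.exp (s n) * α n‖ ≤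
        C * g n * ((h ^ 2 * t ^ 3 + h ^ 3 * t ^ 2) * ‖e n‖ +
          (h ^ 7 * t ^ 4 + h ^ 8 * t ^ 3) * ‖α n‖)) →
      ‖α 0‖ ≤ 2 → ‖e 0‖ ≤ C * (h ^ 4 * t ^ 2) →
      ‖e N‖ ≤ C' * (h ^ 4 * t ^ 2) ∧
      ‖α N - Complex.exp (∑ n ∈ Finset.range N, s n) * α 0‖ ≤
        C' * (h ^ 6 * t ^ 4 + h ^ 7 * t ^ 3) := by
  set Q := Real.exp C * C with hQ
  set P := Q + 4 * C with hP
  set V := Real.exp (P * G) * (2 + C) with hV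
  set W := Real.exp (C * G) * (C + C * V * G) with hW
  set Z := (C + C * G * W + C * G * V) / c with hZ
  have hQ0 : 0 ≤ Q := by positivity
  have hP0 : 0 ≤ P := by positivity
  have hV0 : 0 ≤ V := by positivity
  have hW0 : 0 ≤ W := by positivity
  have hZ0 : 0 ≤ Z := by positivity
  refine ⟨W + Real.exp (Q * G) * (C * Z + C * W * G + C * V * G), by positivity, ?_⟩
  intro h t N α e s g hh h1 ht ht1 hg hg1 hsum hs hE hα hα0 he0
  have hpow : ∀ i j : ℕ, h ^ i * t ^ j ≤ 1 := fun i j =>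
    mul_le_one₀ (pow_le_one₀ hh.le h1) (by positivity) (pow_le_one₀ ht.le ht1)
  have hhk : ∀ i j : ℕ, h ^ (i + 1) * t ^ j ≤ h := fun i j => by
    calc h ^ (i + 1) * t ^ j = h * (h ^ i * t ^ j) := by ring
      _ ≤ h * 1 := mul_le_mul_of_nonneg_left (hpow i j) hh.le
      _ = h := mul_one h
  have hes : ∀ n < N, ‖Complex.exp (s n)‖ ≤ 1 + Q * (h * g n) := fun n hn => by
    have hx : C * (h * g n) ≤ C :=
      mul_le_of_le_one_right hC (mul_le_one₀ h1 (hg n) (hg1 n hn))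
    refine (norm_exp_le_of_le (hs n hn) hx).trans_eq ?_
    rw [hQ]; ring
  have hsumc : ∀ K : ℝ, 0 ≤ K → ∀ m ≤ N, ∑ i ∈ Finset.range m, K * (h * g i) ≤ K * G := by
    intro K hK m hm
    rw [← Finset.mul_sum, ← Finset.mul_sum]
    refine mul_le_mul_of_nonneg_left (le_trans ?_ hsum) hK
    exact mul_le_mul_of_nonneg_left (Finset.sum_le_sum_of_subset_of_nonneg
      (Finset.range_subset_range.2 hm) fun i _ _ => hg i) hh.le
  have hgr : ∀ (v q : ℕ → ℝ) (K S : ℝ), 0 ≤ K → 0 ≤ v 0 → (∀ n < N, 0 ≤ q n) →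
      (∀ n < N, v (n + 1) ≤ (1 + K * (h * g n)) * v n + q n) →
      (∀ m ≤ N, v 0 + ∑ i ∈ Finset.range m, q i ≤ S) →
      ∀ m ≤ N, v m ≤ Real.exp (K * G) * S := by
    intro v q K S hK hv0 hq hv hS m hm
    refine (discrete_gronwall (p := fun n => K * (h * g n)) (N := N)
      (fun n _ => mul_nonneg hK (mul_nonneg hh.le (hg n))) hq hv0 hv m hm).trans ?_
    refine mul_le_mul (Real.exp_le_exp.2 (hsumc K hK m hm)) (hS m hm) ?_ (Real.exp_pos _).le
    exact add_nonneg hv0 (Finset.sum_nonneg fun i hi =>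
      hq i (by have := Finset.mem_range.1 hi; omega))
  have hct : ∀ x : ℝ, 0 ≤ x → (1 - c * t) * x ≤ x := fun x hx => by
    have : 0 ≤ c * t * x := by positivity
    linarith
  -- uniform boundedness
  have bV : ∀ m ≤ N, ‖α m‖ + ‖e m‖ ≤ V := by
    refine hgr (fun n => ‖α n‖ + ‖e n‖) (fun _ => 0) P (2 + C) hP0 (by positivity)
      (fun _ _ => le_rfl) (fun n hn => ?_) (fun m _ => ?_)
    · have a1 : ‖α (n + 1)‖ ≤ ‖Complex.exp (s n)‖ * ‖α n‖ +
          ‖α (n + 1) - Complex.exp (s n) * α n‖ := by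
        have := norm_add_le (Complex.exp (s n) * α n) (α (n + 1) - Complex.exp (s n) * α n)
        rwa [add_sub_cancel, norm_mul] at this
      have a2 := mul_le_mul_of_nonneg_right (hes n hn) (norm_nonneg (α n))
      have a3 := hE n hn
      have a4 := hct ‖e n‖ (norm_nonneg _)
      have a5 := hα n hn
      have gh : 0 ≤ C * (h * g n) := mul_nonneg hC (mul_nonneg hh.le (hg n))
      have b1 : C * g n * (h ^ 2 * t ^ 2 * ‖e n‖ + h ^ 5 * t ^ 2 * ‖α n‖) ≤
          C * g n * (h * ‖e n‖ + h * ‖α n‖) := by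
        have := hg n
        gcongr
        · exact hhk 1 2
        · exact hhk 4 2
      have b2 : C * g n * ((h ^ 2 * t ^ 3 + h ^ 3 * t ^ 2) * ‖e n‖ +
          (h ^ 7 * t ^ 4 + h ^ 8 * t ^ 3) * ‖α n‖) ≤
          C * g n * ((h + h) * ‖e n‖ + (h + h) * ‖α n‖) := by
        have := hg n
        gcongr
        · exact hhk 1 3
        · exact hhk 2 2
        · exact hhk 6 4
        · exact hhk 7 3
      have b3 := mul_nonneg gh (norm_nonneg (α n))
      have b4 := mul_nonneg gh (norm_nonneg (e n))
      have b5 : 0 ≤ Q * (h * g n) * ‖e n‖ :=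
        mul_nonneg (mul_nonneg hQ0 (mul_nonneg hh.le (hg n))) (norm_nonneg _)
      change ‖α (n + 1)‖ + ‖e (n + 1)‖ ≤ (1 + P * (h * g n)) * (‖α n‖ + ‖e n‖) + 0
      rw [hP]
      linarith
    · have := hpow 4 2
      have : C * (h ^ 4 * t ^ 2) ≤ C := mul_le_of_le_one_right hC this
      simp only [Finset.sum_const_zero, add_zero]
      linarith
  have bα : ∀ m ≤ N, ‖α m‖ ≤ V := fun m hm => by
    have := bV m hm
    linarith [norm_nonneg (e m)]
  -- the size of the deviation from the slow manifold
  have bW : ∀ m ≤ N, ‖e m‖ ≤ W * (h ^ 4 * t ^ 2) := by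
    have := hgr (fun n => ‖e n‖) (fun n => C * V * (h * g n) * (h ^ 4 * t ^ 2)) C
      ((C + C * V * G) * (h ^ 4 * t ^ 2)) hC (norm_nonneg _)
      (fun n _ => mul_nonneg (mul_nonneg (by positivity) (mul_nonneg hh.le (hg n))) (by positivity))
      (fun n hn => ?_) (fun m hm => ?_)
    · intro m hm
      refine (this m hm).trans_eq ?_
      rw [hW]; ring
    · have a3 := hE n hn
      have a4 := hct ‖e n‖ (norm_nonneg _)
      have hgn := hg n
      have b1 : C * g n * (h ^ 2 * t ^ 2 * ‖e n‖ + h ^ 5 * t ^ 2 * ‖α n‖) ≤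
          C * g n * (h * ‖e n‖ + h ^ 5 * t ^ 2 * V) := by
        gcongr
        · exact hhk 1 2
        · exact bα n hn.le
      change ‖e (n + 1)‖ ≤ (1 + C * (h * g n)) * ‖e n‖ + C * V * (h * g n) * (h ^ 4 * t ^ 2)
      linarith
    · rw [← Finset.sum_mul, add_mul]
      exact add_le_add he0 (mul_le_mul_of_nonneg_right
        (hsumc (C * V) (by positivity) m hm) (by positivity))
  -- the sum of the deviations
  have tele : ∀ m ≤ N, ‖e m‖ + c * t * ∑ i ∈ Finset.range m, ‖e i‖ ≤
      C * (h ^ 4 * t ^ 2) + ∑ i ∈ Finset.range m, (C * W + C * V) * (h * g i) * (h ^ 4 * t ^ 2) := by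
    intro m
    induction m with
    | zero => intro _; simpa using he0
    | succ m ih =>
      intro hm
      have ih := ih (by omega)
      rw [Finset.sum_range_succ, Finset.sum_range_succ]
      have a3 := hE m (by omega)
      have hgm := hg m
      have b1 : C * g m * (h ^ 2 * t ^ 2 * ‖e m‖ + h ^ 5 * t ^ 2 * ‖α m‖) ≤
          C * g m * (h * (W * (h ^ 4 * t ^ 2)) + h ^ 5 * t ^ 2 * V) := by
        gcongr
        · exact hhk 1 2
        · exact bW m (by omega)
        · exact bα m (by omega)
      linarith
  have bZ : ∑ i ∈ Finset.range N, ‖e i‖ ≤ Z * (h ^ 4 * t) := by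
    have := tele N le_rfl
    rw [← Finset.sum_mul] at this
    have a1 := mul_le_mul_of_nonneg_right (hsumc (C * W + C * V) (by positivity) N le_rfl)
      (show 0 ≤ h ^ 4 * t ^ 2 by positivity)
    have a2 : (c * t) * ∑ i ∈ Finset.range N, ‖e i‖ ≤ (c * t) * (Z * (h ^ 4 * t)) := by
      -- Dropping `‖e N‖` from the telescoped recursion leaves the damping term, and division by `c
      -- * t` gives the sum of the deviations.
      calc (c * t) * ∑ i ∈ Finset.range N, ‖e i‖ ≤
          (C + C * G * W + C * G * V) * (h ^ 4 * t ^ 2) := by linarith [norm_nonneg (e N)]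
        _ = _ := by rw [hZ]; field_simp
    exact le_of_mul_le_mul_left a2 (by positivity)
  refine ⟨(bW N le_rfl).trans (mul_le_mul_of_nonneg_right ?_ (by positivity)), ?_⟩
  · have : 0 ≤ Real.exp (Q * G) * (C * Z + C * W * G + C * V * G) := by positivity
    linarith
  have fin := hgr (fun n => ‖α n - Complex.exp (∑ i ∈ Finset.range n, s i) * α 0‖)
    (fun n => C * (h ^ 2 * t ^ 3) * ‖e n‖ + C * W * (h * g n) * (h ^ 6 * t ^ 4) +
      C * V * (h * g n) * (h ^ 6 * t ^ 4 + h ^ 7 * t ^ 3)) Q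
    ((C * Z + C * W * G + C * V * G) * (h ^ 6 * t ^ 4 + h ^ 7 * t ^ 3)) hQ0 (norm_nonneg _)
    (fun n _ => by have := hg n; positivity) (fun n hn => ?_) (fun m hm => ?_) N le_rfl
  · refine fin.trans ?_
    have : 0 ≤ W * (h ^ 6 * t ^ 4 + h ^ 7 * t ^ 3) := by positivity
    linarith
  · have hgn := hg n
    have a1 : α (n + 1) - Complex.exp (∑ i ∈ Finset.range (n + 1), s i) * α 0 =
        Complex.exp (s n) * (α n - Complex.exp (∑ i ∈ Finset.range n, s i) * α 0) +
        (α (n + 1) - Complex.exp (s n) * α n) := by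
      rw [Finset.sum_range_succ, Complex.exp_add]; ring
    -- In the term with `h ^ 2 * t ^ 3` the weight is discarded and the summability of `‖e n‖` is
    -- used; in the term with `h ^ 3 * t ^ 2` the pointwise bound is used and the weight is summed.
    -- Both give `h ^ 6 * t ^ 4`.
    have a2 : C * g n * ((h ^ 2 * t ^ 3 + h ^ 3 * t ^ 2) * ‖e n‖ +
          (h ^ 7 * t ^ 4 + h ^ 8 * t ^ 3) * ‖α n‖) ≤
        C * (h ^ 2 * t ^ 3) * ‖e n‖ + C * W * (h * g n) * (h ^ 6 * t ^ 4) +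
          C * V * (h * g n) * (h ^ 6 * t ^ 4 + h ^ 7 * t ^ 3) := by
      calc _ = g n * (C * (h ^ 2 * t ^ 3) * ‖e n‖) + C * g n * (h ^ 3 * t ^ 2) * ‖e n‖ +
            C * g n * (h ^ 7 * t ^ 4 + h ^ 8 * t ^ 3) * ‖α n‖ := by ring
        _ ≤ 1 * (C * (h ^ 2 * t ^ 3) * ‖e n‖) + C * g n * (h ^ 3 * t ^ 2) * (W * (h ^ 4 * t ^ 2)) +
            C * g n * (h ^ 7 * t ^ 4 + h ^ 8 * t ^ 3) * V := by
          gcongr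
          · exact hg1 n hn
          · exact bW n hn.le
          · exact bα n hn.le
        _ = _ := by ring
    change ‖α (n + 1) - Complex.exp (∑ i ∈ Finset.range (n + 1), s i) * α 0‖ ≤ _
    rw [a1]
    refine (norm_add_le _ _).trans (add_le_add ?_ ((hα n hn).trans a2))
    rw [norm_mul]
    exact mul_le_mul_of_nonneg_right (hes n hn) (norm_nonneg _)
  · simp only [Finset.sum_range_zero, Complex.exp_zero, one_mul, sub_self, norm_zero, zero_add]
    rw [Finset.sum_add_distrib, Finset.sum_add_distrib, ← Finset.mul_sum, ← Finset.sum_mul,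
      ← Finset.sum_mul]
    have a1 : ∑ i ∈ Finset.range m, ‖e i‖ ≤ Z * (h ^ 4 * t) :=
      (Finset.sum_le_sum_of_subset_of_nonneg (Finset.range_subset_range.2 hm)
        fun i _ _ => norm_nonneg _).trans bZ
    have a2 := hsumc (C * W) (by positivity) m hm
    have a3 := hsumc (C * V) (by positivity) m hm
    calc _ ≤ C * (h ^ 2 * t ^ 3) * (Z * (h ^ 4 * t)) + C * W * G * (h ^ 6 * t ^ 4) +
          C * V * G * (h ^ 6 * t ^ 4 + h ^ 7 * t ^ 3) := by gcongr
      _ = (C * Z + C * W * G + C * V * G) * (h ^ 6 * t ^ 4) + C * V * G * (h ^ 7 * t ^ 3) := by ring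
      _ ≤ (C * Z + C * W * G + C * V * G) * (h ^ 6 * t ^ 4) +
          (C * Z + C * W * G + C * V * G) * (h ^ 7 * t ^ 3) := by
        gcongr
        have : 0 ≤ C * Z + C * W * G := by positivity
        linarith
      _ = _ := by ring

/-! ### The exact solution near the slow manifold -/

/-- The increment from `s` to `x` is compared with that of `(G/ρ) exp(ρy)`; then `s → -∞`. -/
theorem tail_bound {F F' : ℝ → ℂ} {G ρ : ℝ} {l : ℂ} (hG : 0 ≤ G) (hρ : 0 < ρ)
    (hF : ∀ x, HasDerivAt F (F' x) x) (hF' : ∀ x ≤ 0, ‖F' x‖ ≤ G * Real.exp (ρ * x))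
    (hl : Tendsto F atBot (𝓝 l)) : ∀ x ≤ 0, ‖F x - l‖ ≤ G / ρ * Real.exp (ρ * x) := by
  intro x hx
  refine le_of_tendsto ((hl.const_sub (F x)).norm) ?_
  filter_upwards [eventually_le_atBot x] with s hs
  have hB : ∀ y : ℝ, HasDerivAt (fun y => G / ρ * (Real.exp (ρ * y) - Real.exp (ρ * s)))
      (G * Real.exp (ρ * y)) y := by
    intro y
    have := ((((hasDerivAt_id y).const_mul ρ).exp).sub_const (Real.exp (ρ * s))).const_mul (G / ρ)
    refine this.congr_deriv ?_
    simp only [id_eq]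
    field_simp
  have := image_norm_le_of_norm_deriv_right_le_deriv_boundary (a := s) (b := x)
    (f := fun y => F y - F s) (f' := F')
    (fun y _ => ((hF y).sub_const _).continuousAt.continuousWithinAt)
    (fun y _ => ((hF y).sub_const _).hasDerivWithinAt)
    (B := fun y => G / ρ * (Real.exp (ρ * y) - Real.exp (ρ * s))) (by simp) hB
    (fun y hy => hF' y (hy.2.le.trans hx)) (x := x) ⟨hs, le_rfl⟩
  refine this.trans (mul_le_mul_of_nonneg_left ?_ (by positivity))
  linarith [Real.exp_pos (ρ * s)]

theorem interval_bound {F F' : ℝ → ℂ} {G ρ : ℝ} (hG : 0 ≤ G) (hρ : 0 < ρ)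
    (hF : ∀ x, HasDerivAt F (F' x) x) (hF' : ∀ x ≤ 0, ‖F' x‖ ≤ G * Real.exp (ρ * x)) :
    ∀ s x, s ≤ x → x ≤ 0 → ‖F x - F s‖ ≤ G / ρ := by
  intro s x hs hx
  have hB : ∀ y : ℝ, HasDerivAt (fun y => G / ρ * (Real.exp (ρ * y) - Real.exp (ρ * s)))
      (G * Real.exp (ρ * y)) y := by
    intro y
    have := ((((hasDerivAt_id y).const_mul ρ).exp).sub_const (Real.exp (ρ * s))).const_mul (G / ρ)
    refine this.congr_deriv ?_
    simp only [id_eq]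
    field_simp
  have := image_norm_le_of_norm_deriv_right_le_deriv_boundary (a := s) (b := x)
    (f := fun y => F y - F s) (f' := F')
    (fun y _ => ((hF y).sub_const _).continuousAt.continuousWithinAt)
    (fun y _ => ((hF y).sub_const _).hasDerivWithinAt)
    (B := fun y => G / ρ * (Real.exp (ρ * y) - Real.exp (ρ * s))) (by simp) hB
    (fun y hy => hF' y (hy.2.le.trans hx)) (x := x) ⟨hs, le_rfl⟩
  refine this.trans (mul_le_of_le_one_right (by positivity) ?_)
  have : Real.exp (ρ * x) ≤ 1 := Real.exp_le_one_iff.2 (mul_nonpos_of_nonneg_of_nonpos hρ.le hx)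
  linarith [Real.exp_pos (ρ * s)]

theorem bounded_on_left {F : ℝ → ℂ} {l : ℂ} (hF : Continuous F) (hl : Tendsto F atBot (𝓝 l)) :
    ∃ b, ∀ x ≤ 0, ‖F x‖ ≤ b := by
  obtain ⟨r, hr⟩ := eventually_atBot.1 (hl.norm.eventually (eventually_le_nhds (lt_add_one ‖l‖)))
  obtain ⟨b, hb⟩ := (isCompact_Icc (a := r) (b := 0)).exists_bound_of_continuousOn hF.continuousOn
  refine ⟨max b (‖l‖ + 1), fun x hx => ?_⟩
  rcases le_total x r with h | h
  · exact (hr x h).trans (le_max_right _ _)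
  · exact (hb x ⟨h, hx⟩).trans (le_max_left _ _)

/-- An absorption argument: the hypothesis is applied to the supremum, whose finiteness is what the
qualitative bound provides. -/
theorem self_bound {f : ℝ → ℝ} {p : ℝ} (hb : ∃ b, ∀ x ≤ 0, f x ≤ b)
    (h : ∀ S, (∀ x ≤ 0, f x ≤ S) → ∀ x ≤ 0, f x ≤ p + S / 2) : ∀ x ≤ 0, f x ≤ 2 * p := by
  obtain ⟨b, hb⟩ := hb
  have hbdd : BddAbove (f '' Set.Iic 0) := ⟨b, by rintro _ ⟨x, hx, rfl⟩; exact hb x hx⟩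
  have h1 : ∀ x ≤ 0, f x ≤ sSup (f '' Set.Iic 0) := fun x hx => le_csSup hbdd ⟨x, hx, rfl⟩
  have h2 : sSup (f '' Set.Iic 0) ≤ p + sSup (f '' Set.Iic 0) / 2 :=
    csSup_le ⟨f 0, 0, Set.mem_Iic.2 le_rfl, rfl⟩
      (by rintro _ ⟨x, hx, rfl⟩; exact h _ h1 x hx)
  intro x hx
  linarith [h1 x hx]

/-- The solution that tends to `(1, 0)` at `-∞` stays close to an approximate slow manifold
`b = r a`, and its dominant component is an exponential up to a small error. -/
theorem exact_side {M θ δ : ℝ} (hM : 1 ≤ M) (hθ : 0 < θ) (hδ : 0 < δ) :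
    ∃ C q₀ : ℝ, 0 ≤ C ∧ 0 < q₀ ∧ ∀ (κ : ℂ) (ψ : ℝ → ℝ) (a b r r' J : ℝ → ℂ),
      κ ≠ 0 → ‖κ⁻¹‖ ≤ q₀ → δ * ‖κ‖ ≤ κ.re →
      (∀ x ≤ 0, |ψ x| ≤ M * Real.exp (θ * x)) →
      (∀ x, HasDerivAt r (r' x) x) → (∀ x ≤ 0, ‖r x‖ ≤ 1) →
      (∀ x ≤ 0, ‖r' x + κ * r x - ψ x * κ⁻¹ * (1 + r x) ^ 2‖ ≤ M * ‖κ⁻¹‖ ^ 4) →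
      (∀ x, HasDerivAt J (κ⁻¹ * (ψ x * (1 + r x))) x) →
      (∀ x, HasDerivAt a (-(ψ x * κ⁻¹) * (a x + b x)) x) →
      (∀ x, HasDerivAt b (-κ * b x + ψ x * κ⁻¹ * (a x + b x)) x) →
      Tendsto a atBot (𝓝 1) → Tendsto b atBot (𝓝 0) →
      ∀ x ≤ 0, ‖a x‖ ≤ 2 ∧ ‖b x - r x * a x‖ ≤ C * ‖κ⁻¹‖ ^ 5 ∧ ‖J 0 - J x‖ ≤ 1 ∧
        ‖a 0 - Complex.exp (-(J 0 - J x)) * a x‖ ≤ C * ‖κ⁻¹‖ ^ 6 := by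
  -- The minimum supplies three smallness conditions: `q ≤ 1`, absorption in the equation for the
  -- deviation by `4Mq ≤ δ`, and absorption in the equation for `a` by `6Mq ≤ θ`.
  refine ⟨4 * M / δ + 100 * (4 * M / δ * M / θ), min 1 (min (δ / (4 * M)) (θ / (6 * M))),
    by positivity, by positivity, ?_⟩
  intro κ ψ a b r r' J hκ0 hq hre hψ hr hr1 hdef hJ ha hb hla hlb
  set q := ‖κ⁻¹‖ with hqdef
  have hκn : 0 < ‖κ‖ := norm_pos_iff.2 hκ0
  have hq0 : 0 < q := by rw [hqdef, norm_inv]; positivity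
  have hqκ : q * ‖κ‖ = 1 := by rw [hqdef, norm_inv]; field_simp
  have hq1 : q ≤ 1 := hq.trans (min_le_left _ _)
  have hq2 : q * (4 * M) ≤ δ := by
    have := hq.trans ((min_le_right _ _).trans (min_le_left _ _))
    rwa [le_div_iff₀ (by positivity)] at this
  have hq3 : q * (6 * M) ≤ θ := by
    have := hq.trans ((min_le_right _ _).trans (min_le_right _ _))
    rwa [le_div_iff₀ (by positivity)] at this
  have hδ1 : δ ≤ 1 := by
    have : δ * ‖κ‖ ≤ 1 * ‖κ‖ := by linarith [Complex.re_le_norm κ]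
    exact le_of_mul_le_mul_right this hκn
  have hρ : 0 < κ.re := lt_of_lt_of_le (by positivity) hre
  have hρq : 1 / κ.re ≤ q / δ := by
    rw [div_le_div_iff₀ hρ hδ]
    nlinarith
  have hexp1 : ∀ x ≤ 0, Real.exp (θ * x) ≤ 1 := fun x hx =>
    Real.exp_le_one_iff.2 (mul_nonpos_of_nonneg_of_nonpos hθ.le hx)
  have hψ1 : ∀ x ≤ 0, |ψ x| ≤ M := fun x hx =>
    (hψ x hx).trans (mul_le_of_le_one_right (by linarith) (hexp1 x hx))
  have hr2 : ∀ x ≤ 0, ‖1 + r x‖ ≤ 2 := fun x hx =>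
    (norm_add_le _ _).trans (by rw [norm_one]; linarith [hr1 x hx])
  set e : ℝ → ℂ := fun x => b x - r x * a x with he
  set D : ℝ → ℂ := fun x => r' x + κ * r x - ψ x * κ⁻¹ * (1 + r x) ^ 2 with hD
  -- The deviation satisfies the fast equation, with a weak coupling to itself and the manifold
  -- defect `D` as forcing.
  have hde : ∀ x, HasDerivAt e (-κ * e x + (ψ x * κ⁻¹ * (1 + r x) * e x - D x * a x)) x := by
    intro x
    refine ((hb x).sub ((hr x).mul (ha x))).congr_deriv ?_
    simp only [he, hD]
    ring
  have cont : ∀ {F F' : ℝ → ℂ}, (∀ x, HasDerivAt F (F' x) x) → Continuous F := fun hF =>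
    continuous_iff_continuousAt.2 fun x => (hF x).continuousAt
  obtain ⟨ba, hba⟩ := bounded_on_left (cont ha) hla
  obtain ⟨bb, hbb⟩ := bounded_on_left (cont hb) hlb
  have hbe : ∃ B, ∀ x ≤ 0, ‖e x‖ ≤ B := by
    refine ⟨bb + ba, fun x hx => (norm_sub_le _ _).trans (add_le_add (hbb x hx) ?_)⟩
    rw [norm_mul]
    calc ‖r x‖ * ‖a x‖ ≤ 1 * ba := mul_le_mul (hr1 x hx) (hba x hx) (norm_nonneg _) zero_le_one
      _ = ba := one_mul _
  -- With the integrating factor `exp(κx)` the initial value at `-∞` is zero, and integration gains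
  -- the factor `1 / Re κ ≤ q / δ`. Together with the defect of order `q ^ 4` this gives deviations
  -- of order `q ^ 5`.
  have hFd : ∀ x, HasDerivAt (fun x : ℝ => e x * Complex.exp (κ * x))
      ((ψ x * κ⁻¹ * (1 + r x) * e x - D x * a x) * Complex.exp (κ * x)) x := by
    intro x
    have h1 : HasDerivAt (fun x : ℝ => Complex.exp (κ * x)) (Complex.exp (κ * x) * (κ * 1)) x :=
      ((Complex.ofRealCLM.hasDerivAt (x := x)).const_mul κ).cexp
    refine ((hde x).mul h1).congr_deriv ?_
    ring
  have hne : ∀ x : ℝ, ‖Complex.exp (κ * x)‖ = Real.exp (κ.re * x) := fun x => by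
    rw [Complex.norm_exp]; simp
  have hexp0 : Tendsto (fun x : ℝ => Real.exp (κ.re * x)) atBot (𝓝 0) :=
    Real.tendsto_exp_atBot.comp (tendsto_id.const_mul_atBot hρ)
  -- the deviation in terms of a bound for the dominant component
  have stepe : ∀ S, (∀ x ≤ 0, ‖a x‖ ≤ S) → ∀ x ≤ 0, ‖e x‖ ≤ 2 * (M / δ * q ^ 5 * S) := by
    intro S hS
    have hS0 : 0 ≤ S := (norm_nonneg _).trans (hS 0 le_rfl)
    refine self_bound hbe fun T hT x hx => ?_
    have hT0 : 0 ≤ T := (norm_nonneg _).trans (hT 0 le_rfl)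
    have hF' : ∀ x ≤ 0, ‖(ψ x * κ⁻¹ * (1 + r x) * e x - D x * a x) * Complex.exp (κ * x)‖ ≤
        (M * q * 2 * T + M * q ^ 4 * S) * Real.exp (κ.re * x) := by
      intro x hx
      rw [norm_mul, hne]
      refine mul_le_mul_of_nonneg_right ((norm_sub_le _ _).trans (add_le_add ?_ ?_))
        (Real.exp_pos _).le
      · rw [norm_mul, norm_mul, norm_mul, Complex.norm_real, Real.norm_eq_abs]
        have := hψ1 x hx
        have := hr2 x hx
        have := hT x hx
        gcongr
      · rw [norm_mul]
        exact mul_le_mul (hdef x hx) (hS x hx) (norm_nonneg _) (by positivity)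
    have hlim : Tendsto (fun x : ℝ => e x * Complex.exp (κ * x)) atBot (𝓝 0) := by
      rw [tendsto_zero_iff_norm_tendsto_zero]
      refine squeeze_zero' (g := fun x => T * Real.exp (κ.re * x))
        (Eventually.of_forall fun x => norm_nonneg _) ?_ (by simpa using hexp0.const_mul T)
      filter_upwards [eventually_le_atBot 0] with x hx
      rw [norm_mul, hne]
      exact mul_le_mul_of_nonneg_right (hT x hx) (Real.exp_pos _).le
    have h1 := tail_bound (by positivity) hρ hFd hF' hlim x hx
    rw [sub_zero, norm_mul, hne] at h1
    have h2 := le_of_mul_le_mul_right h1 (Real.exp_pos _)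
    refine h2.trans ?_
    have h3 : (M * q * 2 * T + M * q ^ 4 * S) / κ.re ≤ (M * q * 2 * T + M * q ^ 4 * S) * (q / δ) := by
      rw [div_eq_mul_one_div]
      exact mul_le_mul_of_nonneg_left hρq (by positivity)
    refine h3.trans ?_
    have h4 : M * q * 2 * T * (q / δ) ≤ T / 2 := by
      rw [mul_div_assoc', div_le_iff₀ hδ]
      calc M * q * 2 * T * q = q * (4 * M) * (T / 2) * q := by ring
        _ ≤ δ * (T / 2) * 1 := by gcongr
        _ = _ := by ring
    calc _ = M * q * 2 * T * (q / δ) + M / δ * q ^ 5 * S := by ring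
      _ ≤ _ := by linarith
  have hMq : 2 * (M / δ * q ^ 5) ≤ 1 := by
    have : q ^ 5 ≤ q := by
      calc q ^ 5 ≤ q ^ 1 := pow_le_pow_of_le_one hq0.le hq1 (by norm_num)
        _ = q := pow_one q
    rw [div_mul_eq_mul_div, mul_div_assoc', div_le_one hδ]
    nlinarith
  have haq : ∀ x, -(ψ x * κ⁻¹) * (a x + b x) = -(ψ x * κ⁻¹) * ((1 + r x) * a x + e x) := fun x => by
    simp only [he]; ring
  have bound_a : ∀ x ≤ 0, ‖a x‖ ≤ 2 * 1 := by
    refine self_bound ⟨ba, hba⟩ fun S hS x hx => ?_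
    have hS0 : 0 ≤ S := (norm_nonneg _).trans (hS 0 le_rfl)
    have hee : ∀ x ≤ 0, ‖e x‖ ≤ S := fun x hx => by
      refine (stepe S hS x hx).trans ?_
      nlinarith
    have ha' : ∀ x ≤ 0, ‖-(ψ x * κ⁻¹) * (a x + b x)‖ ≤ 3 * M * q * S * Real.exp (θ * x) := by
      intro x hx
      rw [haq, norm_mul, norm_neg, norm_mul, Complex.norm_real, Real.norm_eq_abs]
      have h1 : ‖(1 + r x) * a x + e x‖ ≤ 3 * S := by
        refine (norm_add_le _ _).trans ?_
        rw [norm_mul]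
        have := mul_le_mul (hr2 x hx) (hS x hx) (norm_nonneg _) zero_le_two
        linarith [hee x hx]
      calc |ψ x| * q * ‖(1 + r x) * a x + e x‖ ≤ M * Real.exp (θ * x) * q * (3 * S) := by
            gcongr; exact hψ x hx
        _ = _ := by ring
    have h2 := tail_bound (by positivity) hθ ha ha' hla x hx
    have h3 : 3 * M * q * S / θ * Real.exp (θ * x) ≤ S / 2 := by
      have : 3 * M * q * S / θ ≤ S / 2 := by
        rw [div_le_iff₀ hθ]
        nlinarith
      exact (mul_le_of_le_one_right (by positivity) (hexp1 x hx)).trans this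
    have h4 := norm_add_le (a x - 1) 1
    rw [sub_add_cancel, norm_one] at h4
    linarith
  rw [mul_one] at bound_a
  have bound_e : ∀ x ≤ 0, ‖e x‖ ≤ 4 * M / δ * q ^ 5 := fun x hx =>
    (stepe 2 bound_a x hx).trans_eq (by ring)
  have hJ' : ∀ x ≤ 0, ‖κ⁻¹ * (ψ x * (1 + r x))‖ ≤ 2 * M * q * Real.exp (θ * x) := by
    intro x hx
    rw [norm_mul, norm_mul, Complex.norm_real, Real.norm_eq_abs]
    calc q * (|ψ x| * ‖1 + r x‖) ≤ q * (M * Real.exp (θ * x) * 2) := by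
          gcongr
          · exact hψ x hx
          · exact hr2 x hx
      _ = _ := by ring
  have hJb : ∀ s x, s ≤ x → x ≤ 0 → ‖J x - J s‖ ≤ 1 := fun s x hs hx => by
    refine (interval_bound (by positivity) hθ hJ hJ' s x hs hx).trans ?_
    rw [div_le_one hθ]
    nlinarith
  intro x hx
  have p1 : 0 ≤ 4 * M / δ := by positivity
  have p2 : 0 ≤ 100 * (4 * M / δ * M / θ) := by positivity
  refine ⟨bound_a x hx, (bound_e x hx).trans ?_, hJb x 0 hx le_rfl, ?_⟩
  · exact mul_le_mul_of_nonneg_right (by linarith) (by positivity)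
  -- The factor `exp(J)` removes the motion on the manifold. Only the deviation drives the rest,
  -- with the coefficient `ψ/κ`, so the error has order `q * q ^ 5`.
  have hP : ∀ y, HasDerivAt (fun y => Complex.exp (J y) * a y)
      (-(Complex.exp (J y) * (ψ y * κ⁻¹ * e y))) y := by
    intro y
    refine ((hJ y).cexp.mul (ha y)).congr_deriv ?_
    rw [haq]
    ring
  have hexpJ : ∀ y ≤ 0, ‖Complex.exp (J y)‖ ≤ 3 * ‖Complex.exp (J 0)‖ := fun y hy => by
    have e1 : Complex.exp (J y) = Complex.exp (-(J 0 - J y)) * Complex.exp (J 0) := by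
      rw [← Complex.exp_add]; ring_nf
    rw [e1, norm_mul]
    refine mul_le_mul_of_nonneg_right ?_ (norm_nonneg _)
    refine (Complex.norm_exp_le_exp_norm _).trans ?_
    rw [norm_neg]
    refine (Real.exp_le_exp.2 (hJb y 0 hy le_rfl)).trans ?_
    linarith [Real.exp_one_lt_d9]
  have hP' : ∀ y ≤ 0, ‖-(Complex.exp (J y) * (ψ y * κ⁻¹ * e y))‖ ≤
      3 * ‖Complex.exp (J 0)‖ * (4 * M / δ * M * q ^ 6) * Real.exp (θ * y) := by
    intro y hy
    rw [norm_neg, norm_mul, norm_mul, norm_mul, Complex.norm_real, Real.norm_eq_abs]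
    calc ‖Complex.exp (J y)‖ * (|ψ y| * q * ‖e y‖) ≤
        3 * ‖Complex.exp (J 0)‖ * (M * Real.exp (θ * y) * q * (4 * M / δ * q ^ 5)) := by
          gcongr
          · exact hexpJ y hy
          · exact hψ y hy
          · exact bound_e y hy
      _ = _ := by ring
  have fin := interval_bound (by positivity) hθ hP hP' x 0 hx le_rfl
  have e2 : Complex.exp (J 0) * a 0 - Complex.exp (J x) * a x =
      Complex.exp (J 0) * (a 0 - Complex.exp (-(J 0 - J x)) * a x) := by
    have : Complex.exp (J x) = Complex.exp (J 0) * Complex.exp (-(J 0 - J x)) := by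
      rw [← Complex.exp_add]; ring_nf
    rw [this]; ring
  rw [e2, norm_mul] at fin
  have hpos : 0 < ‖Complex.exp (J 0)‖ := norm_pos_iff.2 (Complex.exp_ne_zero _)
  have fin2 : ‖Complex.exp (J 0)‖ * ‖a 0 - Complex.exp (-(J 0 - J x)) * a x‖ ≤
      ‖Complex.exp (J 0)‖ * (3 * (4 * M / δ * M / θ) * q ^ 6) := fin.trans_eq (by ring)
  refine (le_of_mul_le_mul_left fin2 hpos).trans ?_
  have p3 : 0 ≤ 4 * M / δ * M / θ := by positivity
  exact mul_le_mul_of_nonneg_right (by linarith) (by positivity)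

/-! ### The approximate slow manifold -/

/-- `ψ'' + 2 ψ²`. -/
def chi (ψ : ℝ → ℝ) (x : ℝ) : ℝ := deriv (deriv ψ) x + 2 * (ψ x * ψ x)

/-- The approximate slow manifold `b = r a`, with `r = ψ / κ² - ψ' / κ³ + (ψ'' + 2 ψ²) / κ⁴`. -/
def slow (κ : ℂ) (ψ : ℝ → ℝ) (x : ℝ) : ℂ :=
  κ⁻¹ ^ 2 * ψ x - κ⁻¹ ^ 3 * (deriv ψ x : ℝ) + κ⁻¹ ^ 4 * (chi ψ x : ℝ)

/-- The derivative of `slow`. -/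
def slowDeriv (κ : ℂ) (ψ : ℝ → ℝ) (x : ℝ) : ℂ :=
  κ⁻¹ ^ 2 * (deriv ψ x : ℝ) - κ⁻¹ ^ 3 * (deriv (deriv ψ) x : ℝ) + κ⁻¹ ^ 4 * (deriv (chi ψ) x : ℝ)

theorem LeftDecay.chi {ψ : ℝ → ℝ} (h : LeftDecay ψ) : LeftDecay (chi ψ) :=
  h.deriv.deriv.add ((h.mul h).const_mul 2)

theorem LeftDecay.hasDerivAt {g : ℝ → ℝ} (h : LeftDecay g) (x : ℝ) :
    HasDerivAt g (_root_.deriv g x) x :=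
  (contDiff_infty_iff_deriv.1 h.1).1.differentiableAt.hasDerivAt

theorem hasDerivAt_slow {ψ : ℝ → ℝ} (h : LeftDecay ψ) (κ : ℂ) (x : ℝ) :
    HasDerivAt (slow κ ψ) (slowDeriv κ ψ x) x :=
  (((h.hasDerivAt x).ofReal_comp.const_mul _).sub
    ((h.deriv.hasDerivAt x).ofReal_comp.const_mul _)).add
    ((h.chi.hasDerivAt x).ofReal_comp.const_mul _)

/-- The slow manifold, its derivative, its differences and its stage errors all have this form, so
one estimate covers them. -/
theorem norm_combo_le {ι : ℂ} {x y w B : ℝ} (hι : ‖ι‖ ≤ 1) (hx : |x| ≤ B) (hy : |y| ≤ B)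
    (hw : |w| ≤ B) : ‖ι ^ 2 * x - ι ^ 3 * y + ι ^ 4 * w‖ ≤ 3 * ‖ι‖ ^ 2 * B := by
  have hB : 0 ≤ B := (abs_nonneg _).trans hx
  have term : ∀ (k : ℕ) (v : ℝ), 2 ≤ k → |v| ≤ B → ‖ι ^ k * v‖ ≤ ‖ι‖ ^ 2 * B := by
    intro k v hk hv
    rw [norm_mul, norm_pow, Complex.norm_real, Real.norm_eq_abs]
    exact mul_le_mul (pow_le_pow_of_le_one (norm_nonneg _) hι hk) hv (abs_nonneg _) (by positivity)
  have h1 := norm_add_le (ι ^ 2 * x - ι ^ 3 * y) (ι ^ 4 * w)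
  have h2 := norm_sub_le (ι ^ 2 * (x : ℂ)) (ι ^ 3 * y)
  linarith [term 2 x le_rfl hx, term 3 y (by norm_num) hy, term 4 w (by norm_num) hw]

/-- All terms through `κ⁻³` cancel. At order three the condition is `chi ψ = ψ'' + 2ψ²`, where `2ψ²`
comes from the square `(1 + r)²`. The cubic term `ψ r²` is responsible for `M ^ 3`. -/
theorem slow_defect_le {κ : ℂ} {ψ : ℝ → ℝ} {x B M g : ℝ} (hκ : κ ≠ 0)
    (hq : ‖κ⁻¹‖ ≤ 1) (hM : 1 ≤ M) (hg : 0 ≤ g) (hg1 : g ≤ 1) (hB : B = M * g)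
    (h0 : |ψ x| ≤ B) (h1 : |deriv ψ x| ≤ B) (hc : |chi ψ x| ≤ B) (hc1 : |deriv (chi ψ) x| ≤ B) :
    ‖slowDeriv κ ψ x + κ * slow κ ψ x - ψ x * κ⁻¹ * (1 + slow κ ψ x) ^ 2‖ ≤
      16 * M ^ 3 * g * ‖κ⁻¹‖ ^ 4 := by
  have hB0 : 0 ≤ B := (abs_nonneg _).trans h0
  have hr : ‖slow κ ψ x‖ ≤ 3 * ‖κ⁻¹‖ ^ 2 * B := norm_combo_le hq h0 h1 hc
  set q := ‖κ⁻¹‖ with hqdef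
  have key : slowDeriv κ ψ x + κ * slow κ ψ x - ψ x * κ⁻¹ * (1 + slow κ ψ x) ^ 2 =
      κ⁻¹ ^ 4 * (2 * ψ x * (deriv ψ x : ℝ) + (deriv (chi ψ) x : ℝ)) -
        2 * κ⁻¹ ^ 5 * ψ x * (chi ψ x : ℝ) - κ⁻¹ * ψ x * slow κ ψ x ^ 2 := by
    have hχ : (chi ψ x : ℂ) = (deriv (deriv ψ) x : ℝ) + 2 * (ψ x * ψ x) := by
      rw [chi]; push_cast; ring
    have hκι : κ * κ⁻¹ = 1 := mul_inv_cancel₀ hκ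
    have e1 : κ * slow κ ψ x = κ⁻¹ * ψ x - κ⁻¹ ^ 2 * (deriv ψ x : ℝ) + κ⁻¹ ^ 3 * (chi ψ x : ℝ) := by
      rw [slow]
      linear_combination (κ⁻¹ * ψ x - κ⁻¹ ^ 2 * (deriv ψ x : ℝ) + κ⁻¹ ^ 3 * (chi ψ x : ℝ)) * hκι
    have e2 : (1 + slow κ ψ x) ^ 2 = 1 + 2 * slow κ ψ x + slow κ ψ x ^ 2 := by ring
    rw [e1, e2, mul_add, mul_add, ← sub_sub, ← sub_sub]
    have e3 : (ψ x : ℂ) * κ⁻¹ * (2 * slow κ ψ x) = 2 * κ⁻¹ ^ 3 * ψ x ^ 2 -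
        2 * κ⁻¹ ^ 4 * ψ x * (deriv ψ x : ℝ) + 2 * κ⁻¹ ^ 5 * ψ x * (chi ψ x : ℝ) := by
      rw [slow]; ring
    rw [e3, slowDeriv]
    linear_combination κ⁻¹ ^ 3 * hχ
  rw [key]
  have n0 : ‖(ψ x : ℂ)‖ ≤ B := by rwa [Complex.norm_real, Real.norm_eq_abs]
  have n1 : ‖((deriv ψ x : ℝ) : ℂ)‖ ≤ B := by rwa [Complex.norm_real, Real.norm_eq_abs]
  have nc : ‖((chi ψ x : ℝ) : ℂ)‖ ≤ B := by rwa [Complex.norm_real, Real.norm_eq_abs]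
  have nc1 : ‖((deriv (chi ψ) x : ℝ) : ℂ)‖ ≤ B := by rwa [Complex.norm_real, Real.norm_eq_abs]
  have hq0 : 0 ≤ q := norm_nonneg _
  have t1 : ‖κ⁻¹ ^ 4 * (2 * ψ x * (deriv ψ x : ℝ) + (deriv (chi ψ) x : ℝ))‖ ≤
      q ^ 4 * (2 * B * B + B) := by
    rw [norm_mul, norm_pow]
    refine mul_le_mul_of_nonneg_left ((norm_add_le _ _).trans (add_le_add ?_ nc1)) (by positivity)
    rw [norm_mul, norm_mul, Complex.norm_two]
    gcongr
  have t2 : ‖2 * κ⁻¹ ^ 5 * ψ x * (chi ψ x : ℝ)‖ ≤ q ^ 4 * (2 * B * B) := by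
    rw [norm_mul, norm_mul, norm_mul, norm_pow, Complex.norm_two]
    calc 2 * q ^ 5 * ‖(ψ x : ℂ)‖ * ‖((chi ψ x : ℝ) : ℂ)‖ ≤ 2 * q ^ 5 * B * B := by gcongr
      _ = q ^ 4 * (2 * B * B) * q := by ring
      _ ≤ q ^ 4 * (2 * B * B) * 1 := by gcongr
      _ = _ := mul_one _
  have t3 : ‖κ⁻¹ * ψ x * slow κ ψ x ^ 2‖ ≤ q ^ 4 * (9 * B ^ 3) := by
    rw [norm_mul, norm_mul, norm_pow]
    calc q * ‖(ψ x : ℂ)‖ * ‖slow κ ψ x‖ ^ 2 ≤ q * B * (3 * q ^ 2 * B) ^ 2 := by gcongr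
      _ = q ^ 4 * (9 * B ^ 3) * q := by ring
      _ ≤ q ^ 4 * (9 * B ^ 3) * 1 := by gcongr
      _ = _ := mul_one _
  have s1 := norm_sub_le (κ⁻¹ ^ 4 * (2 * ψ x * (deriv ψ x : ℝ) + (deriv (chi ψ) x : ℝ)) -
        2 * κ⁻¹ ^ 5 * ψ x * (chi ψ x : ℝ)) (κ⁻¹ * ψ x * slow κ ψ x ^ 2)
  have s2 := norm_sub_le (κ⁻¹ ^ 4 * (2 * ψ x * (deriv ψ x : ℝ) + (deriv (chi ψ) x : ℝ)))
        (2 * κ⁻¹ ^ 5 * ψ x * (chi ψ x : ℝ))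
  have b1 : B ≤ M ^ 3 * g := by
    rw [hB]
    refine mul_le_mul_of_nonneg_right ?_ hg
    calc M = M ^ 1 := (pow_one M).symm
      _ ≤ M ^ 3 := pow_le_pow_right₀ hM (by norm_num)
  have b2 : B * B ≤ M ^ 3 * g := by
    calc B * B = M ^ 2 * (g * g) := by rw [hB]; ring
      _ ≤ M ^ 3 * (g * 1) := by
        gcongr
        norm_num
      _ = _ := by ring
  have b3 : B ^ 3 ≤ M ^ 3 * g := by
    calc B ^ 3 = M ^ 3 * (g * (g * g)) := by rw [hB]; ring
      _ ≤ M ^ 3 * (g * (1 * 1)) := by gcongr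
      _ = _ := by ring
  have total : q ^ 4 * (2 * B * B + B) + q ^ 4 * (2 * B * B) + q ^ 4 * (9 * B ^ 3) ≤
      q ^ 4 * (16 * (M ^ 3 * g)) := by
    rw [← mul_add, ← mul_add]
    refine mul_le_mul_of_nonneg_left ?_ (by positivity)
    have : 0 ≤ M ^ 3 * g := by positivity
    nlinarith
  calc _ ≤ q ^ 4 * (16 * (M ^ 3 * g)) := by linarith
    _ = _ := by ring

theorem abs_node_sub_le {G : ℝ → ℝ} (hG : ContDiff ℝ ∞ G) {x h B c : ℝ} (hh : 0 ≤ h)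
    (hc : 0 ≤ c) (hc1 : c ≤ 1) (hB : ∀ y ∈ Set.Icc x (x + h), |iteratedDeriv 1 G y| ≤ B) :
    |G (x + c * h) - G x| ≤ B * h := by
  have hB0 : 0 ≤ B := (abs_nonneg _).trans (hB x ⟨le_rfl, by linarith⟩)
  have hch : c * h ≤ h := mul_le_of_le_one_left hh hc1
  have := taylor_bound 1 (fun i => iteratedDeriv i G) (hasDerivAt_iteratedDeriv hG) (x := x)
    (M := B) (t := c * h) (by positivity) (fun y hy => hB y ⟨hy.1, hy.2.trans (by linarith)⟩)
  simp only [Finset.sum_range_one, iteratedDeriv_zero, pow_zero, pow_one, Nat.factorial,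
    Nat.cast_one, div_one, mul_one] at this
  exact this.trans (mul_le_mul_of_nonneg_left hch hB0)

/-- The stage order of the two-stage Gauss method is two. -/
theorem abs_stage_le {G : ℝ → ℝ} (hG : ContDiff ℝ ∞ G) {x h B c p q : ℝ} (hh : 0 ≤ h)
    (hc : 0 ≤ c) (hc1 : c ≤ 1) (hp : |p| ≤ 1) (hq : |q| ≤ 1) (h1 : p + q = c)
    (h2 : p * (1 / 2 - √3 / 6) + q * (1 / 2 + √3 / 6) = c ^ 2 / 2)
    (hB : ∀ y ∈ Set.Icc x (x + h), |iteratedDeriv 3 G y| ≤ B) :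
    |G (x + c * h) - G x - h * (p * deriv G (x + (1 / 2 - √3 / 6) * h) +
      q * deriv G (x + (1 / 2 + √3 / 6) * h))| ≤ 3 * B * h ^ 3 := by
  obtain ⟨s1, s2, -⟩ := sqrt_three_bounds
  have hB0 : 0 ≤ B := (abs_nonneg _).trans (hB x ⟨le_rfl, by linarith⟩)
  have val := taylor_bound 3 (fun i => iteratedDeriv i G) (hasDerivAt_iteratedDeriv hG) (x := x)
    (M := B) (t := c * h) (by positivity) (fun y hy => hB y ⟨hy.1, hy.2.trans (by nlinarith)⟩)
  have der : ∀ d, 0 ≤ d → d ≤ 1 →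
      |deriv G (x + d * h) - (deriv G x + iteratedDeriv 2 G x * (d * h))| ≤ B * h ^ 2 := by
    intro d hd hd1
    have hdh : d * h ≤ h := mul_le_of_le_one_left hh hd1
    have := taylor_bound 2 (fun i => iteratedDeriv (i + 1) G)
      (fun i => hasDerivAt_iteratedDeriv hG (i + 1)) (x := x)
      (M := B) (t := d * h) (by positivity) (fun y hy => hB y ⟨hy.1, hy.2.trans (by linarith)⟩)
    simp only [Finset.sum_range_succ, Finset.sum_range_zero, pow_zero, pow_one, Nat.factorial,
      Nat.cast_one, div_one, mul_one, zero_add, iteratedDeriv_one] at this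
    norm_num at this
    refine this.trans (mul_le_mul_of_nonneg_left ?_ hB0)
    have : (d * h) ^ 2 ≤ h ^ 2 := pow_le_pow_left₀ (by positivity) hdh 2
    linarith [sq_nonneg (d * h)]
  have d1 := der (1 / 2 - √3 / 6) (by linarith) (by linarith)
  have d2 := der (1 / 2 + √3 / 6) (by linarith) (by linarith)
  simp only [Finset.sum_range_succ, Finset.sum_range_zero, pow_zero, pow_one, Nat.factorial,
    Nat.cast_one, div_one, mul_one, zero_add, iteratedDeriv_zero, iteratedDeriv_one] at val
  norm_num at val
  have hv : |G (x + c * h) - (G x + deriv G x * (c * h) + iteratedDeriv 2 G x * ((c * h) ^ 2 / 2))| ≤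
      B * h ^ 3 := by
    refine val.trans (mul_le_mul_of_nonneg_left ?_ hB0)
    have : (c * h) ^ 3 ≤ h ^ 3 :=
      pow_le_pow_left₀ (by positivity) (mul_le_of_le_one_left hh hc1) 3
    have : 0 ≤ (c * h) ^ 3 := by positivity
    linarith
  set v := G (x + c * h) - (G x + deriv G x * (c * h) + iteratedDeriv 2 G x * ((c * h) ^ 2 / 2))
  set w₁ := deriv G (x + (1 / 2 - √3 / 6) * h) -
    (deriv G x + iteratedDeriv 2 G x * ((1 / 2 - √3 / 6) * h)) with hw₁
  set w₂ := deriv G (x + (1 / 2 + √3 / 6) * h) -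
    (deriv G x + iteratedDeriv 2 G x * ((1 / 2 + √3 / 6) * h)) with hw₂
  have key : G (x + c * h) - G x - h * (p * deriv G (x + (1 / 2 - √3 / 6) * h) +
      q * deriv G (x + (1 / 2 + √3 / 6) * h)) = v - h * (p * w₁) - h * (q * w₂) := by
    rw [hw₁, hw₂]
    linear_combination (-h * deriv G x) * h1 - (h ^ 2 * iteratedDeriv 2 G x) * h2
  have part : ∀ p w : ℝ, |p| ≤ 1 → |w| ≤ B * h ^ 2 → |h * (p * w)| ≤ B * h ^ 3 := by
    intro p w hp hw
    rw [abs_mul, abs_mul, abs_of_nonneg hh]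
    calc h * (|p| * |w|) ≤ h * (1 * (B * h ^ 2)) := by gcongr
      _ = _ := by ring
  rw [key]
  have e1 := abs_sub (v - h * (p * w₁)) (h * (q * w₂))
  have e2 := abs_sub v (h * (p * w₁))
  linarith [part p w₁ hp d1, part q w₂ hq d2]

/-- All panel constants are measured against `exp(θx)` at the left end point, at the cost of a
factor `exp θ`. The slow manifold supplies `κ⁻² ~ h²t²` and stage order two supplies `h³`, hence the
size `h⁵t²` of the stage errors. The constant `16 M₁³` is the one of `slow_defect_le` and dominates
the others. -/
theorem panel_bounds {ψ : ℝ → ℝ} (hψ : LeftDecay ψ) : ∃ M θ : ℝ, 1 ≤ M ∧ 0 < θ ∧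
    (∀ x ≤ 0, |ψ x| ≤ M * Real.exp (θ * x)) ∧
    (∀ (κ : ℂ) (x : ℝ), κ ≠ 0 → M * ‖κ⁻¹‖ ≤ 1 → x ≤ 0 → ‖slow κ ψ x‖ ≤ M * ‖κ⁻¹‖ ^ 2 ∧
      ‖slow κ ψ x‖ ≤ 1 ∧
      ‖slowDeriv κ ψ x + κ * slow κ ψ x - ψ x * κ⁻¹ * (1 + slow κ ψ x) ^ 2‖ ≤ M * ‖κ⁻¹‖ ^ 4) ∧
    ∀ (κ : ℂ) (h t x : ℝ), κ ≠ 0 → 0 < h → h ≤ 1 → 0 < t → ‖κ⁻¹‖ = h * t → M * t ≤ 1 →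
      x + h ≤ 0 →
      PanelBounds M h t (Real.exp (θ * x)) κ (ψ (x + (1 / 2 - √3 / 6) * h))
        (ψ (x + (1 / 2 + √3 / 6) * h)) (slow κ ψ x) (slow κ ψ (x + (1 / 2 - √3 / 6) * h))
        (slow κ ψ (x + (1 / 2 + √3 / 6) * h)) (slow κ ψ (x + h))
        (slowDeriv κ ψ (x + (1 / 2 - √3 / 6) * h)) (slowDeriv κ ψ (x + (1 / 2 + √3 / 6) * h)) := by
  obtain ⟨s1, s2, s3⟩ := sqrt_three_bounds
  obtain ⟨M₀, θ, hM₀, hθ, hb⟩ := LeftDecay.common_bound [ψ, deriv ψ, chi ψ] 3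
    (by simp [hψ, hψ.deriv, hψ.chi])
  set M₁ := max M₀ 1 * Real.exp θ with hM₁
  have he1 : 1 ≤ Real.exp θ := Real.one_le_exp hθ.le
  have hM₁1 : 1 ≤ M₁ := one_le_mul_of_one_le_of_one_le (le_max_right _ _) he1
  have hM₀₁ : M₀ ≤ M₁ := (le_max_left _ _).trans (le_mul_of_one_le_right (by positivity) he1)
  have hM3 : M₁ ≤ M₁ ^ 3 := by
    calc M₁ = M₁ ^ 1 := (pow_one _).symm
      _ ≤ M₁ ^ 3 := pow_le_pow_right₀ hM₁1 (by norm_num)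
  set M := 16 * M₁ ^ 3 with hMdef
  have hM1 : 16 * M₁ ≤ M := by linarith
  have hexp1 : ∀ x ≤ 0, Real.exp (θ * x) ≤ 1 := fun x hx =>
    Real.exp_le_one_iff.2 (mul_nonpos_of_nonneg_of_nonpos hθ.le hx)
  -- bounds on the panel
  have pb : ∀ (x y h : ℝ), h ≤ 1 → y ≤ x + h → y ≤ 0 → ∀ g ∈ [ψ, deriv ψ, chi ψ], ∀ k ≤ 3,
      |_root_.iteratedDeriv k g y| ≤ M₁ * Real.exp (θ * x) := by
    intro x y h h1 hy hy0 g hg k hk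
    refine (hb g hg k hk y hy0).trans ?_
    calc M₀ * Real.exp (θ * y) ≤ max M₀ 1 * (Real.exp θ * Real.exp (θ * x)) :=
          mul_le_mul (le_max_left _ _) (exp_panel_le hθ h1 hy) (Real.exp_pos _).le (by positivity)
      _ = _ := by rw [hM₁]; ring
  have pb0 : ∀ (x y h : ℝ), h ≤ 1 → y ≤ x + h → y ≤ 0 →
      |ψ y| ≤ M₁ * Real.exp (θ * x) ∧ |deriv ψ y| ≤ M₁ * Real.exp (θ * x) ∧
      |chi ψ y| ≤ M₁ * Real.exp (θ * x) ∧ |deriv (deriv ψ) y| ≤ M₁ * Real.exp (θ * x) ∧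
      |deriv (chi ψ) y| ≤ M₁ * Real.exp (θ * x) := by
    intro x y h h1 hy hy0
    refine ⟨?_, ?_, ?_, ?_, ?_⟩
    · simpa using pb x y h h1 hy hy0 ψ (by simp) 0 (by norm_num)
    · simpa using pb x y h h1 hy hy0 (deriv ψ) (by simp) 0 (by norm_num)
    · simpa using pb x y h h1 hy hy0 (chi ψ) (by simp) 0 (by norm_num)
    · simpa using pb x y h h1 hy hy0 (deriv ψ) (by simp) 1 (by norm_num)
    · simpa using pb x y h h1 hy hy0 (chi ψ) (by simp) 1 (by norm_num)
  refine ⟨M, θ, by linarith, hθ, fun x hx => ?_, fun κ x hκ hMq hx => ?_, ?_⟩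
  · refine (hb ψ (by simp) 0 (by norm_num) x hx).trans ?_
    exact mul_le_mul_of_nonneg_right (by linarith) (Real.exp_pos _).le
  · have hq0 : 0 ≤ ‖κ⁻¹‖ := norm_nonneg _
    have hq1 : ‖κ⁻¹‖ ≤ 1 := le_trans (le_mul_of_one_le_left hq0 (by linarith)) hMq
    obtain ⟨h0, h1, hc, -, hc1⟩ := pb0 x x 0 zero_le_one (by simp) hx
    have hs : ‖slow κ ψ x‖ ≤ M * ‖κ⁻¹‖ ^ 2 := by
      refine (norm_combo_le hq1 h0 h1 hc).trans ?_
      have h2 : M₁ * Real.exp (θ * x) ≤ M₁ := mul_le_of_le_one_right (by linarith) (hexp1 x hx)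
      calc 3 * ‖κ⁻¹‖ ^ 2 * (M₁ * Real.exp (θ * x)) ≤ 3 * ‖κ⁻¹‖ ^ 2 * M₁ := by gcongr
        _ = (3 * M₁) * ‖κ⁻¹‖ ^ 2 := by ring
        _ ≤ _ := by gcongr; linarith
    refine ⟨hs, hs.trans ?_, ?_⟩
    · calc M * ‖κ⁻¹‖ ^ 2 = M * ‖κ⁻¹‖ * ‖κ⁻¹‖ := by ring
        _ ≤ 1 := mul_le_one₀ hMq hq0 hq1
    · refine (slow_defect_le hκ hq1 hM₁1 (Real.exp_pos _).le (hexp1 x hx) rfl h0 h1 hc hc1).trans ?_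
      refine mul_le_mul_of_nonneg_right ?_ (by positivity)
      exact mul_le_of_le_one_right (by positivity) (hexp1 x hx)
  intro κ h t x hκ hh h1 ht hq hMt hx
  set g := Real.exp (θ * x) with hg
  have hg0 : 0 < g := Real.exp_pos _
  have hg1 : g ≤ 1 := hexp1 x (by linarith)
  have hqt : h * t ≤ t := mul_le_of_le_one_left ht.le h1
  have ht1 : t ≤ 1 := le_trans (le_mul_of_one_le_left ht.le (by linarith)) hMt
  have hq1 : ‖κ⁻¹‖ ≤ 1 := by rw [hq]; linarith
  set x₁ := x + (1 / 2 - √3 / 6) * h with hx₁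
  set x₂ := x + (1 / 2 + √3 / 6) * h with hx₂
  have hx₁h : x₁ ≤ x + h := by rw [hx₁]; nlinarith
  have hx₂h : x₂ ≤ x + h := by rw [hx₂]; nlinarith
  obtain ⟨a0, a1, ac, a2, ac1⟩ := pb0 x x₁ h h1 hx₁h (by linarith)
  obtain ⟨b0, b1, bc, b2, bc1⟩ := pb0 x x₂ h h1 hx₂h (by linarith)
  rw [← hg] at a0 a1 ac a2 ac1 b0 b1 bc b2 bc1
  have hnode : ∀ G ∈ [ψ, deriv ψ, chi ψ], ContDiff ℝ ∞ G → ∀ c, 0 ≤ c → c ≤ 1 →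
      |G (x + c * h) - G x| ≤ M₁ * g * h := fun G hG hs c hc hc1 =>
    abs_node_sub_le hs hh.le hc hc1 fun y hy =>
      pb x y h h1 hy.2 (hy.2.trans hx) G hG 1 (by norm_num)
  have hstage : ∀ c p q : ℝ, 0 ≤ c → c ≤ 1 → |p| ≤ 1 → |q| ≤ 1 → p + q = c →
      p * (1 / 2 - √3 / 6) + q * (1 / 2 + √3 / 6) = c ^ 2 / 2 →
      ‖slow κ ψ (x + c * h) - slow κ ψ x - h * ((p : ℂ) * slowDeriv κ ψ x₁ +
        (q : ℂ) * slowDeriv κ ψ x₂)‖ ≤ M * g * (h ^ 5 * t ^ 2) := by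
    intro c p q hc hc1 hp hq' e1 e2
    have st : ∀ G ∈ [ψ, deriv ψ, chi ψ], ContDiff ℝ ∞ G →
        |G (x + c * h) - G x - h * (p * deriv G x₁ + q * deriv G x₂)| ≤
          3 * (M₁ * g) * h ^ 3 := fun G hG hs =>
      abs_stage_le hs hh.le hc hc1 hp hq' e1 e2 fun y hy =>
        pb x y h h1 hy.2 (hy.2.trans hx) G hG 3 le_rfl
    have := norm_combo_le hq1 (st ψ (by simp) hψ.1) (st (deriv ψ) (by simp) hψ.deriv.1)
      (st (chi ψ) (by simp) hψ.chi.1)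
    have e : slow κ ψ (x + c * h) - slow κ ψ x - h * ((p : ℂ) * slowDeriv κ ψ x₁ +
        (q : ℂ) * slowDeriv κ ψ x₂) =
        κ⁻¹ ^ 2 * ((ψ (x + c * h) - ψ x - h * (p * deriv ψ x₁ + q * deriv ψ x₂) : ℝ) : ℂ) -
        κ⁻¹ ^ 3 * ((deriv ψ (x + c * h) - deriv ψ x -
          h * (p * deriv (deriv ψ) x₁ + q * deriv (deriv ψ) x₂) : ℝ) : ℂ) +
        κ⁻¹ ^ 4 * ((chi ψ (x + c * h) - chi ψ x -
          h * (p * deriv (chi ψ) x₁ + q * deriv (chi ψ) x₂) : ℝ) : ℂ) := by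
      simp only [slow, slowDeriv]
      push_cast
      ring
    rw [e]
    refine this.trans ?_
    rw [hq]
    calc _ = (9 * M₁) * g * (h ^ 5 * t ^ 2) := by ring
      _ ≤ _ := by gcongr; linarith
  have hsub : ∀ c, 0 ≤ c → c ≤ 1 →
      ‖slow κ ψ (x + c * h) - slow κ ψ x‖ ≤ M * g * (h ^ 3 * t ^ 2) := by
    intro c hc hc1
    have := norm_combo_le hq1 (hnode ψ (by simp) hψ.1 c hc hc1)
      (hnode (deriv ψ) (by simp) hψ.deriv.1 c hc hc1) (hnode (chi ψ) (by simp) hψ.chi.1 c hc hc1)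
    have e : slow κ ψ (x + c * h) - slow κ ψ x =
        κ⁻¹ ^ 2 * ((ψ (x + c * h) - ψ x : ℝ) : ℂ) -
        κ⁻¹ ^ 3 * ((deriv ψ (x + c * h) - deriv ψ x : ℝ) : ℂ) +
        κ⁻¹ ^ 4 * ((chi ψ (x + c * h) - chi ψ x : ℝ) : ℂ) := by
      simp only [slow]
      push_cast
      ring
    rw [e]
    refine this.trans ?_
    rw [hq]
    calc _ = (3 * M₁) * g * (h ^ 3 * t ^ 2) := by ring
      _ ≤ _ := by gcongr; linarith
  have hMg : M₁ * g ≤ M * g := by gcongr; linarith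
  have hslow1 : ∀ y, |ψ y| ≤ M₁ * g → |deriv ψ y| ≤ M₁ * g → |chi ψ y| ≤ M₁ * g →
      ‖slow κ ψ y‖ ≤ 1 := by
    intro y c0 c1 c2
    refine (norm_combo_le hq1 c0 c1 c2).trans ?_
    calc 3 * ‖κ⁻¹‖ ^ 2 * (M₁ * g) ≤ 3 * ‖κ⁻¹‖ ^ 2 * (M₁ * 1) := by gcongr
      _ = 3 * M₁ * ‖κ⁻¹‖ * ‖κ⁻¹‖ := by ring
      _ ≤ M * t * 1 := by
        have : ‖κ⁻¹‖ ≤ t := by rw [hq]; exact hqt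
        gcongr
        linarith
      _ ≤ 1 := by linarith
  have hder : ∀ y, |deriv ψ y| ≤ M₁ * g → |deriv (deriv ψ) y| ≤ M₁ * g →
      |deriv (chi ψ) y| ≤ M₁ * g → ‖slowDeriv κ ψ y‖ ≤ M * g * (h ^ 2 * t ^ 2) := by
    intro y c0 c1 c2
    refine (norm_combo_le hq1 c0 c1 c2).trans ?_
    rw [hq]
    calc 3 * (h * t) ^ 2 * (M₁ * g) = (3 * M₁) * g * (h ^ 2 * t ^ 2) := by ring
      _ ≤ _ := by gcongr; linarith
  have hdef : ∀ y, |ψ y| ≤ M₁ * g → |deriv ψ y| ≤ M₁ * g → |chi ψ y| ≤ M₁ * g →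
      |deriv (chi ψ) y| ≤ M₁ * g →
      ‖slowDeriv κ ψ y + κ * slow κ ψ y - ψ y * κ⁻¹ * (1 + slow κ ψ y) ^ 2‖ ≤
        M * g * (h ^ 4 * t ^ 4) := by
    intro y c0 c1 c2 c3
    refine (slow_defect_le hκ hq1 hM₁1 hg0.le hg1 rfl c0 c1 c2 c3).trans_eq ?_
    rw [hq, hMdef]; ring
  have q1 : (0 : ℝ) ≤ 1 / 2 - √3 / 6 := by linarith
  have q2 : 1 / 2 - √3 / 6 ≤ (1 : ℝ) := by linarith
  have q3 : (0 : ℝ) ≤ 1 / 2 + √3 / 6 := by linarith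
  have q4 : 1 / 2 + √3 / 6 ≤ (1 : ℝ) := by linarith
  have w1 : |(1 / 4 : ℝ)| ≤ 1 := by norm_num [abs_le]
  have w2 : |1 / 4 - √3 / 6| ≤ 1 := by rw [abs_le]; constructor <;> linarith
  have w3 : |1 / 4 + √3 / 6| ≤ 1 := by rw [abs_le]; constructor <;> linarith
  have w4 : |(1 / 2 : ℝ)| ≤ 1 := by norm_num [abs_le]
  have st1 := hstage (1 / 2 - √3 / 6) (1 / 4) (1 / 4 - √3 / 6) q1 q2 w1 w2 (by ring)
    (by linear_combination (-1 / 24) * s3)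
  have st2 := hstage (1 / 2 + √3 / 6) (1 / 4 + √3 / 6) (1 / 4) q3 q4 w3 w1 (by ring)
    (by linear_combination (-1 / 24) * s3)
  -- The final update has the shape of a stage at the node `1` with weights `1/2`, `1/2`.
  have st3 := hstage 1 (1 / 2) (1 / 2) zero_le_one le_rfl w4 w4 (by ring) (by ring)
  rw [← hx₁] at st1
  rw [← hx₂] at st2
  exact {
    pot₁ := by rw [Complex.norm_real, Real.norm_eq_abs]; exact a0.trans hMg
    pot₂ := by rw [Complex.norm_real, Real.norm_eq_abs]; exact b0.trans hMg
    pot_sub := by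
      have c1 := hnode ψ (by simp) hψ.1 _ q1 q2
      have c2 := hnode ψ (by simp) hψ.1 _ q3 q4
      rw [← Complex.ofReal_sub, Complex.norm_real, Real.norm_eq_abs]
      have c3 := abs_sub_le (ψ x₂) (ψ x) (ψ x₁)
      rw [abs_sub_comm (ψ x)] at c3
      have c4 : M₁ * g * h + M₁ * g * h ≤ M * g * h := by
        calc _ = (2 * M₁) * g * h := by ring
          _ ≤ _ := by gcongr; linarith
      linarith
    slow₁ := hslow1 _ a0 a1 ac
    slow₂ := hslow1 _ b0 b1 bc
    slope₁ := hder _ a1 a2 ac1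
    slope₂ := hder _ b1 b2 bc1
    slow_sub₁ := hsub _ q1 q2
    slow_sub₂ := hsub _ q3 q4
    stage₁ := by simpa [sig] using st1
    stage₂ := by simpa [sig] using st2
    final := by simpa using st3
    defect₁ := hdef _ a0 a1 ac ac1
    defect₂ := hdef _ b0 b1 bc bc1 }

/-! ### The error on one side -/

/-- A primitive of `ψ (1 + slow κ ψ) / κ`. -/
def slowPrim (κ : ℂ) (ψ : ℝ → ℝ) (x : ℝ) : ℂ :=
  κ⁻¹ * ((∫ y in 0..x, ψ y : ℝ) + κ⁻¹ ^ 2 * (∫ y in 0..x, ψ y * ψ y : ℝ) -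
    κ⁻¹ ^ 3 * (∫ y in 0..x, ψ y * deriv ψ y : ℝ) + κ⁻¹ ^ 4 * (∫ y in 0..x, ψ y * chi ψ y : ℝ))

theorem hasDerivAt_slowPrim {ψ : ℝ → ℝ} (h : LeftDecay ψ) (κ : ℂ) (x : ℝ) :
    HasDerivAt (slowPrim κ ψ) (κ⁻¹ * (ψ x * (1 + slow κ ψ x))) x := by
  have prim : ∀ G : ℝ → ℝ, LeftDecay G →
      HasDerivAt (fun x => ((∫ y in 0..x, G y : ℝ) : ℂ)) (G x) x := fun G hG =>
    (intervalIntegral.integral_hasDerivAt_right (hG.1.continuous.intervalIntegrable _ _)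
      (hG.1.continuous.stronglyMeasurableAtFilter _ _) hG.1.continuous.continuousAt).ofReal_comp
  have := ((((prim _ h).add ((prim _ (h.mul h)).const_mul (κ⁻¹ ^ 2))).sub
    ((prim _ (h.mul h.deriv)).const_mul (κ⁻¹ ^ 3))).add
    ((prim _ (h.mul h.chi)).const_mul (κ⁻¹ ^ 4))).const_mul κ⁻¹
  refine this.congr_deriv ?_
  rw [slow]
  push_cast
  ring

/-- The Gauss rule applied to the derivative of `slowPrim`. -/
theorem gauss_slowPrim {ψ : ℝ → ℝ} (h : LeftDecay ψ) (κ : ℂ) (l x : ℝ) :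
    -(l * κ⁻¹ / 2) * (ψ (x + (1 / 2 - √3 / 6) * l) * (1 + slow κ ψ (x + (1 / 2 - √3 / 6) * l)) +
      ψ (x + (1 / 2 + √3 / 6) * l) * (1 + slow κ ψ (x + (1 / 2 + √3 / 6) * l))) =
    (-slowPrim κ ψ (x + l) - -slowPrim κ ψ x) - κ⁻¹ * (panelErr ψ l x : ℝ) -
      κ⁻¹ * (κ⁻¹ ^ 2 * (panelErr (fun y => ψ y * ψ y) l x : ℝ) -
        κ⁻¹ ^ 3 * (panelErr (fun y => ψ y * deriv ψ y) l x : ℝ) +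
        κ⁻¹ ^ 4 * (panelErr (fun y => ψ y * chi ψ y) l x : ℝ)) := by
  -- The integrand `ψ (1 + slow κ ψ)` is split into coefficients of powers of `κ⁻¹`, namely `ψ`,
  -- `ψ²`, `ψψ'` and `ψ chi ψ`. These do not depend on `κ`, so the constants in their quadrature
  -- errors do not either.
  have split : ∀ G : ℝ → ℝ, LeftDecay G →
      ((∫ y in 0..x + l, G y : ℝ) : ℂ) = (∫ y in 0..x, G y : ℝ) +
        ((l / 2 * (G (x + (1 / 2 - √3 / 6) * l) + G (x + (1 / 2 + √3 / 6) * l)) -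
          panelErr G l x : ℝ) : ℂ) := by
    intro G hG
    rw [← Complex.ofReal_add, panelErr, sub_sub_cancel, intervalIntegral.integral_add_adjacent_intervals
      (hG.1.continuous.intervalIntegrable _ _) (hG.1.continuous.intervalIntegrable _ _)]
  rw [slowPrim, slowPrim, split _ h, split _ (h.mul h), split _ (h.mul h.deriv),
    split _ (h.mul h.chi), slow, slow]
  push_cast
  ring

theorem norm_combo_pow_le {ι : ℂ} {x y w B : ℝ} (hι : ‖ι‖ ≤ 1) (hx : |x| ≤ B) (hy : |y| ≤ B)
    (hw : |w| ≤ B) : ‖ι * (ι ^ 2 * x - ι ^ 3 * y + ι ^ 4 * w)‖ ≤ 3 * ‖ι‖ ^ 3 * B := by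
  rw [norm_mul]
  calc ‖ι‖ * ‖ι ^ 2 * (x : ℂ) - ι ^ 3 * y + ι ^ 4 * w‖ ≤ ‖ι‖ * (3 * ‖ι‖ ^ 2 * B) := by
        gcongr; exact norm_combo_le hι hx hy hw
    _ = _ := by ring

/-- The exact exponent is `y`, the numerical one `y - w`. Replacing `exp(-w)` by `1 - v` costs `W²`
and the part `η` of `w`. With `W` of size `h⁴/|κ|` the square is the `h⁸κ⁻²` term of the final
estimate. -/
theorem norm_perturb_le {x y z a₀ a₁ v w η : ℂ} {p₁ p₂ p₃ W : ℝ} (hw : ‖w‖ ≤ W) (hW : W ≤ 1)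
    (hwη : w = v + η) (hη : ‖η‖ ≤ p₃)
    (h₁ : ‖x - Complex.exp (y - w) * a₁‖ ≤ p₁) (h₂ : ‖a₀ - Complex.exp y * a₁‖ ≤ p₂)
    (ha : ‖a₀‖ ≤ 2) (hz : z = a₀ * (1 - v)) : ‖x - z‖ ≤ p₁ + 3 * p₂ + 2 * (W ^ 2 + p₃) := by
  have hW0 : 0 ≤ W := (norm_nonneg _).trans hw
  have e : x - z = (x - Complex.exp (y - w) * a₁) - Complex.exp (-w) * (a₀ - Complex.exp y * a₁) +
      a₀ * ((Complex.exp (-w) - 1 - -w) - η) := by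
    rw [hz, sub_eq_add_neg y w, Complex.exp_add]
    linear_combination -a₀ * hwη
  have hexp : ‖Complex.exp (-w)‖ ≤ 3 := by
    rw [Complex.norm_exp]
    have : (-w).re ≤ 1 := (Complex.re_le_norm _).trans (by rw [norm_neg]; linarith)
    exact (Real.exp_le_exp.2 this).trans (by linarith [Real.exp_one_lt_d9])
  have hq : ‖Complex.exp (-w) - 1 - -w‖ ≤ W ^ 2 := by
    refine (Complex.norm_exp_sub_one_sub_id_le (by rw [norm_neg]; linarith)).trans ?_
    rw [norm_neg]
    exact pow_le_pow_left₀ (norm_nonneg _) hw 2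
  rw [e]
  refine (norm_add_le _ _).trans (add_le_add ((norm_sub_le _ _).trans (add_le_add h₁ ?_)) ?_)
  · rw [norm_mul]
    exact mul_le_mul hexp h₂ (norm_nonneg _) (by norm_num)
  · rw [norm_mul]
    exact mul_le_mul ha ((norm_sub_le _ _).trans (add_le_add hq hη)) (norm_nonneg _) (by norm_num)

set_option maxHeartbeats 1000000 in
/-- The error at `0` of the two-stage Gauss method with `N` steps of length `h`, for the solution
`(a, b)` of the diagonalized problem on the left half line. -/
theorem one_sided {ψ : ℝ → ℝ} (hψ : LeftDecay ψ) {δ : ℝ} (hδ : 0 < δ) :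
    ∃ C K : ℝ, 1 ≤ C ∧ 1 ≤ K ∧ ∀ (h : ℝ) (N : ℕ) (κ : ℂ) (a b : ℝ → ℂ) (α β : ℕ → ℂ),
      0 < h → h ≤ 1 → δ * ‖κ‖ ≤ κ.re → K ≤ h * ‖κ‖ →
      (∀ x, HasDerivAt a (-(ψ x * κ⁻¹) * (a x + b x)) x) →
      (∀ x, HasDerivAt b (-κ * b x + ψ x * κ⁻¹ * (a x + b x)) x) →
      Tendsto a atBot (𝓝 1) → Tendsto b atBot (𝓝 0) →
      α 0 = a (-(N * h)) → β 0 = b (-(N * h)) →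
      (∀ n < N, IsPairStep κ h (ψ (-(N * h) + n * h + (1 / 2 - √3 / 6) * h))
        (ψ (-(N * h) + n * h + (1 / 2 + √3 / 6) * h)) (α n) (β n) (α (n + 1)) (β (n + 1))) →
      ‖α N - a 0 * (1 - κ⁻¹ * (halfErr ψ h N : ℝ))‖ ≤
        C * (h ^ 8 * ‖κ⁻¹‖ ^ 2 + h ^ 4 * ‖κ⁻¹‖ ^ 3 + h ^ 2 * ‖κ⁻¹‖ ^ 4) ∧
      ‖β N - b 0‖ ≤ C * (h ^ 2 * ‖κ⁻¹‖ ^ 2) ∧ ‖a 0‖ ≤ C ∧ ‖b 0‖ ≤ C * ‖κ⁻¹‖ ^ 2 ∧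
      |halfErr ψ h N| ≤ C * h ^ 4 := by
  obtain ⟨M, θ, hM, hθ, hψb, hslow, hpanel⟩ := panel_bounds hψ
  obtain ⟨Ce, q₀, hCe, hq₀, hexact⟩ := exact_side hM hθ hδ
  obtain ⟨C₀, hC₀, hh₀⟩ := hψ.sum_panelErr_le
  obtain ⟨C₁, hC₁, hh₁⟩ := (hψ.mul hψ).sum_panelErr_le
  obtain ⟨C₂, hC₂, hh₂⟩ := (hψ.mul hψ.deriv).sum_panelErr_le
  obtain ⟨C₃, hC₃, hh₃⟩ := (hψ.mul hψ.chi).sum_panelErr_le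
  set Ch := C₀ + C₁ + C₂ + C₃ with hCh
  have hCh0 : 0 < Ch := by positivity
  set Cd := 100000 * M ^ 5 + Ce with hCd
  have hM5 : M ≤ M ^ 5 := by
    calc M = M ^ 1 := (pow_one _).symm
      _ ≤ M ^ 5 := pow_le_pow_right₀ hM (by norm_num)
  have hM5' : 100000 * M ^ 5 ≤ Cd := by linarith
  have hCeCd : Ce ≤ Cd := by linarith
  obtain ⟨C', hC', hdisc⟩ := discrete_propagation (C := Cd) (G := 1 / θ) (c := 3 * δ)
    (by positivity) (by positivity) (by positivity)
  set D := C' + 3 * Ce + 2 * ((4 * Ch) ^ 2 + 3 * Ch) with hD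
  have hD0 : 0 ≤ D := by positivity
  -- In the lower bound for `h‖κ‖`, the term `52 * M` gives `M * t ≤ 1 / 52`, the term `1 / q₀` the
  -- smallness needed by `exact_side`, and `4 * Ch` makes the perturbation of the exponent at most
  -- one.
  refine ⟨2 + D + C' + M * (3 * D + 2 * Ch) + Ce + 2 * M + Ch, 1 + 52 * M + 1 / q₀ + 4 * Ch, ?_, ?_, ?_⟩
  · have : 0 ≤ M * (3 * D + 2 * Ch) := by positivity
    linarith
  · have : 0 ≤ 1 / q₀ := by positivity
    linarith
  intro h N κ a b α β hh h1 hre hK ha hb hla hlb hα0 hβ0 hstep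
  have hq₀' : 0 < 1 / q₀ := by positivity
  have hhκ : 0 < h * ‖κ‖ := by linarith
  have hκn : 0 < ‖κ‖ := pos_of_mul_pos_right hhκ hh.le
  have hκ0 : κ ≠ 0 := norm_pos_iff.1 hκn
  set t := (h * ‖κ‖)⁻¹ with ht
  have ht0 : 0 < t := inv_pos.2 hhκ
  have htK : ∀ c, c ≤ h * ‖κ‖ → c * t ≤ 1 := by
    intro c hc
    rw [ht, ← div_eq_mul_inv]
    exact (div_le_one hhκ).2 hc
  have ht1 : t ≤ 1 := by simpa using htK 1 (by linarith)
  have hMt : M * t ≤ 1 / 52 := by linarith [htK (52 * M) (by linarith)]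
  have htq : t ≤ q₀ := by
    have := htK (1 / q₀) (by linarith)
    rw [div_mul_eq_mul_div, one_mul, div_le_one hq₀] at this
    exact this
  have htC : 4 * Ch * t ≤ 1 := htK _ (by linarith)
  have hqt : ‖κ⁻¹‖ = h * t := by
    rw [norm_inv, ht]
    field_simp
  set q := ‖κ⁻¹‖ with hq
  have hq0 : 0 < q := by rw [hqt]; positivity
  have hqlt : q ≤ t := by rw [hqt]; exact mul_le_of_le_one_left ht0.le h1
  have hqh : q ≤ h := by rw [hqt]; exact mul_le_of_le_one_right hh.le ht1
  have hq1 : q ≤ 1 := hqh.trans h1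
  have hMq : M * q ≤ 1 := by
    have : M * q ≤ M * t := by gcongr
    linarith
  have hex := hexact κ ψ a b (slow κ ψ) (slowDeriv κ ψ) (slowPrim κ ψ) hκ0 (hqlt.trans htq) hre hψb
    (hasDerivAt_slow hψ κ) (fun x hx => (hslow κ x hκ0 hMq hx).2.1)
    (fun x hx => (hslow κ x hκ0 hMq hx).2.2) (hasDerivAt_slowPrim hψ κ) ha hb hla hlb
  simp only [← hq] at hex
  have hL : -(N * h) ≤ 0 := neg_nonpos.2 (by positivity)
  set ξ : ℕ → ℝ := fun n => -(N * h) + n * h with hξ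
  have hξs : ∀ n, ξ (n + 1) = ξ n + h := by
    intro n
    simp only [hξ]
    push_cast
    ring
  have hξ0 : ξ 0 = -(N * h) := by simp [hξ]
  have hξN : ξ N = 0 := by simp [hξ]
  set s : ℕ → ℂ := fun n => -(h * κ⁻¹ / 2) *
    (ψ (ξ n + (1 / 2 - √3 / 6) * h) * (1 + slow κ ψ (ξ n + (1 / 2 - √3 / 6) * h)) +
      ψ (ξ n + (1 / 2 + √3 / 6) * h) * (1 + slow κ ψ (ξ n + (1 / 2 + √3 / 6) * h))) with hs
  have hpb : ∀ n < N, _ := fun n hn => hpanel κ h t (ξ n) hκ0 hh h1 ht0 hqt (by linarith)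
    (node_le_zero hn hh)
  have hg1 : ∀ n < N, Real.exp (θ * ξ n) ≤ 1 := fun n hn =>
    Real.exp_le_one_iff.2 (mul_nonpos_of_nonneg_of_nonpos hθ.le (by
      have : ξ n + h ≤ 0 := node_le_zero hn hh
      linarith))
  have hpair : ∀ n < N, _ := fun n hn => pair_step hM hMt hh h1 ht0 (Real.exp_pos _).le (hg1 n hn) hδ
    (by
      rw [norm_mul, Complex.norm_real, Real.norm_eq_abs, abs_of_pos hh, ht]
      exact mul_inv_cancel₀ hhκ.ne') hre (hpb n hn) (hstep n hn)
  obtain ⟨heN, hαN⟩ := hdisc h t N α (fun n => β n - slow κ ψ (ξ n) * α n) s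
    (fun n => Real.exp (θ * ξ n)) hh h1 ht0 ht1 (fun n => (Real.exp_pos _).le) hg1
    (sum_exp_le hθ h N)
    (by
      intro n hn
      have p := hpb n hn
      have hone : ∀ u r : ℂ, ‖u‖ ≤ M * Real.exp (θ * ξ n) → ‖r‖ ≤ 1 →
          ‖u * (1 + r)‖ ≤ M * Real.exp (θ * ξ n) * 2 := by
        intro u r hu hr
        rw [norm_mul]
        refine mul_le_mul hu ((norm_add_le _ _).trans ?_) (norm_nonneg _) (by positivity)
        rw [norm_one]
        linarith
      have hsum := (norm_add_le _ _).trans (add_le_add (hone _ _ p.pot₁ p.slow₁) (hone _ _ p.pot₂ p.slow₂))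
      have hfac : ‖-(h * κ⁻¹ / 2)‖ ≤ h / 2 := by
        rw [norm_neg, norm_div, norm_mul, Complex.norm_real, Real.norm_eq_abs, abs_of_pos hh,
          Complex.norm_two]
        have : h * ‖κ⁻¹‖ ≤ h := mul_le_of_le_one_right hh.le hq1
        linarith
      rw [hs, norm_mul]
      calc _ ≤ h / 2 * (M * Real.exp (θ * ξ n) * 2 + M * Real.exp (θ * ξ n) * 2) :=
            mul_le_mul hfac hsum (norm_nonneg _) (by positivity)
        _ = (2 * M) * (h * Real.exp (θ * ξ n)) := by ring
        _ ≤ _ := by gcongr; linarith)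
    (by
      intro n hn
      rw [hξs]
      refine (hpair n hn).1.trans ?_
      gcongr)
    (by
      intro n hn
      refine (hpair n hn).2.trans ?_
      gcongr)
    (by
      rw [hα0]
      exact (hex _ hL).1)
    (by
      simp only [hξ0]
      rw [hα0, hβ0]
      refine (hex _ hL).2.1.trans ?_
      rw [hqt]
      -- The exact starting value deviates from the manifold by `O(q ^ 5)`, which is more than
      -- enough for the initial bound required of the recursion.
      calc Ce * (h * t) ^ 5 = Ce * (h ^ 4 * t ^ 2) * (h * t ^ 3) := by ring
        _ ≤ Ce * (h ^ 4 * t ^ 2) * (1 * 1 ^ 3) := by gcongr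
        _ = Ce * (h ^ 4 * t ^ 2) := by ring
        _ ≤ _ := by gcongr)
  simp only [hξN] at heN
  set v := κ⁻¹ * ((halfErr ψ h N : ℝ) : ℂ) with hv
  set η := κ⁻¹ * (κ⁻¹ ^ 2 * (halfErr (fun y => ψ y * ψ y) h N : ℝ) -
        κ⁻¹ ^ 3 * (halfErr (fun y => ψ y * deriv ψ y) h N : ℝ) +
        κ⁻¹ ^ 4 * (halfErr (fun y => ψ y * chi ψ y) h N : ℝ)) with hη
  -- The increments of the primitive telescope to the exact exponent; the panel errors add up to the
  -- one-sided quadrature errors.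
  have hsum : ∑ n ∈ Finset.range N, s n =
      -(slowPrim κ ψ 0 - slowPrim κ ψ (-(N * h))) - (v + η) := by
    have e : ∀ n ∈ Finset.range N, s n = (-slowPrim κ ψ (ξ (n + 1)) - -slowPrim κ ψ (ξ n)) -
        κ⁻¹ * (panelErr ψ h (ξ n) : ℝ) -
        κ⁻¹ * (κ⁻¹ ^ 2 * (panelErr (fun y => ψ y * ψ y) h (ξ n) : ℝ) -
          κ⁻¹ ^ 3 * (panelErr (fun y => ψ y * deriv ψ y) h (ξ n) : ℝ) +
          κ⁻¹ ^ 4 * (panelErr (fun y => ψ y * chi ψ y) h (ξ n) : ℝ)) := by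
      intro n _
      rw [hξs]
      exact gauss_slowPrim hψ κ h (ξ n)
    rw [Finset.sum_congr rfl e, Finset.sum_sub_distrib, Finset.sum_sub_distrib,
      Finset.sum_range_sub (fun n => -slowPrim κ ψ (ξ n)), hξN, hξ0, ← Finset.mul_sum,
      ← Finset.mul_sum, Finset.sum_add_distrib, Finset.sum_sub_distrib, ← Finset.mul_sum,
      ← Finset.mul_sum, ← Finset.mul_sum, hv, hη, halfErr, halfErr, halfErr, halfErr]
    push_cast
    ring
  have b₀ : |halfErr ψ h N| ≤ Ch * h ^ 4 :=
    (hh₀ h N hh h1).trans (mul_le_mul_of_nonneg_right (by linarith) (by positivity))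
  have b₁ : |halfErr (fun y => ψ y * ψ y) h N| ≤ Ch * h ^ 4 :=
    (hh₁ h N hh h1).trans (mul_le_mul_of_nonneg_right (by linarith) (by positivity))
  have b₂ : |halfErr (fun y => ψ y * deriv ψ y) h N| ≤ Ch * h ^ 4 :=
    (hh₂ h N hh h1).trans (mul_le_mul_of_nonneg_right (by linarith) (by positivity))
  have b₃ : |halfErr (fun y => ψ y * chi ψ y) h N| ≤ Ch * h ^ 4 :=
    (hh₃ h N hh h1).trans (mul_le_mul_of_nonneg_right (by linarith) (by positivity))
  have hηn : ‖η‖ ≤ 3 * q ^ 3 * (Ch * h ^ 4) := norm_combo_pow_le hq1 b₁ b₂ b₃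
  have hvn : ‖v‖ ≤ q * (Ch * h ^ 4) := by
    rw [hv, norm_mul, Complex.norm_real, Real.norm_eq_abs]
    gcongr
  have hq3 : q ^ 3 ≤ q := by
    calc q ^ 3 = q * (q * q) := by ring
      _ ≤ q * (1 * 1) := by gcongr
      _ = q := by ring
  have hwn : ‖v + η‖ ≤ 4 * q * (Ch * h ^ 4) := by
    refine (norm_add_le _ _).trans ((add_le_add hvn hηn).trans ?_)
    calc q * (Ch * h ^ 4) + 3 * q ^ 3 * (Ch * h ^ 4) ≤ q * (Ch * h ^ 4) + 3 * q * (Ch * h ^ 4) := by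
          gcongr
      _ = _ := by ring
  have hW1 : 4 * q * (Ch * h ^ 4) ≤ 1 := by
    calc 4 * q * (Ch * h ^ 4) = 4 * Ch * q * h ^ 4 := by ring
      _ ≤ 4 * Ch * t * 1 := by gcongr; exact pow_le_one₀ hh.le h1
      _ ≤ 1 := by linarith
  rw [hsum, hα0] at hαN
  obtain ⟨ha0, hb0, -, -⟩ := hex 0 le_rfl
  obtain ⟨-, -, -, haL⟩ := hex _ hL
  have hmain := norm_perturb_le hwn hW1 rfl hηn hαN haL ha0 rfl
  have hmain' : ‖α N - a 0 * (1 - v)‖ ≤ D * (h ^ 8 * q ^ 2 + h ^ 4 * q ^ 3 + h ^ 2 * q ^ 4) := by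
    refine hmain.trans ?_
    -- The substitution `q = h * t` turns the step-size bounds into powers of `κ⁻¹`.
    have e1 : h ^ 6 * t ^ 4 + h ^ 7 * t ^ 3 = h ^ 4 * q ^ 3 + h ^ 2 * q ^ 4 := by rw [hqt]; ring
    have e2 : Ce * q ^ 6 ≤ Ce * (h ^ 2 * q ^ 4) := by
      calc Ce * q ^ 6 = Ce * (q ^ 2 * q ^ 4) := by ring
        _ ≤ _ := by gcongr
    have p1 : 0 ≤ h ^ 8 * q ^ 2 := by positivity
    have p2 : 0 ≤ h ^ 4 * q ^ 3 := by positivity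
    have p3 : 0 ≤ h ^ 2 * q ^ 4 := by positivity
    rw [e1]
    calc C' * (h ^ 4 * q ^ 3 + h ^ 2 * q ^ 4) + 3 * (Ce * q ^ 6) +
          2 * ((4 * q * (Ch * h ^ 4)) ^ 2 + 3 * q ^ 3 * (Ch * h ^ 4)) ≤
        C' * (h ^ 8 * q ^ 2 + h ^ 4 * q ^ 3 + h ^ 2 * q ^ 4) +
          3 * (Ce * (h ^ 8 * q ^ 2 + h ^ 4 * q ^ 3 + h ^ 2 * q ^ 4)) +
          2 * ((4 * Ch) ^ 2 * (h ^ 8 * q ^ 2) + 3 * Ch * (h ^ 4 * q ^ 3)) := by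
          refine add_le_add (add_le_add ?_ ?_) (le_of_eq (by ring))
          · exact mul_le_mul_of_nonneg_left (by linarith) hC'
          · have : Ce * (h ^ 2 * q ^ 4) ≤ Ce * (h ^ 8 * q ^ 2 + h ^ 4 * q ^ 3 + h ^ 2 * q ^ 4) :=
              mul_le_mul_of_nonneg_left (by linarith) hCe
            linarith
      _ ≤ C' * (h ^ 8 * q ^ 2 + h ^ 4 * q ^ 3 + h ^ 2 * q ^ 4) +
          3 * (Ce * (h ^ 8 * q ^ 2 + h ^ 4 * q ^ 3 + h ^ 2 * q ^ 4)) +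
          2 * ((4 * Ch) ^ 2 * (h ^ 8 * q ^ 2 + h ^ 4 * q ^ 3 + h ^ 2 * q ^ 4) +
            3 * Ch * (h ^ 8 * q ^ 2 + h ^ 4 * q ^ 3 + h ^ 2 * q ^ 4)) := by
          gcongr <;> linarith
      _ = _ := by rw [hD]; ring
  have hr0 : ‖slow κ ψ 0‖ ≤ M * q ^ 2 := (hslow κ 0 hκ0 hMq le_rfl).1
  have hP : 0 ≤ M * (3 * D + 2 * Ch) := by positivity
  have hαa : ‖α N - a 0‖ ≤ (3 * D + 2 * Ch) * h ^ 2 := by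
    have e : α N - a 0 = (α N - a 0 * (1 - v)) - a 0 * v := by ring
    have r1 : h ^ 8 * q ^ 2 + h ^ 4 * q ^ 3 + h ^ 2 * q ^ 4 ≤ 3 * h ^ 2 := by
      have s1 : h ^ 8 * q ^ 2 ≤ h ^ 2 * 1 :=
        mul_le_mul (pow_le_pow_of_le_one hh.le h1 (by norm_num)) (pow_le_one₀ hq0.le hq1)
          (by positivity) (by positivity)
      have s2 : h ^ 4 * q ^ 3 ≤ h ^ 2 * 1 :=
        mul_le_mul (pow_le_pow_of_le_one hh.le h1 (by norm_num)) (pow_le_one₀ hq0.le hq1)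
          (by positivity) (by positivity)
      have s3 : h ^ 2 * q ^ 4 ≤ h ^ 2 * 1 :=
        mul_le_mul_of_nonneg_left (pow_le_one₀ hq0.le hq1) (by positivity)
      linarith
    have r2 : ‖a 0 * v‖ ≤ 2 * (Ch * h ^ 2) := by
      rw [norm_mul]
      refine mul_le_mul ha0 (hvn.trans ?_) (norm_nonneg _) (by norm_num)
      calc q * (Ch * h ^ 4) ≤ 1 * (Ch * h ^ 2) :=
            mul_le_mul hq1 (mul_le_mul_of_nonneg_left
              (pow_le_pow_of_le_one hh.le h1 (by norm_num)) hCh0.le) (by positivity) zero_le_one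
        _ = _ := one_mul _
    rw [e]
    refine (norm_sub_le _ _).trans ((add_le_add hmain' r2).trans ?_)
    calc _ ≤ D * (3 * h ^ 2) + 2 * (Ch * h ^ 2) := by gcongr
      _ = _ := by ring
  refine ⟨hmain'.trans ?_, ?_, ?_, ?_, b₀.trans ?_⟩
  · exact mul_le_mul_of_nonneg_right (by linarith) (by positivity)
  -- Numerical and exact fast components are compared through their common manifold value `slow κ ψ
  -- 0`, which is itself `O(q ^ 2)`.
  · have e : β N - b 0 = (β N - slow κ ψ 0 * α N) + slow κ ψ 0 * (α N - a 0) -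
        (b 0 - slow κ ψ 0 * a 0) := by ring
    have t2 : ‖slow κ ψ 0 * (α N - a 0)‖ ≤ M * q ^ 2 * ((3 * D + 2 * Ch) * h ^ 2) := by
      rw [norm_mul]
      exact mul_le_mul hr0 hαa (norm_nonneg _) (by positivity)
    have t3 : Ce * q ^ 5 ≤ Ce * (h ^ 2 * q ^ 2) := by
      calc Ce * q ^ 5 = Ce * (q ^ 2 * q ^ 2) * q := by ring
        _ ≤ Ce * (h ^ 2 * q ^ 2) * 1 := by gcongr
        _ = _ := mul_one _
    have t1 : C' * (h ^ 4 * t ^ 2) = C' * (h ^ 2 * q ^ 2) := by rw [hqt]; ring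
    rw [t1] at heN
    rw [e]
    refine (norm_sub_le _ _).trans ((add_le_add ((norm_add_le _ _).trans (add_le_add heN t2))
      (hb0.trans t3)).trans ?_)
    calc _ = (C' + M * (3 * D + 2 * Ch) + Ce) * (h ^ 2 * q ^ 2) := by ring
      _ ≤ _ := mul_le_mul_of_nonneg_right (by linarith) (by positivity)
  · linarith
  · have e : b 0 = (b 0 - slow κ ψ 0 * a 0) + slow κ ψ 0 * a 0 := by ring
    have t2 : ‖slow κ ψ 0 * a 0‖ ≤ M * q ^ 2 * 2 := by
      rw [norm_mul]
      exact mul_le_mul hr0 ha0 (norm_nonneg _) (by positivity)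
    have t3 : Ce * q ^ 5 ≤ Ce * q ^ 2 := by
      have : q ^ 5 ≤ q ^ 2 := pow_le_pow_of_le_one hq0.le hq1 (by norm_num)
      gcongr
    rw [e]
    refine (norm_add_le _ _).trans ((add_le_add (hb0.trans t3) t2).trans ?_)
    calc _ = (Ce + 2 * M) * q ^ 2 := by ring
      _ ≤ _ := mul_le_mul_of_nonneg_right (by linarith) (by positivity)
  · exact mul_le_mul_of_nonneg_right (by linarith) (by positivity)

/-! ### The modes at infinity -/

theorem kappa_sq (f : ℝ → ℝ) (c u₀ : ℝ) (lam : ℂ) :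
    kappa f c u₀ lam ^ 2 = (c : ℂ) ^ 2 + 4 * (lam - ((deriv f u₀ : ℝ) : ℂ)) := by
  rw [kappa, Complex.sqrt]
  exact_mod_cast Complex.cpow_nat_inv_pow _ two_ne_zero

theorem mu_add (f : ℝ → ℝ) (c u₀ : ℝ) (lam : ℂ) : mu1 f c u₀ lam + mu2 f c u₀ lam = -c := by
  rw [mu1, mu2]
  ring

theorem mu_sub (f : ℝ → ℝ) (c u₀ : ℝ) (lam : ℂ) :
    mu1 f c u₀ lam - mu2 f c u₀ lam = kappa f c u₀ lam := by
  rw [mu1, mu2]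
  ring

theorem mu_mul (f : ℝ → ℝ) (c u₀ : ℝ) (lam : ℂ) :
    mu1 f c u₀ lam * mu2 f c u₀ lam = -(lam - ((deriv f u₀ : ℝ) : ℂ)) := by
  rw [mu1, mu2]
  linear_combination (-1 / 4) * kappa_sq f c u₀ lam

theorem sin_mul_norm_le_re {z : ℂ} {ε : ℝ} (hε : 0 ≤ ε) (hz : |z.arg| < Real.pi / 2 - ε) :
    Real.sin ε * ‖z‖ ≤ z.re := by
  have h1 : Real.sin ε ≤ Real.cos z.arg := by
    rw [← Real.cos_abs z.arg, ← Real.cos_pi_div_two_sub]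
    exact Real.cos_le_cos_of_nonneg_of_le_pi (abs_nonneg _) (by linarith [Real.pi_pos]) hz.le
  rw [← Complex.norm_mul_cos_arg z, mul_comm]
  exact mul_le_mul_of_nonneg_left h1 (norm_nonneg _)

/-- The coefficient of `(1, μ^{[1]})` in `y`. -/
def coeff1 (f : ℝ → ℝ) (c u₀ : ℝ) (lam : ℂ) (y : Fin 2 → ℂ) : ℂ :=
  (kappa f c u₀ lam)⁻¹ * (y 1 - mu2 f c u₀ lam * y 0)

/-- The coefficient of `(1, μ^{[2]})` in `y`. -/
def coeff2 (f : ℝ → ℝ) (c u₀ : ℝ) (lam : ℂ) (y : Fin 2 → ℂ) : ℂ :=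
  (kappa f c u₀ lam)⁻¹ * (mu1 f c u₀ lam * y 0 - y 1)

section coeff

variable {f : ℝ → ℝ} {c u₀ : ℝ} {lam : ℂ}

theorem B_mulVec (w : Fin 2 → ℂ) :
    B f c u₀ lam *ᵥ w = ![w 0 + w 1, mu1 f c u₀ lam * w 0 + mu2 f c u₀ lam * w 1] := by
  ext i
  fin_cases i <;> simp [B, Matrix.mulVec, dotProduct, Fin.sum_univ_two]

theorem coeff1_B (hκ : kappa f c u₀ lam ≠ 0) (w : Fin 2 → ℂ) :
    coeff1 f c u₀ lam (B f c u₀ lam *ᵥ w) = w 0 := by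
  rw [B_mulVec, coeff1, inv_mul_eq_iff_eq_mul₀ hκ, ← mu_sub]
  simp
  ring

theorem coeff2_B (hκ : kappa f c u₀ lam ≠ 0) (w : Fin 2 → ℂ) :
    coeff2 f c u₀ lam (B f c u₀ lam *ᵥ w) = w 1 := by
  rw [B_mulVec, coeff2, inv_mul_eq_iff_eq_mul₀ hκ, ← mu_sub]
  simp
  ring

theorem B_mulVec_coeff (hκ : kappa f c u₀ lam ≠ 0) (y : Fin 2 → ℂ) :
    B f c u₀ lam *ᵥ ![coeff1 f c u₀ lam y, coeff2 f c u₀ lam y] = y := by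
  have e : mu1 f c u₀ lam = mu2 f c u₀ lam + kappa f c u₀ lam := by rw [← mu_sub]; ring
  rw [B_mulVec]
  ext i
  fin_cases i <;> simp [coeff1, coeff2, e] <;> field_simp <;> ring

theorem coeff1_smul (z : ℂ) (y : Fin 2 → ℂ) :
    coeff1 f c u₀ lam (z • y) = z * coeff1 f c u₀ lam y := by
  simp only [coeff1, Pi.smul_apply, smul_eq_mul]
  ring

theorem coeff2_smul (z : ℂ) (y : Fin 2 → ℂ) :
    coeff2 f c u₀ lam (z • y) = z * coeff2 f c u₀ lam y := by
  simp only [coeff2, Pi.smul_apply, smul_eq_mul]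
  ring

theorem continuous_coeff1 : Continuous (coeff1 f c u₀ lam) := by
  unfold coeff1
  fun_prop

theorem continuous_coeff2 : Continuous (coeff2 f c u₀ lam) := by
  unfold coeff2
  fun_prop

variable {U : ℝ → ℝ} {y : ℝ → Fin 2 → ℂ}

/-- Relative to the limiting matrix, only the lower-left entry changes, by `-ψ`. It acts on `y x 0`,
the sum of the two coefficients, and projection onto the eigenvectors gives opposite contributions
`∓ψ/κ`. -/
theorem IsSolution.hasDerivAt_coeff (hy : IsSolution f c U lam y) (hκ : kappa f c u₀ lam ≠ 0)
    (x : ℝ) :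
    HasDerivAt (fun x => coeff1 f c u₀ lam (y x)) (mu1 f c u₀ lam * coeff1 f c u₀ lam (y x) -
      (phi f U x - deriv f u₀ : ℝ) * (kappa f c u₀ lam)⁻¹ *
        (coeff1 f c u₀ lam (y x) + coeff2 f c u₀ lam (y x))) x ∧
    HasDerivAt (fun x => coeff2 f c u₀ lam (y x)) (mu2 f c u₀ lam * coeff2 f c u₀ lam (y x) +
      (phi f U x - deriv f u₀ : ℝ) * (kappa f c u₀ lam)⁻¹ *
        (coeff1 f c u₀ lam (y x) + coeff2 f c u₀ lam (y x))) x := by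
  have h := hasDerivAt_pi.1 (hy x)
  have h0 : HasDerivAt (fun x => y x 0) (y x 1) x := by
    simpa [A, Matrix.mulVec, dotProduct, Fin.sum_univ_two] using h 0
  have h1 : HasDerivAt (fun x => y x 1) ((lam - phi f U x) * y x 0 - c * y x 1) x := by
    have := h 1
    simp only [A, Matrix.mulVec, dotProduct, Fin.sum_univ_two, Matrix.of_apply, Matrix.cons_val_zero,
      Matrix.cons_val_one, Matrix.cons_val', neg_mul, ← sub_eq_add_neg] at this
    exact this
  have hs : coeff1 f c u₀ lam (y x) + coeff2 f c u₀ lam (y x) = y x 0 := by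
    have := congrFun (B_mulVec_coeff hκ (y x)) 0
    rw [B_mulVec] at this
    simpa using this
  rw [hs]
  have e1 := mu_add f c u₀ lam
  have e2 := mu_mul f c u₀ lam
  refine ⟨((h1.sub (h0.const_mul _)).const_mul _).congr_deriv ?_,
    (((h0.const_mul _).sub h1).const_mul _).congr_deriv ?_⟩
  · rw [coeff1]
    push_cast
    linear_combination (-(kappa f c u₀ lam)⁻¹ * y x 1) * e1 + ((kappa f c u₀ lam)⁻¹ * y x 0) * e2
  · rw [coeff2]
    push_cast
    linear_combination ((kappa f c u₀ lam)⁻¹ * y x 1) * e1 - ((kappa f c u₀ lam)⁻¹ * y x 0) * e2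

theorem hasDerivAt_cexp_mul (m : ℂ) (x : ℝ) :
    HasDerivAt (fun x : ℝ => Complex.exp (m * (x : ℂ))) (Complex.exp (m * x) * m) x := by
  simpa using ((hasDerivAt_id x).ofReal_comp.const_mul m).cexp

/-- The coefficients of `y₋` in the transformed variables. -/
theorem IsLeftSolution.coeff (hy : IsLeftSolution f c U u₀ lam y) (hκ : kappa f c u₀ lam ≠ 0) :
    ∃ a b : ℝ → ℂ,
      (∀ x, HasDerivAt a (-(psiLeft f U u₀ x * (kappa f c u₀ lam)⁻¹) * (a x + b x)) x) ∧
      (∀ x, HasDerivAt b (-kappa f c u₀ lam * b x +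
        psiLeft f U u₀ x * (kappa f c u₀ lam)⁻¹ * (a x + b x)) x) ∧
      Tendsto a atBot (𝓝 1) ∧ Tendsto b atBot (𝓝 0) ∧
      (∀ x w, y x = Complex.exp (mu1 f c u₀ lam * (x : ℂ)) • (B f c u₀ lam *ᵥ w) →
        w 0 = a x ∧ w 1 = b x) ∧
      y 0 = B f c u₀ lam *ᵥ ![a 0, b 0] := by
  refine ⟨fun x => Complex.exp (-mu1 f c u₀ lam * x) * coeff1 f c u₀ lam (y x),
    fun x => Complex.exp (-mu1 f c u₀ lam * x) * coeff2 f c u₀ lam (y x), fun x => ?_, fun x => ?_,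
    ?_, ?_, fun x w hw => ?_, ?_⟩
  · refine ((hasDerivAt_cexp_mul _ x).mul (hy.1.hasDerivAt_coeff hκ x).1).congr_deriv ?_
    rw [psiLeft]
    ring
  · refine ((hasDerivAt_cexp_mul _ x).mul (hy.1.hasDerivAt_coeff hκ x).2).congr_deriv ?_
    rw [psiLeft, ← mu_sub]
    ring
  · have := (continuous_coeff1 (f := f) (c := c) (u₀ := u₀) (lam := lam)).continuousAt.tendsto.comp hy.2
    refine Tendsto.congr (fun x => ?_) (this.trans_eq ?_)
    · rw [Function.comp_apply, coeff1_smul, neg_mul]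
    · rw [coeff1]
      simp [mu_sub, hκ]
  · have := (continuous_coeff2 (f := f) (c := c) (u₀ := u₀) (lam := lam)).continuousAt.tendsto.comp hy.2
    refine Tendsto.congr (fun x => ?_) (this.trans_eq ?_)
    · rw [Function.comp_apply, coeff2_smul, neg_mul]
    · rw [coeff2]
      simp
  · dsimp only
    rw [hw, coeff1_smul, coeff2_smul, coeff1_B hκ, coeff2_B hκ, ← mul_assoc, ← mul_assoc,
      ← Complex.exp_add]
    simp
  · simpa using (B_mulVec_coeff hκ (y 0)).symm

/-- The coefficients of `y₊` in the transformed variables, after a reflection. -/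
theorem IsRightSolution.coeff (hy : IsRightSolution f c U u₀ lam y) (hκ : kappa f c u₀ lam ≠ 0) :
    ∃ a b : ℝ → ℂ,
      (∀ x, HasDerivAt a (-(psiRight f U u₀ x * (kappa f c u₀ lam)⁻¹) * (a x + b x)) x) ∧
      (∀ x, HasDerivAt b (-kappa f c u₀ lam * b x +
        psiRight f U u₀ x * (kappa f c u₀ lam)⁻¹ * (a x + b x)) x) ∧
      Tendsto a atBot (𝓝 1) ∧ Tendsto b atBot (𝓝 0) ∧
      (∀ x w, y x = Complex.exp (mu2 f c u₀ lam * (x : ℂ)) • (B f c u₀ lam *ᵥ w) →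
        w 1 = a (-x) ∧ w 0 = b (-x)) ∧
      y 0 = B f c u₀ lam *ᵥ ![b 0, a 0] := by
  have hd : ∀ x, _ := fun x => hy.1.hasDerivAt_coeff hκ (-x)
  refine ⟨fun x => Complex.exp (mu2 f c u₀ lam * x) * coeff2 f c u₀ lam (y (-x)),
    fun x => Complex.exp (mu2 f c u₀ lam * x) * coeff1 f c u₀ lam (y (-x)), fun x => ?_, fun x => ?_,
    ?_, ?_, fun x w hw => ?_, ?_⟩
  · refine ((hasDerivAt_cexp_mul _ x).mul ((hd x).2.scomp x (hasDerivAt_neg x))).congr_deriv ?_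
    rw [psiRight, neg_one_smul]
    simp only [Function.comp_apply]
    ring
  · refine ((hasDerivAt_cexp_mul _ x).mul ((hd x).1.scomp x (hasDerivAt_neg x))).congr_deriv ?_
    rw [psiRight, neg_one_smul]
    simp only [Function.comp_apply]
    rw [← mu_sub]
    ring
  · have := (continuous_coeff2 (f := f) (c := c) (u₀ := u₀) (lam := lam)).continuousAt.tendsto.comp
      (hy.2.comp tendsto_neg_atBot_atTop)
    refine Tendsto.congr (fun x => ?_) (this.trans_eq ?_)
    · simp only [Function.comp_apply, coeff2_smul, Complex.ofReal_neg, mul_neg, neg_neg]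
    · rw [coeff2]
      simp [mu_sub, hκ]
  · have := (continuous_coeff1 (f := f) (c := c) (u₀ := u₀) (lam := lam)).continuousAt.tendsto.comp
      (hy.2.comp tendsto_neg_atBot_atTop)
    refine Tendsto.congr (fun x => ?_) (this.trans_eq ?_)
    · simp only [Function.comp_apply, coeff1_smul, Complex.ofReal_neg, mul_neg, neg_neg]
    · rw [coeff1]
      simp
  · simp only [neg_neg]
    rw [hw, coeff1_smul, coeff2_smul, coeff1_B hκ, coeff2_B hκ, ← mul_assoc, ← mul_assoc,
      ← Complex.exp_add]
    simp
  · simpa using (B_mulVec_coeff hκ (y 0)).symm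

theorem Abar_eq (hκ : kappa f c u₀ lam ≠ 0) (μ : ℂ) (x : ℝ) :
    Abar f c U u₀ μ lam x =
      !![mu1 f c u₀ lam - μ - (phi f U x - deriv f u₀ : ℝ) * (kappa f c u₀ lam)⁻¹,
        -((phi f U x - deriv f u₀ : ℝ) * (kappa f c u₀ lam)⁻¹);
        (phi f U x - deriv f u₀ : ℝ) * (kappa f c u₀ lam)⁻¹,
        mu2 f c u₀ lam - μ + (phi f U x - deriv f u₀ : ℝ) * (kappa f c u₀ lam)⁻¹] := by
  have hdet : IsUnit (B f c u₀ lam).det := by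
    rw [B, Matrix.det_fin_two_of, isUnit_iff_ne_zero]
    intro h
    apply hκ
    rw [← mu_sub]
    linear_combination -h
  have e1 := mu_add f c u₀ lam
  have e2 := mu_mul f c u₀ lam
  have e3 := mu_sub f c u₀ lam
  have e4 : (mu1 f c u₀ lam - mu2 f c u₀ lam) * (kappa f c u₀ lam)⁻¹ = 1 := by
    rw [e3, mul_inv_cancel₀ hκ]
  -- Comparing products with `B` on the left avoids an explicit inverse.
  have key : A f c U lam x * B f c u₀ lam = B f c u₀ lam *
      !![mu1 f c u₀ lam - (phi f U x - deriv f u₀ : ℝ) * (kappa f c u₀ lam)⁻¹,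
        -((phi f U x - deriv f u₀ : ℝ) * (kappa f c u₀ lam)⁻¹);
        (phi f U x - deriv f u₀ : ℝ) * (kappa f c u₀ lam)⁻¹,
        mu2 f c u₀ lam + (phi f U x - deriv f u₀ : ℝ) * (kappa f c u₀ lam)⁻¹] := by
    rw [A, B, Matrix.mul_fin_two, Matrix.mul_fin_two]
    push_cast
    ext i j
    fin_cases i <;> fin_cases j <;> simp only [Matrix.of_apply, Matrix.cons_val', Matrix.cons_val_zero,
      Matrix.cons_val_one, Matrix.cons_val_fin_one, Fin.zero_eta, Fin.mk_one, Fin.isValue]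
    · ring
    · ring
    · linear_combination -mu1 f c u₀ lam * e1 + e2 + (phi f U x - deriv f u₀ : ℂ) * e4
    · linear_combination -mu2 f c u₀ lam * e1 + e2 + (phi f U x - deriv f u₀ : ℂ) * e4
  rw [Abar, mul_assoc, key, Matrix.nonsing_inv_mul_cancel_left _ _ hdet]
  ext i j
  fin_cases i <;> fin_cases j <;> simp <;> ring

theorem Abar_mulVec (hκ : kappa f c u₀ lam ≠ 0) (μ : ℂ) (x : ℝ) (w : Fin 2 → ℂ) :
    (Abar f c U u₀ μ lam x *ᵥ w) 0 = (mu1 f c u₀ lam - μ) * w 0 -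
        (phi f U x - deriv f u₀ : ℝ) * (kappa f c u₀ lam)⁻¹ * (w 0 + w 1) ∧
      (Abar f c U u₀ μ lam x *ᵥ w) 1 = (mu2 f c u₀ lam - μ) * w 1 +
        (phi f U x - deriv f u₀ : ℝ) * (kappa f c u₀ lam)⁻¹ * (w 0 + w 1) := by
  rw [Abar_eq hκ]
  constructor <;> simp [Matrix.mulVec, dotProduct, Fin.sum_univ_two] <;> ring

theorem IsGaussLegendreStep.left {h ξ : ℝ} {w w' : Fin 2 → ℂ} (hκ : kappa f c u₀ lam ≠ 0)
    (hs : IsGaussLegendreStep (Abar f c U u₀ (mu1 f c u₀ lam) lam) h ξ w w') :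
    IsPairStep (kappa f c u₀ lam) h (psiLeft f U u₀ (ξ + (1 / 2 - √3 / 6) * h))
      (psiLeft f U u₀ (ξ + (1 / 2 + √3 / 6) * h)) (w 0) (w 1) (w' 0) (w' 1) := by
  obtain ⟨s₁, s₂, h₁, h₂, h₃⟩ := hs
  set S₁ := w + (1 / 4 * h) • s₁ + ((1 / 4 - √3 / 6) * h) • s₂ with hS₁
  set S₂ := w + ((1 / 4 + √3 / 6) * h) • s₁ + (1 / 4 * h) • s₂ with hS₂
  have e₁ := Abar_mulVec (U := U) hκ (mu1 f c u₀ lam) (ξ + (1 / 2 - √3 / 6) * h) S₁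
  have e₂ := Abar_mulVec (U := U) hκ (mu1 f c u₀ lam) (ξ + (1 / 2 + √3 / 6) * h) S₂
  rw [← h₁] at e₁
  rw [← h₂] at e₂
  have e3 := mu_sub f c u₀ lam
  refine ⟨S₁ 0, S₂ 0, S₁ 1, S₂ 1, s₁ 0, s₂ 0, s₁ 1, s₂ 1, ?_, ?_, ?_, ?_, ?_, ?_, ?_, ?_, ?_, ?_⟩
  · rw [e₁.1, psiLeft]; ring
  · rw [e₂.1, psiLeft]; ring
  · rw [e₁.1, e₁.2]; linear_combination -S₁ 1 * e3
  · rw [e₂.1, e₂.2]; linear_combination -S₂ 1 * e3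
  all_goals
    simp only [hS₁, hS₂, h₃, sig, Pi.add_apply, Pi.smul_apply, Complex.real_smul]
    push_cast
    ring

/-- A backward step from `-ξ` becomes a forward step from `ξ` for the reflected potential. Slopes
change sign and the two components exchange roles, because the second mode is the neutral one on the
right. -/
theorem IsGaussLegendreStep.right {h ξ : ℝ} {w w' : Fin 2 → ℂ} (hκ : kappa f c u₀ lam ≠ 0)
    (hs : IsGaussLegendreStep (Abar f c U u₀ (mu2 f c u₀ lam) lam) (-h) (-ξ) w w') :
    IsPairStep (kappa f c u₀ lam) h (psiRight f U u₀ (ξ + (1 / 2 - √3 / 6) * h))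
      (psiRight f U u₀ (ξ + (1 / 2 + √3 / 6) * h)) (w 1) (w 0) (w' 1) (w' 0) := by
  obtain ⟨s₁, s₂, h₁, h₂, h₃⟩ := hs
  set S₁ := w + (1 / 4 * -h) • s₁ + ((1 / 4 - √3 / 6) * -h) • s₂ with hS₁
  set S₂ := w + ((1 / 4 + √3 / 6) * -h) • s₁ + (1 / 4 * -h) • s₂ with hS₂
  have e₁ := Abar_mulVec (U := U) hκ (mu2 f c u₀ lam) (-ξ + (1 / 2 - √3 / 6) * -h) S₁
  have e₂ := Abar_mulVec (U := U) hκ (mu2 f c u₀ lam) (-ξ + (1 / 2 + √3 / 6) * -h) S₂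
  rw [← h₁] at e₁
  rw [← h₂] at e₂
  have e3 := mu_sub f c u₀ lam
  have n₁ : -(ξ + (1 / 2 - √3 / 6) * h) = -ξ + (1 / 2 - √3 / 6) * -h := by ring
  have n₂ : -(ξ + (1 / 2 + √3 / 6) * h) = -ξ + (1 / 2 + √3 / 6) * -h := by ring
  refine ⟨S₁ 1, S₂ 1, S₁ 0, S₂ 0, -s₁ 1, -s₂ 1, -s₁ 0, -s₂ 0, ?_, ?_, ?_, ?_, ?_, ?_, ?_, ?_, ?_, ?_⟩
  · rw [e₁.2, psiRight, n₁]; ring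
  · rw [e₂.2, psiRight, n₂]; ring
  · rw [e₁.1, e₁.2]; linear_combination -S₁ 0 * e3
  · rw [e₂.1, e₂.2]; linear_combination -S₂ 0 * e3
  all_goals
    simp only [hS₁, hS₂, h₃, sig, Pi.add_apply, Pi.smul_apply, Complex.real_smul]
    push_cast
    ring

end coeff

/-! ### The error in the Evans function -/

/-- The common part `-c/2` of the exponents drops out. The mean of the two `κ`, of size `|λ|^{1/2}`,
multiplies the products of two dominant or two fast components; the half-difference, of size
`|λ|^{-1/2}`, multiplies the mixed ones. -/
theorem wedge_B {f : ℝ → ℝ} {c um up : ℝ} {lam : ℂ} (v w : Fin 2 → ℂ) :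
    wedge (B f c um lam *ᵥ v) (B f c up lam *ᵥ w) =
      -((kappa f c um lam + kappa f c up lam) / 2) * (v 0 * w 1) +
      (kappa f c up lam - kappa f c um lam) / 2 * (v 0 * w 0) -
      (kappa f c up lam - kappa f c um lam) / 2 * (v 1 * w 1) +
      (kappa f c um lam + kappa f c up lam) / 2 * (v 1 * w 0) := by
  rw [wedge, Matrix.det_fin_two_of, B_mulVec, B_mulVec]
  simp only [Matrix.cons_val_zero, Matrix.cons_val_one, Matrix.cons_val_fin_one, mu1, mu2]
  ring

/-- Here `S` costs a factor `Λ` and `T` only `ρ = Λ⁻¹`. Every fast component contributes `ρ ^ 2`, so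
all terms other than the quadrature terms of the dominant product fall directly into the rate. -/
theorem evans_error_le {a b a' b' α β α' β' S T ι ι' : ℂ} {Q Q' C Λ ρ h R : ℝ} (hC : 1 ≤ C)
    (hρ : 0 < ρ) (hΛρ : Λ * ρ = 1) (hρ1 : ρ ≤ 1) (hh : 0 < h) (h1 : h ≤ 1)
    (hS : ‖S‖ ≤ C * Λ) (hT : ‖T‖ ≤ C * ρ) (hι : ‖ι‖ ≤ ρ) (hι' : ‖ι'‖ ≤ ρ)
    (hιι : ‖ι' - ι‖ ≤ C * ρ ^ 3) (hQ : |Q| ≤ C * h ^ 4) (hQ' : |Q'| ≤ C * h ^ 4)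
    (hR : R = h ^ 8 * ρ ^ 2 + h ^ 4 * ρ ^ 3 + h ^ 2 * ρ ^ 4)
    (ha : ‖a‖ ≤ C) (ha' : ‖a'‖ ≤ C) (hb : ‖b‖ ≤ C * ρ ^ 2) (hb' : ‖b'‖ ≤ C * ρ ^ 2)
    (hα : ‖α - a * (1 - ι * Q)‖ ≤ C * R) (hα' : ‖α' - a' * (1 - ι' * Q')‖ ≤ C * R)
    (hβ : ‖β - b‖ ≤ C * (h ^ 2 * ρ ^ 2)) (hβ' : ‖β' - b'‖ ≤ C * (h ^ 2 * ρ ^ 2)) :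
    ‖(-S * (a * a') + T * (a * b') - T * (b * a') + S * (b * b')) -
      (-S * (α * α') + T * (α * β') - T * (β * α') + S * (β * β'))‖ ≤
      50 * C ^ 5 * (ρ * h ^ 8 + ρ ^ 2 * h ^ 4 + ρ ^ 3 * h ^ 2 + |Q + Q'|) := by
  have hC0 : 0 ≤ C := by linarith
  have hΛ : 0 ≤ Λ := by
    by_contra hneg
    have : Λ * ρ < 0 := mul_neg_of_neg_of_pos (not_le.1 hneg) hρ
    linarith
  have hR0 : 0 ≤ R := by rw [hR]; positivity
  set P := ρ * h ^ 8 + ρ ^ 2 * h ^ 4 + ρ ^ 3 * h ^ 2 with hP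
  have hP0 : 0 ≤ P := by positivity
  have hP1 : ρ * h ^ 8 ≤ P := by
    have : 0 ≤ ρ ^ 2 * h ^ 4 + ρ ^ 3 * h ^ 2 := by positivity
    linarith
  have hP2 : ρ ^ 2 * h ^ 4 ≤ P := by
    have : 0 ≤ ρ * h ^ 8 + ρ ^ 3 * h ^ 2 := by positivity
    linarith
  have hP3 : ρ ^ 3 * h ^ 2 ≤ P := by
    have : 0 ≤ ρ * h ^ 8 + ρ ^ 2 * h ^ 4 := by positivity
    linarith
  have hΛR : Λ * R = P := by
    rw [hR, hP]
    linear_combination (h ^ 8 * ρ + h ^ 4 * ρ ^ 2 + h ^ 2 * ρ ^ 3) * hΛρ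
  have hh8 : h ^ 8 ≤ h ^ 2 := pow_le_pow_of_le_one hh.le h1 (by norm_num)
  have hh4 : h ^ 4 ≤ h ^ 2 := pow_le_pow_of_le_one hh.le h1 (by norm_num)
  have hh21 : h ^ 2 ≤ 1 := pow_le_one₀ hh.le h1
  have hR3 : R ≤ 3 * h ^ 2 := by
    have s1 : h ^ 8 * ρ ^ 2 ≤ h ^ 2 * 1 :=
      mul_le_mul hh8 (pow_le_one₀ hρ.le hρ1) (by positivity) (by positivity)
    have s2 : h ^ 4 * ρ ^ 3 ≤ h ^ 2 * 1 :=
      mul_le_mul hh4 (pow_le_one₀ hρ.le hρ1) (by positivity) (by positivity)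
    have s3 : h ^ 2 * ρ ^ 4 ≤ h ^ 2 * 1 :=
      mul_le_mul_of_nonneg_left (pow_le_one₀ hρ.le hρ1) (by positivity)
    rw [hR]
    linarith
  have hCC : C ≤ C ^ 2 := by
    calc C = C ^ 1 := (pow_one _).symm
      _ ≤ C ^ 2 := pow_le_pow_right₀ hC (by norm_num)
  have nQ : ‖(Q : ℂ)‖ ≤ C * h ^ 4 := by rwa [Complex.norm_real, Real.norm_eq_abs]
  have nQ' : ‖(Q' : ℂ)‖ ≤ C * h ^ 4 := by rwa [Complex.norm_real, Real.norm_eq_abs]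
  have nQQ : ‖((Q + Q' : ℝ) : ℂ)‖ ≤ |Q + Q'| := by rw [Complex.norm_real, Real.norm_eq_abs]
  have small : ∀ z : ℂ, ∀ q : ℝ, ‖z‖ ≤ ρ → ‖(q : ℂ)‖ ≤ C * h ^ 4 → ‖z * q‖ ≤ C * h ^ 2 := by
    intro z q hz hq
    refine (norm_mul_le_of_le hz hq).trans ?_
    calc ρ * (C * h ^ 4) ≤ 1 * (C * h ^ 2) := mul_le_mul hρ1
          (mul_le_mul_of_nonneg_left hh4 hC0) (by positivity) zero_le_one
      _ = _ := one_mul _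
  have diff : ∀ x x' z : ℂ, ∀ q : ℝ, ‖z‖ ≤ ρ → ‖(q : ℂ)‖ ≤ C * h ^ 4 → ‖x‖ ≤ C →
      ‖x' - x * (1 - z * q)‖ ≤ C * R → ‖x - x'‖ ≤ 4 * C ^ 2 * h ^ 2 := by
    intro x x' z q hz hq hx hx'
    have e : x - x' = x * (z * q) - (x' - x * (1 - z * q)) := by ring
    rw [e]
    refine (norm_sub_le _ _).trans ((add_le_add (norm_mul_le_of_le hx (small z q hz hq)) hx').trans ?_)
    have : C * R ≤ C ^ 2 * (3 * h ^ 2) := mul_le_mul hCC hR3 hR0 (by positivity)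
    linarith
  have u1 : ‖1 - ι * (Q : ℂ)‖ ≤ 2 * C := by
    refine (norm_sub_le _ _).trans ?_
    rw [norm_one]
    have : C * h ^ 2 ≤ C := mul_le_of_le_one_right hC0 hh21
    linarith [small ι Q hι nQ]
  have da := diff a α ι Q hι nQ ha hα
  have da' := diff a' α' ι' Q' hι' nQ' ha' hα'
  have nα' : ‖α'‖ ≤ 5 * C ^ 2 := by
    have e : α' = a' - (a' - α') := by ring
    rw [e]
    refine (norm_sub_le _ _).trans ?_
    have : 4 * C ^ 2 * h ^ 2 ≤ 4 * C ^ 2 := mul_le_of_le_one_right (by positivity) hh21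
    linarith
  have nβ' : ‖β'‖ ≤ 2 * C * ρ ^ 2 := by
    have e : β' = b' + (β' - b') := by ring
    rw [e]
    refine (norm_add_le _ _).trans ?_
    have : C * (h ^ 2 * ρ ^ 2) ≤ C * (1 * ρ ^ 2) := by gcongr
    linarith
  -- The first three terms come from expanding `(1 - ι * Q) * (1 - ι' * Q')`: the total quadrature
  -- error with the common factor `ι`, a correction with `ι' - ι = O(ρ ^ 3)`, and the product `Q *
  -- Q' = O(h ^ 8)`. The remaining terms are numerical errors.
  have e : (-S * (a * a') + T * (a * b') - T * (b * a') + S * (b * b')) -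
      (-S * (α * α') + T * (α * β') - T * (β * α') + S * (β * β')) =
      -(S * (a * a' * (((Q + Q' : ℝ) : ℂ) * ι))) - S * (a * a' * (Q' * (ι' - ι))) +
      S * (a * a' * (ι * ι' * (Q * Q'))) + S * ((α - a * (1 - ι * Q)) * α') +
      S * (a * (1 - ι * Q) * (α' - a' * (1 - ι' * Q'))) -
      T * (a * (β' - b')) + T * ((a - α) * β') -
      T * (b * (a' - α')) + T * ((β - b) * α') - S * (b * (β' - b')) - S * ((β - b) * β') := by
    push_cast
    ring
  have t1 := norm_mul_le_of_le hS (norm_mul_le_of_le (norm_mul_le_of_le ha ha')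
    (norm_mul_le_of_le nQQ hι))
  have t2 := norm_mul_le_of_le hS (norm_mul_le_of_le (norm_mul_le_of_le ha ha')
    (norm_mul_le_of_le nQ' hιι))
  have t3 := norm_mul_le_of_le hS (norm_mul_le_of_le (norm_mul_le_of_le ha ha')
    (norm_mul_le_of_le (norm_mul_le_of_le hι hι') (norm_mul_le_of_le nQ nQ')))
  have t4 := norm_mul_le_of_le hS (norm_mul_le_of_le hα nα')
  have t5 := norm_mul_le_of_le hS (norm_mul_le_of_le (norm_mul_le_of_le ha u1) hα')
  have t6 := norm_mul_le_of_le hT (norm_mul_le_of_le ha hβ')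
  have t7 := norm_mul_le_of_le hT (norm_mul_le_of_le da nβ')
  have t8 := norm_mul_le_of_le hT (norm_mul_le_of_le hb da')
  have t9 := norm_mul_le_of_le hT (norm_mul_le_of_le hβ nα')
  have t10 := norm_mul_le_of_le hS (norm_mul_le_of_le hb hβ')
  have t11 := norm_mul_le_of_le hS (norm_mul_le_of_le hβ nβ')
  have c5 : ∀ (k : ℕ) (x y : ℝ), k ≤ 5 → 0 ≤ x → x ≤ y → C ^ k * x ≤ C ^ 5 * y :=
    fun k x y hk hx hy => mul_le_mul (pow_le_pow_right₀ hC hk) hy hx (by positivity)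
  have r1 : C * Λ * (C * C * (|Q + Q'| * ρ)) ≤ C ^ 5 * |Q + Q'| := by
    calc _ = C ^ 3 * |Q + Q'| * (Λ * ρ) := by ring
      _ = C ^ 3 * |Q + Q'| := by rw [hΛρ, mul_one]
      _ ≤ _ := c5 3 _ _ (by norm_num) (abs_nonneg _) le_rfl
  have r2 : C * Λ * (C * C * (C * h ^ 4 * (C * ρ ^ 3))) ≤ C ^ 5 * P := by
    calc _ = C ^ 5 * (ρ ^ 2 * h ^ 4) * (Λ * ρ) := by ring
      _ = C ^ 5 * (ρ ^ 2 * h ^ 4) := by rw [hΛρ, mul_one]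
      _ ≤ _ := c5 5 _ _ le_rfl (by positivity) hP2
  have r3 : C * Λ * (C * C * (ρ * ρ * (C * h ^ 4 * (C * h ^ 4)))) ≤ C ^ 5 * P := by
    calc _ = C ^ 5 * (ρ * h ^ 8) * (Λ * ρ) := by ring
      _ = C ^ 5 * (ρ * h ^ 8) := by rw [hΛρ, mul_one]
      _ ≤ _ := c5 5 _ _ le_rfl (by positivity) hP1
  have r4 : C * Λ * (C * R * (5 * C ^ 2)) ≤ 5 * (C ^ 5 * P) := by
    calc _ = 5 * (C ^ 4 * (Λ * R)) := by ring
      _ = 5 * (C ^ 4 * P) := by rw [hΛR]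
      _ ≤ _ := by linarith [c5 4 P P (by norm_num) hP0 le_rfl]
  have r5 : C * Λ * (C * (2 * C) * (C * R)) ≤ 2 * (C ^ 5 * P) := by
    calc _ = 2 * (C ^ 4 * (Λ * R)) := by ring
      _ = 2 * (C ^ 4 * P) := by rw [hΛR]
      _ ≤ _ := by linarith [c5 4 P P (by norm_num) hP0 le_rfl]
  have r6 : C * ρ * (C * (C * (h ^ 2 * ρ ^ 2))) ≤ C ^ 5 * P := by
    calc _ = C ^ 3 * (ρ ^ 3 * h ^ 2) := by ring
      _ ≤ _ := c5 3 _ _ (by norm_num) (by positivity) hP3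
  have r7 : C * ρ * (4 * C ^ 2 * h ^ 2 * (2 * C * ρ ^ 2)) ≤ 8 * (C ^ 5 * P) := by
    calc _ = 8 * (C ^ 4 * (ρ ^ 3 * h ^ 2)) := by ring
      _ ≤ _ := by linarith [c5 4 _ _ (by norm_num) (by positivity) hP3]
  have r8 : C * ρ * (C * ρ ^ 2 * (4 * C ^ 2 * h ^ 2)) ≤ 4 * (C ^ 5 * P) := by
    calc _ = 4 * (C ^ 4 * (ρ ^ 3 * h ^ 2)) := by ring
      _ ≤ _ := by linarith [c5 4 _ _ (by norm_num) (by positivity) hP3]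
  have r9 : C * ρ * (C * (h ^ 2 * ρ ^ 2) * (5 * C ^ 2)) ≤ 5 * (C ^ 5 * P) := by
    calc _ = 5 * (C ^ 4 * (ρ ^ 3 * h ^ 2)) := by ring
      _ ≤ _ := by linarith [c5 4 _ _ (by norm_num) (by positivity) hP3]
  have r10 : C * Λ * (C * ρ ^ 2 * (C * (h ^ 2 * ρ ^ 2))) ≤ C ^ 5 * P := by
    calc _ = C ^ 3 * (ρ ^ 3 * h ^ 2) * (Λ * ρ) := by ring
      _ = C ^ 3 * (ρ ^ 3 * h ^ 2) := by rw [hΛρ, mul_one]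
      _ ≤ _ := c5 3 _ _ (by norm_num) (by positivity) hP3
  have r11 : C * Λ * (C * (h ^ 2 * ρ ^ 2) * (2 * C * ρ ^ 2)) ≤ 2 * (C ^ 5 * P) := by
    calc _ = 2 * (C ^ 3 * (ρ ^ 3 * h ^ 2)) * (Λ * ρ) := by ring
      _ = 2 * (C ^ 3 * (ρ ^ 3 * h ^ 2)) := by rw [hΛρ, mul_one]
      _ ≤ _ := by linarith [c5 3 _ _ (by norm_num) (by positivity) hP3]
  rw [e]
  refine (norm_sub_le_of_le (norm_sub_le_of_le (norm_add_le_of_le (norm_sub_le_of_le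
    (norm_add_le_of_le (norm_sub_le_of_le (norm_add_le_of_le (norm_add_le_of_le (norm_add_le_of_le
      (norm_sub_le_of_le ((norm_neg _).trans_le (t1.trans r1)) (t2.trans r2)) (t3.trans r3))
      (t4.trans r4)) (t5.trans r5)) (t6.trans r6)) (t7.trans r7)) (t8.trans r8)) (t9.trans r9))
      (t10.trans r10)) (t11.trans r11)).trans ?_
  have f1 : 0 ≤ C ^ 5 * P := by positivity
  have f2 : 0 ≤ C ^ 5 * |Q + Q'| := by positivity
  calc _ = 30 * (C ^ 5 * P) + C ^ 5 * |Q + Q'| := by ring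
    _ ≤ 50 * (C ^ 5 * P) + 50 * (C ^ 5 * |Q + Q'|) := by linarith
    _ = _ := by ring

theorem rate_eq {lam : ℂ} {Λ : ℝ} (hΛ : 0 < Λ) (h2 : ‖lam‖ = Λ ^ 2) (h : ℝ) :
    rate lam h = Λ⁻¹ * h ^ 8 + Λ⁻¹ ^ 2 * h ^ 4 + Λ⁻¹ ^ 3 * h ^ 2 := by
  have key : ∀ k : ℕ, ‖lam‖ ^ (-(k / 2) : ℝ) = Λ⁻¹ ^ k := by
    intro k
    rw [h2, ← Real.rpow_natCast Λ 2, ← Real.rpow_mul hΛ.le, inv_pow, ← Real.rpow_natCast Λ k,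
      ← Real.rpow_neg hΛ.le]
    congr 1
    push_cast
    ring
  have k1 := key 1
  have k3 := key 3
  norm_num at k1 k3
  rw [rate, k1, k3, Real.rpow_neg_one, h2, inv_pow, inv_pow]

theorem norm_kappa_bounds {κ lam w : ℂ} {V : ℝ} (hκ : κ ^ 2 = 4 * lam + w) (hw : ‖w‖ ≤ V)
    (hbig : 5 * V + 5 ≤ ‖κ‖) :
    1 ≤ √‖lam‖ ∧ √‖lam‖ ≤ ‖κ‖ ∧ ‖κ‖ ≤ 3 * √‖lam‖ := by
  have hV : 0 ≤ V := (norm_nonneg _).trans hw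
  have h1 : ‖κ‖ ^ 2 ≤ 4 * ‖lam‖ + V := by
    rw [← norm_pow, hκ]
    refine (norm_add_le _ _).trans (add_le_add (le_of_eq ?_) hw)
    rw [norm_mul]
    norm_num
  have h2 : 4 * ‖lam‖ - V ≤ ‖κ‖ ^ 2 := by
    have e : 4 * lam = κ ^ 2 - w := by rw [hκ]; ring
    have : 4 * ‖lam‖ = ‖4 * lam‖ := by rw [norm_mul]; norm_num
    rw [this, e, ← norm_pow]
    linarith [norm_sub_le (κ ^ 2) w]
  have h3 : ‖κ‖ ≤ ‖κ‖ ^ 2 := by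
    rw [sq]
    exact le_mul_of_one_le_left (norm_nonneg _) (by linarith)
  refine ⟨Real.one_le_sqrt.2 (by linarith), Real.sqrt_le_iff.2 ⟨norm_nonneg _, by linarith⟩, ?_⟩
  refine abs_le_of_sq_le_sq' ?_ (by positivity) |>.2
  rw [mul_pow, Real.sq_sqrt (norm_nonneg _)]
  linarith

/-- The product `(κ' - κ)(κ' + κ)` is bounded independently of `λ`, and the sum cannot cancel
because both numbers lie in the same sector of the right half-plane. -/
theorem norm_kappa_sub_le {κ κ' w w' : ℂ} {V δ Λ : ℝ} {lam : ℂ} (hδ : 0 < δ) (hΛ : 0 < Λ)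
    (hκ : κ ^ 2 = 4 * lam + w) (hκ' : κ' ^ 2 = 4 * lam + w') (hw : ‖w' - w‖ ≤ V)
    (hre : δ * ‖κ‖ ≤ κ.re) (hre' : δ * ‖κ'‖ ≤ κ'.re) (hl : Λ ≤ ‖κ‖) (hl' : Λ ≤ ‖κ'‖) :
    ‖κ' - κ‖ ≤ V / (2 * δ) * Λ⁻¹ := by
  have e : (κ' - κ) * (κ' + κ) = w' - w := by linear_combination hκ' - hκ
  have h1 : 2 * δ * Λ ≤ ‖κ' + κ‖ := by
    refine le_trans ?_ (Complex.re_le_norm _)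
    rw [Complex.add_re]
    have h2 : δ * Λ ≤ δ * ‖κ‖ := by gcongr
    have h3 : δ * Λ ≤ δ * ‖κ'‖ := by gcongr
    linarith
  have h4 : ‖κ' - κ‖ * (2 * δ * Λ) ≤ V := by
    calc _ ≤ ‖κ' - κ‖ * ‖κ' + κ‖ := by gcongr
      _ = ‖w' - w‖ := by rw [← norm_mul, e]
      _ ≤ V := hw
  rw [← div_eq_mul_inv, div_div]
  exact (le_div_iff₀ (by positivity)).2 h4

theorem left_side {f U : ℝ → ℝ} {c um up : ℝ} (hf : ContDiff ℝ ∞ f)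
    (hU : IsTravellingWave f c U um up) (hd : PhiDecaysExponentially f U um up) {δ : ℝ}
    (hδ : 0 < δ) :
    ∃ C K : ℝ, 1 ≤ C ∧ 1 ≤ K ∧ ∀ (h : ℝ) (N : ℕ) (lam : ℂ) (y : ℝ → Fin 2 → ℂ) (w : ℕ → Fin 2 → ℂ),
      0 < h → h ≤ 1 → δ * ‖kappa f c um lam‖ ≤ (kappa f c um lam).re →
      K ≤ h * ‖kappa f c um lam‖ → IsLeftSolution f c U um lam y →
      y (-(N * h)) =
        Complex.exp (mu1 f c um lam * ((-(N * h) : ℝ) : ℂ)) • (B f c um lam *ᵥ w 0) →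
      IsGaussLegendreRun (Abar f c U um (mu1 f c um lam) lam) h (-(N * h)) N w →
      ∃ a b : ℂ, y 0 = B f c um lam *ᵥ ![a, b] ∧
        ‖w N 0 - a * (1 - (kappa f c um lam)⁻¹ * (halfErr (psiLeft f U um) h N : ℝ))‖ ≤
          C * (h ^ 8 * ‖(kappa f c um lam)⁻¹‖ ^ 2 + h ^ 4 * ‖(kappa f c um lam)⁻¹‖ ^ 3 +
            h ^ 2 * ‖(kappa f c um lam)⁻¹‖ ^ 4) ∧
        ‖w N 1 - b‖ ≤ C * (h ^ 2 * ‖(kappa f c um lam)⁻¹‖ ^ 2) ∧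
        ‖a‖ ≤ C ∧ ‖b‖ ≤ C * ‖(kappa f c um lam)⁻¹‖ ^ 2 ∧
        |halfErr (psiLeft f U um) h N| ≤ C * h ^ 4 := by
  obtain ⟨C, K, hC, hK, H⟩ := one_sided (leftDecay_psiLeft hf hU hd) hδ
  refine ⟨C, K, hC, hK, fun h N lam y w hh h1 hre hKκ hy hw hrun => ?_⟩
  have hκ : kappa f c um lam ≠ 0 := by
    intro h0
    rw [h0, norm_zero, mul_zero] at hKκ
    linarith
  obtain ⟨a, b, ha, hb, hla, hlb, hab, hy0⟩ := hy.coeff hκ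
  obtain ⟨e0, e1⟩ := hab _ _ hw
  exact ⟨a 0, b 0, hy0, H h N _ a b (fun n => w n 0) (fun n => w n 1) hh h1 hre hKκ ha hb hla hlb
    e0 e1 fun n hn => (hrun n hn).left hκ⟩

theorem right_side {f U : ℝ → ℝ} {c um up : ℝ} (hf : ContDiff ℝ ∞ f)
    (hU : IsTravellingWave f c U um up) (hd : PhiDecaysExponentially f U um up) {δ : ℝ}
    (hδ : 0 < δ) :
    ∃ C K : ℝ, 1 ≤ C ∧ 1 ≤ K ∧ ∀ (h : ℝ) (N : ℕ) (lam : ℂ) (y : ℝ → Fin 2 → ℂ) (w : ℕ → Fin 2 → ℂ),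
      0 < h → h ≤ 1 → δ * ‖kappa f c up lam‖ ≤ (kappa f c up lam).re →
      K ≤ h * ‖kappa f c up lam‖ → IsRightSolution f c U up lam y →
      y (N * h) = Complex.exp (mu2 f c up lam * ((N * h : ℝ) : ℂ)) • (B f c up lam *ᵥ w 0) →
      IsGaussLegendreRun (Abar f c U up (mu2 f c up lam) lam) (-h) (N * h) N w →
      ∃ a b : ℂ, y 0 = B f c up lam *ᵥ ![b, a] ∧
        ‖w N 1 - a * (1 - (kappa f c up lam)⁻¹ * (halfErr (psiRight f U up) h N : ℝ))‖ ≤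
          C * (h ^ 8 * ‖(kappa f c up lam)⁻¹‖ ^ 2 + h ^ 4 * ‖(kappa f c up lam)⁻¹‖ ^ 3 +
            h ^ 2 * ‖(kappa f c up lam)⁻¹‖ ^ 4) ∧
        ‖w N 0 - b‖ ≤ C * (h ^ 2 * ‖(kappa f c up lam)⁻¹‖ ^ 2) ∧
        ‖a‖ ≤ C ∧ ‖b‖ ≤ C * ‖(kappa f c up lam)⁻¹‖ ^ 2 ∧
        |halfErr (psiRight f U up) h N| ≤ C * h ^ 4 := by
  obtain ⟨C, K, hC, hK, H⟩ := one_sided (leftDecay_psiRight hf hU hd) hδ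
  refine ⟨C, K, hC, hK, fun h N lam y w hh h1 hre hKκ hy hw hrun => ?_⟩
  have hκ : kappa f c up lam ≠ 0 := by
    intro h0
    rw [h0, norm_zero, mul_zero] at hKκ
    linarith
  obtain ⟨a, b, ha, hb, hla, hlb, hab, hy0⟩ := hy.coeff hκ
  obtain ⟨e0, e1⟩ := hab _ _ hw
  refine ⟨a 0, b 0, hy0, H h N _ a b (fun n => w n 1) (fun n => w n 0) hh h1 hre hKκ ha hb hla hlb
    e0 e1 fun n hn => ?_⟩
  have := hrun n hn
  -- The starting points of the backward steps are the reflections of the forward nodes on the left.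
  rw [show (N : ℝ) * h + n * -h = -(-(N * h) + n * h) by ring] at this
  exact this.right hκ

theorem scaled_bounds {C C₀ h q ρ : ℝ} (hC : C ≤ C₀) (hC0 : 0 ≤ C) (hq : 0 ≤ q)
    (hqρ : q ≤ ρ) :
    C * (h ^ 8 * q ^ 2 + h ^ 4 * q ^ 3 + h ^ 2 * q ^ 4) ≤
      C₀ * (h ^ 8 * ρ ^ 2 + h ^ 4 * ρ ^ 3 + h ^ 2 * ρ ^ 4) ∧
    C * (h ^ 2 * q ^ 2) ≤ C₀ * (h ^ 2 * ρ ^ 2) ∧ C * q ^ 2 ≤ C₀ * ρ ^ 2 := by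
  have hC₀ : 0 ≤ C₀ := hC0.trans hC
  refine ⟨?_, ?_, ?_⟩ <;> gcongr

/-- The lower bound `1 ≤ ‖lam‖` is recorded for every `lam` in the regime because the lower bound on
the rate relies on it. -/
theorem norm_evansError_le {f U : ℝ → ℝ} {c um up : ℝ} (hf : ContDiff ℝ ∞ f)
    (hU : IsTravellingWave f c U um up) (hd : PhiDecaysExponentially f U um up) {ε : ℝ}
    (hε : 0 < ε) :
    ∃ C K : ℝ, 0 < C ∧ 0 < K ∧ ∀ (h : ℝ) (N : ℕ) (lam E : ℂ), 0 < h → h ≤ 1 →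
      InRegime f c um up ε K h lam → 1 ≤ ‖lam‖ ∧ (IsEvansError f c U um up lam h N E →
        ‖E‖ ≤ C * (rate lam h + |quadError f U h N|)) := by
  -- The minimum keeps `sin ε'` positive however large `ε` is; the sector for `ε` is contained in
  -- that for `ε'`.
  set ε' := min ε 1 with hε'
  have hε'0 : 0 < ε' := lt_min hε one_pos
  set δ := Real.sin ε' with hδdef
  have hδ : 0 < δ := Real.sin_pos_of_pos_of_lt_pi hε'0
    ((min_le_right _ _).trans_lt (by linarith [Real.pi_gt_three]))
  obtain ⟨C₁, K₁, hC₁, hK₁, H₁⟩ := left_side hf hU hd hδ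
  obtain ⟨C₂, K₂, hC₂, hK₂, H₂⟩ := right_side hf hU hd hδ
  set V := c ^ 2 + 4 * |deriv f um| + 4 * |deriv f up| with hV
  have hV0 : 0 ≤ V := by positivity
  have hVδ : 0 ≤ V / (2 * δ) := by positivity
  set C := C₁ + C₂ + 3 + V / (2 * δ) with hC
  have hC1 : 1 ≤ C := by linarith
  -- The terms `K₁`, `K₂` serve the two half-lines, and `5 * V + 5` makes both `‖κ‖` comparable to
  -- `√‖lam‖`.
  refine ⟨50 * C ^ 5, K₁ + K₂ + 5 * V + 5, by positivity, by linarith, ?_⟩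
  rintro h N lam E hh h1 ⟨ham, hap, hKm, hKp⟩
  have hrem : δ * ‖kappa f c um lam‖ ≤ (kappa f c um lam).re :=
    sin_mul_norm_le_re hε'0.le (ham.trans_le (by linarith [min_le_left ε 1]))
  have hrep : δ * ‖kappa f c up lam‖ ≤ (kappa f c up lam).re :=
    sin_mul_norm_le_re hε'0.le (hap.trans_le (by linarith [min_le_left ε 1]))
  have hw : ∀ u : ℝ, |deriv f u| ≤ |deriv f um| + |deriv f up| →
      ‖(c : ℂ) ^ 2 - 4 * ((deriv f u : ℝ) : ℂ)‖ ≤ V := by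
    intro u hu
    refine (norm_sub_le _ _).trans ?_
    rw [norm_pow, norm_mul, Complex.norm_real, Complex.norm_real, Real.norm_eq_abs,
      Real.norm_eq_abs, sq_abs]
    norm_num
    linarith
  have hsq : ∀ u : ℝ, kappa f c u lam ^ 2 = 4 * lam + ((c : ℂ) ^ 2 - 4 * ((deriv f u : ℝ) : ℂ)) := by
    intro u
    rw [kappa_sq]
    ring
  have hκm : h * ‖kappa f c um lam‖ ≤ ‖kappa f c um lam‖ := mul_le_of_le_one_left (norm_nonneg _) h1
  have hκp : h * ‖kappa f c up lam‖ ≤ ‖kappa f c up lam‖ := mul_le_of_le_one_left (norm_nonneg _) h1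
  obtain ⟨hΛ1, hlm, hum⟩ := norm_kappa_bounds (hsq um)
    (hw um (by linarith [abs_nonneg (deriv f up)])) (by linarith)
  obtain ⟨-, hlp, hup⟩ := norm_kappa_bounds (hsq up)
    (hw up (by linarith [abs_nonneg (deriv f um)])) (by linarith)
  refine ⟨Real.one_le_sqrt.1 hΛ1, ?_⟩
  rintro ⟨ym, yp, wm, wp, hym, hyp, hm0, hp0, hrm, hrp, rfl⟩
  obtain ⟨a, b, hy0, hα, hβ, ha, hb, hQ⟩ :=
    H₁ h N lam ym wm hh h1 hrem (by linarith) hym hm0 hrm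
  obtain ⟨a', b', hy0', hα', hβ', ha', hb', hQ'⟩ :=
    H₂ h N lam yp wp hh h1 hrep (by linarith) hyp hp0 hrp
  set Λ := √‖lam‖ with hΛ
  have hΛ0 : 0 < Λ := by linarith
  have hκm0 : kappa f c um lam ≠ 0 := norm_pos_iff.1 (by linarith)
  have hκp0 : kappa f c up lam ≠ 0 := norm_pos_iff.1 (by linarith)
  have hqm : ‖(kappa f c um lam)⁻¹‖ ≤ Λ⁻¹ := by
    rw [norm_inv]
    exact inv_anti₀ hΛ0 hlm
  have hqp : ‖(kappa f c up lam)⁻¹‖ ≤ Λ⁻¹ := by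
    rw [norm_inv]
    exact inv_anti₀ hΛ0 hlp
  have hsub : ‖kappa f c up lam - kappa f c um lam‖ ≤ V / (2 * δ) * Λ⁻¹ :=
    norm_kappa_sub_le hδ hΛ0 (hsq um) (hsq up) (by
      rw [sub_sub_sub_cancel_left, ← mul_sub, ← Complex.ofReal_sub, norm_mul, Complex.norm_real,
        Real.norm_eq_abs]
      norm_num
      linarith [abs_sub (deriv f um) (deriv f up), sq_nonneg c]) hrem hrep hlm hlp
  obtain ⟨m1, m2, m3⟩ := scaled_bounds (h := h) (C₀ := C) (by linarith) (by linarith) (norm_nonneg _) hqm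
    (C := C₁)
  obtain ⟨p1, p2, p3⟩ := scaled_bounds (h := h) (C₀ := C) (by linarith) (by linarith) (norm_nonneg _) hqp
    (C := C₂)
  have hCΛ : V / (2 * δ) * Λ⁻¹ ≤ C * Λ⁻¹ := by
    have : V / (2 * δ) ≤ C := by linarith
    gcongr
  have h4 : C₁ * h ^ 4 ≤ C * h ^ 4 := mul_le_mul_of_nonneg_right (by linarith) (by positivity)
  have h4' : C₂ * h ^ 4 ≤ C * h ^ 4 := mul_le_mul_of_nonneg_right (by linarith) (by positivity)
  have main := evans_error_le (S := (kappa f c um lam + kappa f c up lam) / 2)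
    (T := (kappa f c up lam - kappa f c um lam) / 2) (Λ := Λ) (ρ := Λ⁻¹) hC1 (inv_pos.2 hΛ0)
    (mul_inv_cancel₀ hΛ0.ne') (inv_le_one_of_one_le₀ hΛ1) hh h1
    (by
      rw [norm_div, Complex.norm_two]
      have := norm_add_le (kappa f c um lam) (kappa f c up lam)
      have : 3 * Λ ≤ C * Λ := by
        have : 3 ≤ C := by linarith
        gcongr
      linarith)
    (by
      rw [norm_div, Complex.norm_two]
      have := norm_nonneg (kappa f c up lam - kappa f c um lam)
      linarith)
    hqm hqp
    (by
      have e : (kappa f c up lam)⁻¹ - (kappa f c um lam)⁻¹ =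
          -((kappa f c up lam - kappa f c um lam) *
            ((kappa f c up lam)⁻¹ * (kappa f c um lam)⁻¹)) := by
        field_simp
        ring
      rw [e, norm_neg]
      calc _ ≤ C * Λ⁻¹ * (Λ⁻¹ * Λ⁻¹) :=
            norm_mul_le_of_le (hsub.trans hCΛ) (norm_mul_le_of_le hqp hqm)
        _ = _ := by ring)
    (hQ.trans h4) (hQ'.trans h4') rfl (by linarith) (by linarith) (hb.trans m3) (hb'.trans p3)
    (hα.trans m1) (hα'.trans p1) (hβ.trans m2) (hβ'.trans p2)
  rw [rate_eq hΛ0 (Real.sq_sqrt (norm_nonneg lam)).symm,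
    quadError_eq_halfErr_add (hU.contDiff_phi hf).continuous um up]
  rw [hy0, hy0', wedge_B, wedge_B]
  convert main using 2
  simp only [Matrix.cons_val_zero, Matrix.cons_val_one, Matrix.cons_val_fin_one]

/-- The polynomial bound on `‖lam‖` is needed because the rate tends to zero as `|λ| → ∞` whereas
the quadrature error does not depend on `λ`. The term with `h ^ 8` already suffices. -/
theorem rate_lower {lam : ℂ} {h : ℝ} {p : ℕ} (hh : 0 < h) (hl : 1 ≤ ‖lam‖)
    (hp : ‖lam‖ ≤ (1 / h) ^ p) : h ^ (p + 8) ≤ rate lam h := by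
  have hl0 : 0 < ‖lam‖ := by linarith
  have e : h ^ p ≤ ‖lam‖ ^ (-(1 / 2) : ℝ) := by
    have s1 : h ^ p ≤ ‖lam‖⁻¹ := by
      rw [one_div, inv_pow] at hp
      exact (le_inv_comm₀ hl0 (by positivity)).1 hp
    refine s1.trans ?_
    rw [← Real.rpow_neg_one]
    exact Real.rpow_le_rpow_of_exponent_le hl (by norm_num)
  have t2 : 0 ≤ ‖lam‖ ^ (-1 : ℝ) * h ^ 4 := by positivity
  have t3 : 0 ≤ ‖lam‖ ^ (-(3 / 2) : ℝ) * h ^ 2 := by positivity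
  have t1 : h ^ p * h ^ 8 ≤ ‖lam‖ ^ (-(1 / 2) : ℝ) * h ^ 8 := by gcongr
  rw [rate, pow_add]
  linarith

end EvansGL

end

/-! ### Assembly: the three assertions -/

theorem mainTheorem4 (f : ℝ → ℝ) (c : ℝ) (U : ℝ → ℝ) (um up : ℝ)
    (hf : ContDiff ℝ ∞ f) (hU : IsTravellingWave f c U um up)
    (hdecay : PhiDecaysExponentially f U um up) (ε : ℝ) (hε : 0 < ε) :
    -- the error, including the quadrature error, which does not depend on `λ`
    (∃ C K h₀ : ℝ, 0 < C ∧ 0 < K ∧ 0 < h₀ ∧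
      ∀ (h : ℝ) (N : ℕ) (lam E : ℂ), 0 < h → h ≤ h₀ → InRegime f c um up ε K h lam →
        IsEvansError f c U um up lam h N E →
        ‖E‖ ≤ C * (rate lam h + |quadError f U h N|)) ∧
    -- the quadrature error is negligible
    (∀ m : ℕ, ∃ C θ : ℝ, 0 < C ∧ 0 < θ ∧
      ∀ (h : ℝ) (N : ℕ), 0 < h → h ≤ 1 →
        |quadError f U h N| ≤ C * (h ^ m + Real.exp (-(θ * (N * h))))) ∧
    -- the error when `L = N h` is so large that the quadrature error can be dropped
    (∀ p : ℕ, ∃ C K h₀ M : ℝ, 0 < C ∧ 0 < K ∧ 0 < h₀ ∧ 0 < M ∧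
      ∀ (h : ℝ) (N : ℕ) (lam E : ℂ), 0 < h → h ≤ h₀ → InRegime f c um up ε K h lam →
        ‖lam‖ ≤ (1 / h) ^ p → M * Real.log (1 / h) ≤ N * h →
        IsEvansError f c U um up lam h N E →
        ‖E‖ ≤ C * rate lam h) := by
  obtain ⟨C, K, hC, hK, H⟩ := norm_evansError_le hf hU hdecay hε
  refine ⟨⟨C, K, 1, hC, hK, one_pos, fun h N lam E hh h1 hr hE => (H h N lam E hh h1 hr).2 hE⟩,
    fun m => negligible_quadError hf hU hdecay m, fun p => ?_⟩
  -- The order `p + 8` matches the lower bound `h ^ (p + 8)` on the rate.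
  obtain ⟨C', θ, hC', hθ, hQ⟩ := negligible_quadError hf hU hdecay (p + 8)
  -- With `M = (p + 8) / θ`, the assumption on `N * h` makes the exponential tail at most `h ^ (p +
  -- 8)` as well; hence the factor two.
  refine ⟨C * (1 + 2 * C'), K, 1, (p + 8 : ℕ) / θ, by positivity, hK, one_pos, by positivity, ?_⟩
  intro h N lam E hh h1 hr hp hN hE
  obtain ⟨hl, hE'⟩ := H h N lam E hh h1 hr
  have hrate := rate_lower hh hl hp
  have hexp : Real.exp (-(θ * (N * h))) ≤ h ^ (p + 8) := by
    rw [one_div, Real.log_inv, div_mul_eq_mul_div, div_le_iff₀ hθ] at hN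
    rw [← Real.exp_log (pow_pos hh (p + 8)), Real.log_pow, Real.exp_le_exp]
    linarith
  have hq : |quadError f U h N| ≤ C' * (2 * rate lam h) :=
    (hQ h N hh h1).trans (mul_le_mul_of_nonneg_left (by linarith) hC'.le)
  calc ‖E‖ ≤ C * (rate lam h + |quadError f U h N|) := hE' hE
    _ ≤ C * (rate lam h + C' * (2 * rate lam h)) := by gcongr
    _ = C * (1 + 2 * C') * rate lam h := by ring
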